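/- Let $U\in C^2(\mathbb R)$ be a double-well potential: it has two local minima $x_-<x_+$ and a local maximum $x_0\in(x_-,x_+)$, and $U''\neq 0$ at $x_-,x_0,x_+$. Let $c_1<c_0$ and $\lambda_0,\lambda_1>0$. Let $\xi$ be the Markov process on $\{0,1\}$ whose holding times are independent, those in state $i$ being exponential with parameter $\lambda_i$; let $\mathbb T(t)=\int_0^t c_{\xi(s)}\,ds$, let $X$ be the continuous solution of $dX(t)=-U'(X(t))\,dt+d\mathbb T(t)$, $X(0)=x$, and let $P_t$ be the transition function of the Markov process $\Xi=(X,\xi)$ on $\mathbb R\times\{0,1\}$. Let $G=(a,b)$, $a<b$, be an invariant attractor, i.e. $U'(a)=c_1$, $U'(b)=c_0$ and $c_1<U'(x)<c_0$ for $a<x<b$. Let $\Phi_0,\Phi_1$ be any functions on $(a,b)$ with $\Phi_i'(x)=1/(c_i-U'(x))$, let $\Psi=\exp(\lambda_0\Phi_0+\lambda_1\Phi_1)$, and put, for $x\in G$, $$\pi_0(x)=C_0\frac{\Psi(x)^{-1}}{c_0-U'(x)},\qquad \pi_1(x)=C_1\frac{\Psi(x)^{-1}}{U'(x)-c_1},$$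 $$C_0=\frac{\lambda_1}{\lambda_0+\lambda_1}\Big(\int_a^b\frac{\Psi(x)^{-1}dx}{c_0-U'(x)}\Big)^{-1},\qquad C_1=\frac{\lambda_0}{\lambda_0+\lambda_1}\Big(\int_a^b\frac{\Psi(x)^{-1}dx}{U'(x)-c_1}\Big)^{-1}.$$ Theorem. For every starting point $x\in[a,b]$ and every initial state of $\xi$, the process $X$ almost surely exists for all $t\ge0$ and stays in $[a,b]$. The two integrals above are finite and positive, $C_i>0$ and $\pi_i>0$ on $G$, and $$\int_a^b\pi_0(x)\,dx=\frac{\lambda_1}{\lambda_0+\lambda_1},\qquad \int_a^b\pi_1(x)\,dx=\frac{\lambda_0}{\lambda_0+\lambda_1}.$$ The measure $\mu$ on $\mathbb R\times\{0,1\}$ which is concentrated on $G\times\{0,1\}$ and has density $\pi_i$ on $G\times\{i\}$, $i\in\{0,1\}$, is a probability measure with topological support $[a,b]\times\{0,1\}$, and it is invariant: $\mu P_t=\mu$ for all $t\ge 0$. It is the only invariant probability measure of $\Xi$ that is carried by $[a,b]\times\{0,1\}$. -/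

import Mathlib

open MeasureTheory ProbabilityTheory Set

noncomputable section

namespace TelegraphPotential

/-- A double-well potential: a `C²` function with two local minima separated by a local maximum,
the second derivative being nonzero at these three points. -/
def IsDoubleWell (U : ℝ → ℝ) : Prop :=
  ContDiff ℝ 2 U ∧ ∃ xm x0 xp : ℝ, xm < x0 ∧ x0 < xp ∧
    IsLocalMin U xm ∧ IsLocalMax U x0 ∧ IsLocalMin U xp ∧
    deriv (deriv U) xm ≠ 0 ∧ deriv (deriv U) x0 ≠ 0 ∧ deriv (deriv U) xp ≠ 0

/-! ### The two-state Markov process `ξ` -/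

/-- The state reached from `i` after `n` switchings. -/
def stateAfter (i : Fin 2) (n : ℕ) : Fin 2 := if Even n then i else 1 - i

/-- The law of the sequence of holding times of `ξ` when `ξ(0) = i`: they are independent, and
the `n`-th one is exponential with the intensity of the state occupied after `n` switchings. -/
def holdingLaw (l : Fin 2 → ℝ) (i : Fin 2) : Measure (ℕ → ℝ) :=
  Measure.infinitePi fun n => expMeasure (l (stateAfter i n))

/-- The time of the `n`-th switching, `s` being the sequence of holding times. -/
def switchTime (s : ℕ → ℝ) (n : ℕ) : ℝ := ∑ k ∈ Finset.range n, s k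

/-- The number of switchings up to time `t`. -/
def switchCount (s : ℕ → ℝ) (t : ℝ) : ℕ := {n : ℕ | switchTime s (n + 1) ≤ t}.ncard

/-- The path of `ξ` with `ξ(0) = i` and holding times `s`. -/
def switching (i : Fin 2) (s : ℕ → ℝ) (t : ℝ) : Fin 2 := stateAfter i (switchCount s t)

/-! ### The telegraph process and the process `X` -/

/-- The telegraph process `𝕋(t) = ∫₀ᵗ c_{ξ(s)} ds` driven by the path `ξ`. -/
def telegraph (c : Fin 2 → ℝ) (ξ : ℝ → Fin 2) (t : ℝ) : ℝ := ∫ s in (0 : ℝ)..t, c (ξ s)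

/-- `X` is a continuous solution on `[0, ∞)` of `dX(t) = -U'(X(t)) dt + d𝕋(t)`, `X(0) = x`. -/
def IsTrajectory (U : ℝ → ℝ) (c : Fin 2 → ℝ) (ξ : ℝ → Fin 2) (x : ℝ) (X : ℝ → ℝ) : Prop :=
  ContinuousOn X (Ici 0) ∧
    ∀ t, 0 ≤ t → X t = x - (∫ s in (0 : ℝ)..t, deriv U (X s)) + telegraph c ξ t

open Classical in
/-- The solution of `dX(t) = -U'(X(t)) dt + d𝕋(t)`, `X(0) = x`. It is unique on `[0, ∞)` since
`U'` is locally Lipschitz; when there is no solution on all of `[0, ∞)`, the value is a dummy. -/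
def trajectory (U : ℝ → ℝ) (c : Fin 2 → ℝ) (ξ : ℝ → Fin 2) (x : ℝ) : ℝ → ℝ :=
  if h : ∃ X, IsTrajectory U c ξ x X then h.choose else fun _ => x

/-- The path of the Markov process `Ξ = (X, ξ)` started at `z = (x, i)`. -/
def path (U : ℝ → ℝ) (c : Fin 2 → ℝ) (z : ℝ × Fin 2) (s : ℕ → ℝ) (t : ℝ) : ℝ × Fin 2 :=
  (trajectory U c (switching z.2 s) z.1 t, switching z.2 s t)

/-- The transition probability `P_t(z, A) = ℙ(Ξ(t) ∈ A | Ξ(0) = z)`. -/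
def transitionProb (U : ℝ → ℝ) (c l : Fin 2 → ℝ) (t : ℝ) (z : ℝ × Fin 2)
    (A : Set (ℝ × Fin 2)) : ENNReal :=
  holdingLaw l z.2 {s | path U c z s t ∈ A}

/-- `ν` is an invariant measure of `Ξ`: `ν P_t = ν` for every `t ≥ 0`. -/
def IsInvariantMeasure (U : ℝ → ℝ) (c l : Fin 2 → ℝ) (ν : Measure (ℝ × Fin 2)) : Prop :=
  ∀ t, 0 ≤ t → ∀ A : Set (ℝ × Fin 2), MeasurableSet A →
    ∫⁻ z, transitionProb U c l t z A ∂ν = ν A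

/-! ### Attractors and the stationary densities -/

/-- `G = (a, b)` is an invariant attractor: `a` is a critical point of `U(x) - c₁ x`, `b` is a
critical point of `U(x) - c₀ x`, and `c₁ < U' < c₀` in between. -/
structure IsAttractor (U : ℝ → ℝ) (c : Fin 2 → ℝ) (a b : ℝ) : Prop where
  lt : a < b
  left : deriv U a = c 1
  right : deriv U b = c 0
  between : ∀ x ∈ Ioo a b, c 1 < deriv U x ∧ deriv U x < c 0

/-- `Φ₀, Φ₁` are rectifying functions on `(a, b)`: `Φᵢ' = 1 / (cᵢ - U')`. -/
def IsRectifying (U : ℝ → ℝ) (c : Fin 2 → ℝ) (a b : ℝ) (Φ : Fin 2 → ℝ → ℝ) : Prop :=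
  ∀ i, ∀ x ∈ Ioo a b, HasDerivAt (Φ i) (1 / (c i - deriv U x)) x

/-- `Ψ = exp (λ₀ Φ₀ + λ₁ Φ₁)`. -/
def Psi (l : Fin 2 → ℝ) (Φ : Fin 2 → ℝ → ℝ) (x : ℝ) : ℝ :=
  Real.exp (l 0 * Φ 0 x + l 1 * Φ 1 x)

/-- The measure on `ℝ × {0, 1}` concentrated on `(a, b) × {0, 1}` which has the density `p i` with
respect to Lebesgue measure on `(a, b) × {i}`. -/
def measureOfDensities (a b : ℝ) (p : Fin 2 → ℝ → ℝ) : Measure (ℝ × Fin 2) :=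
  ∑ i : Fin 2, ((volume.restrict (Ioo a b)).withDensity fun x => ENNReal.ofReal (p i x)).map
    fun x => (x, i)

end TelegraphPotential

end

/-! On the attractor the velocity v_i = c_i - U' has constant sign, + for i = 0 and - for i = 1. At
a only v_1 vanishes and at b only v_0, so no trajectory leaves [a, b].

Stationary densities satisfy (v_i p_i)' = λ_{1-i} p_{1-i} - λ_i p_i. Adding the two equations shows
that the total flux v_0 p_0 + v_1 p_1 is constant. For zero flux, |v_0| p_0 and |v_1| p_1 are the
same function, which solves a linear first-order equation and is therefore a multiple of Ψ⁻¹. This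
is the content of `velocity_mul_weight` and `hasDerivAt_inv_Psi`. Since U' is Lipschitz on [a, b],
the vanishing velocity is at most linear at its endpoint, so the rectifying function diverges at
least logarithmically and Ψ⁻¹ tends to 0 at a and b. Hence integration by parts against Ψ⁻¹ has no
boundary terms (`integral_deriv_mul_inv_Psi`). The constant test function gives λ_0 ∫ w_0 = λ_1 ∫
w_1, which makes C_0 = C_1, so that μ is a single multiple of the unnormalised weights.

Invariance. Applying the generator to P_t f would require regularity of P_t f in space. Two Duhamel
formulas are used instead: the weights transported by a frozen flow (`lintegral_weightMeasure_eq`),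
and P_t decomposed at the first switching (`killedSemigroup_renewal`). The time integral of
σ_i(P_{t-r} f(·, 1-i)) is expanded by each formula. After weighting by λ_i and summing over i, the
common double integrals cancel, and what is left says that μ P_t = μ (`sum_lintegral_lsemigroup`).

Uniqueness. A short-time expansion with error O(t²) turns invariance of ν into the weak stationary
equation for C¹ test functions (`integral_generator_eq_zero`). A du Bois-Reymond argument with test
functions F Ψ shows that on (a, b) the two components of ν are a common multiple of the weights
(`IsStationaryPair.exists_restrict_eq`). Atoms at a and b are excluded by the flux identity where
the velocity is nonzero, and by the switching terms where it vanishes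
(`IsStationaryPair.exists_eq_smul`). The total mass then fixes the multiple. -/

noncomputable section

open Filter Topology
open scoped NNReal ENNReal

namespace TelegraphPotential

variable {U : ℝ → ℝ} {c l : Fin 2 → ℝ} {a b : ℝ} {Φ : Fin 2 → ℝ → ℝ}

/-! ### Ordinary differential equations on the half-line -/

/-- Global forward solutions exist for a bounded vector field that is Lipschitz in space and
continuous in time. -/
theorem exists_forward_solution {v : ℝ → ℝ → ℝ} {K M : ℝ≥0} (hK : ∀ t, LipschitzWith K (v t))
    (hv : ∀ x, Continuous fun t => v t x) (hM : ∀ t x, ‖v t x‖ ≤ M) (x : ℝ) :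
    ∃ Y : ℝ → ℝ, Y 0 = x ∧ ∀ t, 0 ≤ t → HasDerivWithinAt Y (v t (Y t)) (Ici 0) t := by
  have key : ∀ n : ℕ, ∃ y : ℝ → ℝ, y 0 = x ∧
      ∀ t ∈ Icc (0 : ℝ) n, HasDerivWithinAt y (v t (y t)) (Icc 0 n) t := by
    intro n
    -- The field is bounded by M everywhere, so the ball of radius `M * n` holds every candidate
    -- solution up to time n and the interval need not be short.
    have hp : IsPicardLindelof v (tmin := 0) (tmax := n) ⟨0, le_rfl, Nat.cast_nonneg n⟩ x
        (M * n) 0 M K :=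
      { lipschitzOnWith := fun t _ => (hK t).lipschitzOnWith
        continuousOn := fun y _ => (hv y).continuousOn
        norm_le := fun t _ y _ => hM t y
        mul_max_le := by simp }
    exact hp.exists_eq_forall_mem_Icc_hasDerivWithinAt₀
  choose y hy0 hy using key
  have huniq : ∀ m n : ℕ, m ≤ n → EqOn (y m) (y n) (Icc 0 m) := by
    intro m n hmn
    have hmn' : (m : ℝ) ≤ n := Nat.cast_le.2 hmn
    have hd : ∀ k : ℕ, m ≤ k → ∀ t ∈ Ico (0 : ℝ) m,
        HasDerivWithinAt (y k) (v t (y k t)) (Ici t) t := by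
      intro k hk t ht
      have hk' : (m : ℝ) ≤ k := Nat.cast_le.2 hk
      have h1 := (hy k t ⟨ht.1, ht.2.le.trans hk'⟩).mono
        (Icc_subset_Icc_left ht.1 : Icc t (k : ℝ) ⊆ Icc 0 k)
      exact h1.mono_of_mem_nhdsWithin (Icc_mem_nhdsGE (ht.2.trans_le hk'))
    refine ODE_solution_unique_of_mem_Icc_right (v := v) (s := fun _ => univ)
      (fun t _ => (hK t).lipschitzOnWith) (fun t ht => (hy m t ht).continuousWithinAt)
      (hd m le_rfl) (fun _ _ => mem_univ _)
      (fun t ht => ((hy n t ⟨ht.1, ht.2.trans hmn'⟩).continuousWithinAt).mono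
        (Icc_subset_Icc_right hmn')) (hd n hmn) (fun _ _ => mem_univ _) ?_
    rw [hy0, hy0]
  have hglue : ∀ (n : ℕ) (t : ℝ), t ∈ Icc (0 : ℝ) n → y ⌈t⌉₊ t = y n t := by
    intro n t ht
    exact huniq _ _ (Nat.ceil_le.2 ht.2) ⟨ht.1, Nat.le_ceil t⟩
  refine ⟨fun t => y ⌈t⌉₊ t, hy0 _, fun t ht => ?_⟩
  -- With index ⌈t⌉₊ the point t could be the right endpoint; one more makes the interval a
  -- neighbourhood of t in [0, ∞).
  have hlt : t < (⌈t⌉₊ + 1 : ℕ) := (Nat.le_ceil t).trans_lt (by simp)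
  have hmem : t ∈ Icc (0 : ℝ) (⌈t⌉₊ + 1 : ℕ) := ⟨ht, hlt.le⟩
  have h1 := hy (⌈t⌉₊ + 1) t hmem
  have h2 : HasDerivWithinAt (fun t => y ⌈t⌉₊ t) (v t (y ⌈t⌉₊ t))
      (Icc 0 (⌈t⌉₊ + 1 : ℕ)) t := by
    rw [hglue _ t hmem]
    exact h1.congr (fun s hs => hglue _ s hs) (hglue _ t hmem)
  refine h2.mono_of_mem_nhdsWithin ?_
  rw [← Ici_inter_Iic]
  exact inter_mem self_mem_nhdsWithin (mem_nhdsWithin_of_mem_nhds (Iic_mem_nhds hlt))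

/-- The fundamental theorem of calculus on `[0, ∞)`. -/
theorem hasDerivWithinAt_of_integral {D g : ℝ → ℝ} {d : ℝ} (hg : ContinuousOn g (Ici 0))
    (hD : ∀ t, 0 ≤ t → D t = d + ∫ s in (0 : ℝ)..t, g s) {t : ℝ} (ht : 0 ≤ t) :
    HasDerivWithinAt D (g t) (Ici 0) t := by
  have hg' : Continuous fun s => g (max s 0) :=
    hg.comp_continuous (by fun_prop) fun s => le_max_right s 0
  have h1 : HasDerivAt (fun u => d + ∫ s in (0 : ℝ)..u, g (max s 0)) (g (max t 0)) t :=
    (hg'.integral_hasStrictDerivAt 0 t).hasDerivAt.const_add d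
  rw [max_eq_left ht] at h1
  have hcongr : ∀ u, 0 ≤ u → D u = d + ∫ s in (0 : ℝ)..u, g (max s 0) := by
    intro u hu
    rw [hD u hu]
    congr 1
    refine intervalIntegral.integral_congr fun s hs => ?_
    rw [uIcc_of_le hu] at hs
    simp only [max_eq_left hs.1]
  exact h1.hasDerivWithinAt.congr (fun u hu => hcongr u hu) (hcongr t ht)

/-- The integral form of an equation whose right-hand side is continuous on `[0, ∞)`. -/
theorem eq_add_integral_of_hasDerivWithinAt {D g : ℝ → ℝ} (hg : ContinuousOn g (Ici 0))
    (hD : ∀ t, 0 ≤ t → HasDerivWithinAt D (g t) (Ici 0) t) {t : ℝ} (ht : 0 ≤ t) :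
    D t = D 0 + ∫ s in (0 : ℝ)..t, g s := by
  have hint : IntervalIntegrable g volume 0 t :=
    (hg.mono (by rw [uIcc_of_le ht]; exact Icc_subset_Ici_self)).intervalIntegrable
  have h := intervalIntegral.integral_eq_sub_of_hasDeriv_right_of_le ht
    (fun s hs => ((hD s hs.1).continuousWithinAt).mono Icc_subset_Ici_self)
    (fun s hs => (hD s hs.1.le).mono (Ioi_subset_Ici hs.1.le)) hint
  linarith

/-- Grönwall's inequality for two solutions of an equation in integral form. -/
theorem abs_sub_le_of_integral_eq {V X Y : ℝ → ℝ} {S : Set ℝ} {K d T : ℝ} (hV : Continuous V)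
    (hK : ∀ x ∈ S, ∀ y ∈ S, |V x - V y| ≤ K * |x - y|)
    (hX : ContinuousOn X (Ici 0)) (hY : ContinuousOn Y (Ici 0))
    (hXS : ∀ t ∈ Icc 0 T, X t ∈ S) (hYS : ∀ t ∈ Icc 0 T, Y t ∈ S)
    (h : ∀ t ∈ Icc 0 T, X t - Y t =
      d - ((∫ s in (0 : ℝ)..t, V (X s)) - ∫ s in (0 : ℝ)..t, V (Y s))) :
    ∀ t ∈ Icc 0 T, |X t - Y t| ≤ |d| * Real.exp (K * t) := by
  have hVX : ContinuousOn (fun s => V (X s)) (Ici 0) := hV.comp_continuousOn hX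
  have hVY : ContinuousOn (fun s => V (Y s)) (Ici 0) := hV.comp_continuousOn hY
  have hint : ∀ {g : ℝ → ℝ}, ContinuousOn g (Ici 0) → ∀ t, 0 ≤ t →
      IntervalIntegrable g volume 0 t := fun hg t ht =>
    (hg.mono (by rw [uIcc_of_le ht]; exact Icc_subset_Ici_self)).intervalIntegrable
  have hD : ∀ t ∈ Icc 0 T, X t - Y t = d + ∫ s in (0 : ℝ)..t, -(V (X s) - V (Y s)) := by
    intro t ht
    rw [h t ht, intervalIntegral.integral_neg,
      intervalIntegral.integral_sub (hint hVX t ht.1) (hint hVY t ht.1)]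
    ring
  have hder : ∀ t, 0 ≤ t → HasDerivWithinAt
      (fun t => d + ∫ s in (0 : ℝ)..t, -(V (X s) - V (Y s))) (-(V (X t) - V (Y t))) (Ici 0) t :=
    fun t ht => hasDerivWithinAt_of_integral (hVX.sub hVY).neg (fun _ _ => rfl) ht
  intro t ht
  rw [hD t ht]
  have := norm_le_gronwallBound_of_norm_deriv_right_le
    (f := fun t => d + ∫ s in (0 : ℝ)..t, -(V (X s) - V (Y s)))
    (f' := fun t => -(V (X t) - V (Y t))) (δ := |d|) (K := K) (ε := 0) (a := 0) (b := T)
    (fun s hs => ((hder s hs.1).continuousWithinAt).mono Icc_subset_Ici_self)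
    (fun s hs => (hder s hs.1).mono (Ici_subset_Ici.2 hs.1))
    (by simp)
    (fun s hs => by
      have hs' : s ∈ Icc 0 T := ⟨hs.1, hs.2.le⟩
      rw [norm_neg, add_zero, ← hD s hs']
      exact hK _ (hXS s hs') _ (hYS s hs')) t ht
  simpa [gronwallBound_ε0] using this

/-- A function on `[0, ∞)` with `f' ≥ -K f` stays above `f(0) e^{-Kt}`. -/
theorem mul_exp_le_of_deriv_ge {f f' : ℝ → ℝ} {K : ℝ}
    (hf : ∀ t, 0 ≤ t → HasDerivWithinAt f (f' t) (Ici 0) t) (h : ∀ t, 0 ≤ t → -K * f t ≤ f' t)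
    {t : ℝ} (ht : 0 ≤ t) : f 0 * Real.exp (-K * t) ≤ f t := by
  have hmono : MonotoneOn (fun t => f t * Real.exp (K * t)) (Ici 0) := by
    have hd : ∀ t, 0 ≤ t → HasDerivWithinAt (fun t => f t * Real.exp (K * t))
        (f' t * Real.exp (K * t) + f t * (Real.exp (K * t) * K)) (Ici 0) t := by
      intro t ht
      refine (hf t ht).mul (HasDerivAt.hasDerivWithinAt ?_)
      simpa using ((hasDerivAt_id t).const_mul K).exp
    refine monotoneOn_of_hasDerivWithinAt_nonneg (convex_Ici 0)
      (fun t ht => (hd t ht).continuousWithinAt)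
      (f' := fun t => f' t * Real.exp (K * t) + f t * (Real.exp (K * t) * K)) ?_ ?_
    · intro t ht
      rw [interior_Ici] at ht ⊢
      exact (hd t (le_of_lt ht)).mono Ioi_subset_Ici_self
    · intro t ht
      rw [interior_Ici] at ht
      have h1 := h t (le_of_lt ht)
      have : f' t * Real.exp (K * t) + f t * (Real.exp (K * t) * K) =
        (f' t + K * f t) * Real.exp (K * t) := by ring
      rw [this]
      exact mul_nonneg (by linarith) (Real.exp_pos _).le
  have h2 := hmono self_mem_Ici (show t ∈ Ici 0 from ht) ht
  simp only [mul_zero, Real.exp_zero, mul_one] at h2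
  calc f 0 * Real.exp (-K * t) ≤ f t * Real.exp (K * t) * Real.exp (-K * t) := by gcongr
    _ = f t := by rw [mul_assoc, ← Real.exp_add]; simp

/-! ### The vector field on an attractor -/

theorem continuous_deriv_of_contDiff (hU : ContDiff ℝ 2 U) : Continuous (deriv U) :=
  hU.continuous_deriv (by norm_num)

theorem contDiff_deriv_of_contDiff (hU : ContDiff ℝ 2 U) : ContDiff ℝ 1 (deriv U) :=
  (contDiff_succ_iff_deriv (n := 1)).1 hU |>.2.2

theorem exists_lipschitz_deriv (hU : ContDiff ℝ 2 U) (p q : ℝ) :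
    ∃ K : ℝ≥0, LipschitzOnWith K (deriv U) (Icc p q) :=
  (contDiff_deriv_of_contDiff hU).contDiffOn.exists_lipschitzOnWith (by norm_num) (convex_Icc p q)
    isCompact_Icc

theorem IsAttractor.deriv_mem (hG : IsAttractor U c a b) {x : ℝ} (hx : x ∈ Icc a b) :
    deriv U x ∈ Icc (c 1) (c 0) := by
  have hc : c 1 < c 0 := by
    obtain ⟨y, hy⟩ := nonempty_Ioo.2 hG.lt
    exact (hG.between y hy).1.trans (hG.between y hy).2
  rcases eq_or_lt_of_le hx.1 with rfl | h1
  · rw [hG.left]; exact ⟨le_rfl, hc.le⟩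
  rcases eq_or_lt_of_le hx.2 with rfl | h2
  · rw [hG.right]; exact ⟨hc.le, le_rfl⟩
  exact ⟨(hG.between x ⟨h1, h2⟩).1.le, (hG.between x ⟨h1, h2⟩).2.le⟩

theorem IsAttractor.c_mem (hG : IsAttractor U c a b) (i : Fin 2) : c i ∈ Icc (c 1) (c 0) := by
  have h := hG.deriv_mem (left_mem_Icc.2 hG.lt.le)
  fin_cases i
  · exact ⟨h.1.trans h.2, le_rfl⟩
  · exact ⟨le_rfl, h.1.trans h.2⟩

theorem intervalIntegrable_comp (c : Fin 2 → ℝ) {ξ : ℝ → Fin 2} (hξ : Measurable ξ) (s t : ℝ) :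
    IntervalIntegrable (fun u => c (ξ u)) volume s t := by
  have hm : Measurable fun u => c (ξ u) := (measurable_of_finite c).comp hξ
  refine (intervalIntegrable_const (c := |c 0| + |c 1|)).mono_fun hm.aestronglyMeasurable ?_
  refine Eventually.of_forall fun u => ?_
  have h0 := abs_nonneg (c 0)
  have h1 := abs_nonneg (c 1)
  show |c (ξ u)| ≤ |(|c 0| + |c 1|)|
  rw [abs_of_nonneg (add_nonneg h0 h1)]
  generalize ξ u = i
  fin_cases i
  · exact le_add_of_nonneg_right h1
  · exact le_add_of_nonneg_left h0

theorem continuous_telegraph (c : Fin 2 → ℝ) {ξ : ℝ → Fin 2} (hξ : Measurable ξ) :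
    Continuous (telegraph c ξ) :=
  intervalIntegral.continuous_primitive (intervalIntegrable_comp c hξ) 0

/-! ### Existence and uniqueness of trajectories -/

/-- A continuous function that does not increase while it is above `b` stays below `b`. -/
theorem le_of_antitone_above {X : ℝ → ℝ} (hX : ContinuousOn X (Ici 0)) (h0 : X 0 ≤ b)
    (h : ∀ r t, 0 ≤ r → r ≤ t → (∀ s ∈ Ioc r t, b < X s) → X t ≤ X r) {t : ℝ} (ht : 0 ≤ t) :
    X t ≤ b := by
  by_contra! hlt
  -- `sSup A` is the last time before t at which X ≤ b; after it the hypothesis on excursions above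
  -- b applies.
  set A : Set ℝ := Icc 0 t ∩ X ⁻¹' Iic b with hA
  have hAc : IsClosed A :=
    (hX.mono Icc_subset_Ici_self).preimage_isClosed_of_isClosed isClosed_Icc isClosed_Iic
  have hne : A.Nonempty := ⟨0, ⟨le_rfl, ht⟩, h0⟩
  have hbdd : BddAbove A := ⟨t, fun s hs => hs.1.2⟩
  have hmem : sSup A ∈ A := hAc.csSup_mem hne hbdd
  have := h (sSup A) t hmem.1.1 hmem.1.2 fun s hs => by
    by_contra! hs'
    exact (hs.1.trans_le (le_csSup hbdd ⟨⟨hmem.1.1.trans hs.1.le, hs.2⟩, hs'⟩)).false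
  exact (hlt.trans_le (this.trans hmem.2)).false

/-- Composing U' with the projection onto [a, b] makes the field bounded and Lipschitz, so global
solutions exist. Above b the projected field equals c_ξ - c_0 ≤ 0, and below a it equals c_ξ - c_1 ≥
0. The solution therefore stays in [a, b], where the projection is the identity. -/
theorem exists_isTrajectory (hU : ContDiff ℝ 2 U) (hG : IsAttractor U c a b) {ξ : ℝ → Fin 2}
    (hξ : Measurable ξ) {x : ℝ} (hx : x ∈ Icc a b) :
    ∃ X, IsTrajectory U c ξ x X ∧ ∀ t, 0 ≤ t → X t ∈ Icc a b := by
  obtain ⟨K, hK⟩ := exists_lipschitz_deriv hU a b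
  set π : ℝ → ℝ := fun y => max a (min b y) with hπ
  have hπmem : ∀ y, π y ∈ Icc a b := fun y => ⟨le_max_left _ _, max_le hG.lt.le (min_le_left _ _)⟩
  have hπid : ∀ y ∈ Icc a b, π y = y := fun y hy => by simp [hπ, hy.1, hy.2]
  have hπlip : LipschitzWith 1 π := by
    refine LipschitzWith.const_max ?_ a
    exact LipschitzWith.id.const_min b
  have hVπ : LipschitzWith K fun y => deriv U (π y) := by
    have := hK.comp (hπlip.lipschitzOnWith (s := univ)) fun y _ => hπmem y
    rw [mul_one] at this
    exact lipschitzOnWith_univ.1 this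
  have htel := continuous_telegraph c hξ
  -- The unknown is Y = X - 𝕋: this moves the jumps of c_ξ out of the right-hand side, which becomes
  -- continuous in time.
  obtain ⟨Y, hY0, hY⟩ := exists_forward_solution
    (v := fun t y => -deriv U (π (y + telegraph c ξ t))) (K := K)
    (M := ⟨|c 0| + |c 1|, by positivity⟩)
    (fun t => by
      refine LipschitzWith.of_dist_le_mul fun y z => ?_
      have := hVπ.dist_le_mul (y + telegraph c ξ t) (z + telegraph c ξ t)
      simpa using this)
    (fun y => ((hVπ.continuous.comp (continuous_const.add htel))).neg)
    (fun t y => by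
      have := hG.deriv_mem (hπmem (y + telegraph c ξ t))
      rw [norm_neg, Real.norm_eq_abs]
      show _ ≤ |c 0| + |c 1|
      rw [abs_le]
      constructor <;> linarith [this.1, this.2, neg_abs_le (c 1), le_abs_self (c 0),
        abs_nonneg (c 0), abs_nonneg (c 1)]) x
  set X : ℝ → ℝ := fun t => Y t + telegraph c ξ t with hXdef
  have hYc : ContinuousOn Y (Ici 0) := fun t ht => (hY t ht).continuousWithinAt
  have hXc : ContinuousOn X (Ici 0) := hYc.add htel.continuousOn
  have hg : ContinuousOn (fun s => deriv U (π (X s))) (Ici 0) := hVπ.continuous.comp_continuousOn hXc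
  have hgint : ∀ r t, 0 ≤ r → r ≤ t →
      IntervalIntegrable (fun s => deriv U (π (X s))) volume r t := fun r t hr hrt =>
    (hg.mono (by
      rw [uIcc_of_le hrt]
      exact Icc_subset_Ici_self.trans (Ici_subset_Ici.2 hr))).intervalIntegrable
  have hXeq : ∀ t, 0 ≤ t → X t = x - (∫ s in (0 : ℝ)..t, deriv U (π (X s))) + telegraph c ξ t := by
    intro t ht
    have := eq_add_integral_of_hasDerivWithinAt hg.neg hY ht
    simp only [Pi.neg_apply] at this
    rw [intervalIntegral.integral_neg, hY0] at this
    simp only [hXdef]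
    rw [this]
    ring
  have hX0 : X 0 = x := by simpa [telegraph] using hXeq 0 le_rfl
  have hincr : ∀ r t, 0 ≤ r → r ≤ t →
      X t - X r = ∫ s in r..t, (c (ξ s) - deriv U (π (X s))) := by
    intro r t hr hrt
    rw [hXeq t (hr.trans hrt), hXeq r hr,
      intervalIntegral.integral_sub (intervalIntegrable_comp c hξ r t) (hgint r t hr hrt),
      telegraph, telegraph,
      ← intervalIntegral.integral_add_adjacent_intervals (hgint 0 r le_rfl hr) (hgint r t hr hrt),
      ← intervalIntegral.integral_add_adjacent_intervals (intervalIntegrable_comp c hξ 0 r)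
        (intervalIntegrable_comp c hξ r t)]
    ring
  have hle : ∀ t, 0 ≤ t → X t ≤ b := by
    intro t ht
    refine le_of_antitone_above hXc (hX0 ▸ hx.2) (fun r t hr hrt hs => ?_) ht
    have h1 : (∫ s in r..t, (c (ξ s) - deriv U (π (X s)))) ≤ ∫ s in r..t, (0 : ℝ) := by
      refine intervalIntegral.integral_mono_on_of_le_Ioo hrt
        ((intervalIntegrable_comp c hξ r t).sub (hgint r t hr hrt)) intervalIntegrable_const ?_
      intro s hs'
      have : π (X s) = b := by
        have := hs s ⟨hs'.1, hs'.2.le⟩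
        simp [hπ, this.le, hG.lt.le]
      rw [this, hG.right]
      linarith [(hG.c_mem (ξ s)).2]
    rw [← hincr r t hr hrt, intervalIntegral.integral_zero] at h1
    linarith
  have hge : ∀ t, 0 ≤ t → a ≤ X t := by
    intro t ht
    have := le_of_antitone_above (X := fun t => -X t) (b := -a) hXc.neg
      (by simpa [hX0] using hx.1) (fun r t hr hrt hs => ?_) ht
    · linarith
    have h1 : (∫ s in r..t, (0 : ℝ)) ≤ ∫ s in r..t, (c (ξ s) - deriv U (π (X s))) := by
      refine intervalIntegral.integral_mono_on_of_le_Ioo hrt intervalIntegrable_const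
        ((intervalIntegrable_comp c hξ r t).sub (hgint r t hr hrt)) ?_
      intro s hs'
      have : π (X s) = a := by
        have := neg_lt_neg_iff.1 (hs s ⟨hs'.1, hs'.2.le⟩)
        simp [hπ, this.le, (this.trans hG.lt).le]
      rw [this, hG.left]
      linarith [(hG.c_mem (ξ s)).1]
    rw [← hincr r t hr hrt, intervalIntegral.integral_zero] at h1
    linarith
  refine ⟨X, ⟨hXc, fun t ht => ?_⟩, fun t ht => ⟨hge t ht, hle t ht⟩⟩
  rw [hXeq t ht]
  congr 2
  refine intervalIntegral.integral_congr fun s hs => ?_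
  rw [uIcc_of_le ht] at hs
  simp only [hπid _ ⟨hge s hs.1, hle s hs.1⟩]

theorem IsTrajectory.zero {ξ : ℝ → Fin 2} {x : ℝ} {X : ℝ → ℝ} (hX : IsTrajectory U c ξ x X) :
    X 0 = x := by
  simpa [telegraph] using hX.2 0 le_rfl

/-- Trajectories from the same point driven by paths that agree up to time `T` agree up to `T`. -/
theorem IsTrajectory.eqOn (hU : ContDiff ℝ 2 U) {ξ η : ℝ → Fin 2} {x T : ℝ} {X Y : ℝ → ℝ}
    (hX : IsTrajectory U c ξ x X) (hY : IsTrajectory U c η x Y)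
    (h : ∀ t ∈ Ioo 0 T, ξ t = η t) : EqOn X Y (Icc 0 T) := by
  -- U' is only locally Lipschitz; both trajectories stay in a compact interval up to time T, which
  -- supplies the constant for Grönwall.
  have hXb := (isCompact_Icc (a := (0 : ℝ)) (b := T)).image_of_continuousOn
    (hX.1.mono Icc_subset_Ici_self)
  have hYb := (isCompact_Icc (a := (0 : ℝ)) (b := T)).image_of_continuousOn
    (hY.1.mono Icc_subset_Ici_self)
  obtain ⟨R, hR⟩ := (hXb.union hYb).isBounded.subset_closedBall 0
  rw [Real.closedBall_eq_Icc] at hR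
  obtain ⟨K, hK⟩ := exists_lipschitz_deriv hU (0 - R) (0 + R)
  have key := abs_sub_le_of_integral_eq (V := deriv U) (S := Icc (0 - R) (0 + R)) (K := K) (d := 0)
    (T := T) (continuous_deriv_of_contDiff hU)
    (fun x hx y hy => by simpa [Real.dist_eq] using hK.dist_le_mul x hx y hy) hX.1 hY.1
    (fun t ht => hR (Or.inl (mem_image_of_mem _ ht)))
    (fun t ht => hR (Or.inr (mem_image_of_mem _ ht)))
    (fun t ht => by
      rw [hX.2 t ht.1, hY.2 t ht.1]
      have : telegraph c ξ t = telegraph c η t := by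
        rw [telegraph, telegraph, intervalIntegral.integral_of_le ht.1,
          intervalIntegral.integral_of_le ht.1, integral_Ioc_eq_integral_Ioo,
          integral_Ioc_eq_integral_Ioo]
        refine setIntegral_congr_fun measurableSet_Ioo fun s hs => ?_
        simp only [h s ⟨hs.1, hs.2.trans_le ht.2⟩]
      rw [this]
      ring)
  intro t ht
  have := key t ht
  rw [abs_zero, zero_mul] at this
  exact sub_eq_zero.1 (abs_nonpos_iff.1 this)

theorem isTrajectory_trajectory (hU : ContDiff ℝ 2 U) (hG : IsAttractor U c a b) {ξ : ℝ → Fin 2}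
    (hξ : Measurable ξ) {x : ℝ} (hx : x ∈ Icc a b) :
    IsTrajectory U c ξ x (trajectory U c ξ x) := by
  obtain ⟨X, hX, -⟩ := exists_isTrajectory hU hG hξ hx
  have h : ∃ X, IsTrajectory U c ξ x X := ⟨X, hX⟩
  rw [trajectory, dif_pos h]
  exact h.choose_spec

/-- `trajectory` is an arbitrary choice among solutions; uniqueness identifies it with the confined
one just constructed. -/
theorem trajectory_mem (hU : ContDiff ℝ 2 U) (hG : IsAttractor U c a b) {ξ : ℝ → Fin 2}
    (hξ : Measurable ξ) {x : ℝ} (hx : x ∈ Icc a b) {t : ℝ} (ht : 0 ≤ t) :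
    trajectory U c ξ x t ∈ Icc a b := by
  obtain ⟨X, hX, hmem⟩ := exists_isTrajectory hU hG hξ hx
  rw [(isTrajectory_trajectory hU hG hξ hx).eqOn hU hX (fun _ _ => rfl) ⟨ht, le_rfl⟩]
  exact hmem t ht

/-- The Markov property of trajectories: restarting at time `r`. -/
theorem IsTrajectory.shift (hU : ContDiff ℝ 2 U) {ξ : ℝ → Fin 2} (hξ : Measurable ξ) {x r : ℝ}
    {X : ℝ → ℝ} (hX : IsTrajectory U c ξ x X) (hr : 0 ≤ r) :
    IsTrajectory U c (fun t => ξ (r + t)) (X r) fun t => X (r + t) := by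
  have hVX : ContinuousOn (fun s => deriv U (X s)) (Ici 0) :=
    (continuous_deriv_of_contDiff hU).comp_continuousOn hX.1
  have hint : ∀ p q, 0 ≤ p → p ≤ q → IntervalIntegrable (fun s => deriv U (X s)) volume p q :=
    fun p q hp hpq => (hVX.mono (by
      rw [uIcc_of_le hpq]
      exact Icc_subset_Ici_self.trans (Ici_subset_Ici.2 hp))).intervalIntegrable
  refine ⟨hX.1.comp (by fun_prop) fun t ht => add_nonneg hr ht, fun t ht => ?_⟩
  have h1 := intervalIntegral.integral_comp_add_left (a := 0) (b := t)
    (fun s => deriv U (X s)) r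
  have h2 := intervalIntegral.integral_comp_add_left (a := 0) (b := t) (fun s => c (ξ s)) r
  simp only [add_zero] at h1 h2
  show X (r + t) = X r - (∫ s in (0 : ℝ)..t, deriv U (X (r + s))) + _
  rw [hX.2 (r + t) (add_nonneg hr ht), hX.2 r hr, telegraph, telegraph, telegraph, h1, h2,
    ← intervalIntegral.integral_add_adjacent_intervals (hint 0 r le_rfl hr)
      (hint r (r + t) hr (by linarith)),
    ← intervalIntegral.integral_add_adjacent_intervals (intervalIntegrable_comp c hξ 0 r)
      (intervalIntegrable_comp c hξ r (r + t))]
  ring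

/-! ### The flow in a frozen state -/

/-- The projection of the line onto `[a, b]`. -/
def clamp (a b x : ℝ) : ℝ := max a (min b x)

theorem clamp_mem (hab : a ≤ b) (x : ℝ) : clamp a b x ∈ Icc a b :=
  ⟨le_max_left _ _, max_le hab (min_le_left _ _)⟩

theorem clamp_of_mem {x : ℝ} (hx : x ∈ Icc a b) : clamp a b x = x := by
  simp [clamp, hx.1, hx.2]

theorem continuous_clamp : Continuous (clamp a b) := by unfold clamp; fun_prop

/-- The position at time `t` of the solution of `X' = cᵢ - U'(X)` started at `x`; points outside
`[a, b]` are first projected onto it, and negative times are replaced by `0`. -/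
def flow (U : ℝ → ℝ) (c : Fin 2 → ℝ) (a b : ℝ) (i : Fin 2) (t x : ℝ) : ℝ :=
  trajectory U c (fun _ => i) (clamp a b x) (max t 0)

theorem flow_eq {i : Fin 2} {t x : ℝ} (ht : 0 ≤ t) (hx : x ∈ Icc a b) :
    flow U c a b i t x = trajectory U c (fun _ => i) x t := by
  rw [flow, clamp_of_mem hx, max_eq_left ht]

theorem isTrajectory_flow (hU : ContDiff ℝ 2 U) (hG : IsAttractor U c a b) (i : Fin 2) {x : ℝ}
    (hx : x ∈ Icc a b) : IsTrajectory U c (fun _ => i) x fun t => flow U c a b i t x := by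
  have h := isTrajectory_trajectory hU hG (measurable_const (a := i)) hx
  refine ⟨h.1.congr fun t ht => flow_eq ht hx, fun t ht => ?_⟩
  show flow U c a b i t x = x - (∫ s in (0 : ℝ)..t, deriv U (flow U c a b i s x)) + _
  rw [flow_eq ht hx, h.2 t ht]
  congr 2
  refine intervalIntegral.integral_congr fun s hs => ?_
  rw [uIcc_of_le ht] at hs
  simp only [flow_eq hs.1 hx]

theorem flow_mem (hU : ContDiff ℝ 2 U) (hG : IsAttractor U c a b) (i : Fin 2) (t x : ℝ) :
    flow U c a b i t x ∈ Icc a b :=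
  trajectory_mem hU hG measurable_const (clamp_mem hG.lt.le x) (le_max_right _ _)

theorem flow_zero (hU : ContDiff ℝ 2 U) (hG : IsAttractor U c a b) (i : Fin 2) {x : ℝ}
    (hx : x ∈ Icc a b) : flow U c a b i 0 x = x :=
  (isTrajectory_flow hU hG i hx).zero

theorem continuous_flow_time (hU : ContDiff ℝ 2 U) (hG : IsAttractor U c a b) (i : Fin 2) (x : ℝ) :
    Continuous fun t => flow U c a b i t x :=
  (isTrajectory_trajectory hU hG measurable_const (clamp_mem hG.lt.le x)).1.comp_continuous
    (by fun_prop) fun t => mem_Ici.2 (le_max_right t 0)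

theorem flow_eq_integral (hU : ContDiff ℝ 2 U) (hG : IsAttractor U c a b) (i : Fin 2) {x : ℝ}
    (hx : x ∈ Icc a b) {t : ℝ} (ht : 0 ≤ t) :
    flow U c a b i t x =
      x - (∫ s in (0 : ℝ)..t, deriv U (flow U c a b i s x)) + telegraph c (fun _ => i) t :=
  (isTrajectory_flow hU hG i hx).2 t ht

theorem hasDerivWithinAt_flow (hU : ContDiff ℝ 2 U) (hG : IsAttractor U c a b) (i : Fin 2) {x : ℝ}
    (hx : x ∈ Icc a b) {t : ℝ} (ht : 0 ≤ t) :
    HasDerivWithinAt (fun t => flow U c a b i t x) (c i - deriv U (flow U c a b i t x))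
      (Ici 0) t := by
  have hc : Continuous fun t => deriv U (flow U c a b i t x) :=
    (continuous_deriv_of_contDiff hU).comp (continuous_flow_time hU hG i x)
  refine hasDerivWithinAt_of_integral (D := fun t => flow U c a b i t x)
    (g := fun t => c i - deriv U (flow U c a b i t x)) (d := x)
    (continuous_const.sub hc).continuousOn (fun t ht => ?_) ht
  rw [flow_eq_integral hU hG i hx ht, telegraph,
    intervalIntegral.integral_sub intervalIntegrable_const (hc.intervalIntegrable _ _)]
  ring

theorem abs_flow_sub_le (hU : ContDiff ℝ 2 U) (hG : IsAttractor U c a b) (i : Fin 2) {x : ℝ}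
    (hx : x ∈ Icc a b) {t : ℝ} (ht : 0 ≤ t) :
    |flow U c a b i t x - x| ≤ (c 0 - c 1) * t := by
  have h := Convex.norm_image_sub_le_of_norm_hasDerivWithin_le (f := fun t => flow U c a b i t x)
    (C := c 0 - c 1) (s := Ici 0) (fun t ht => hasDerivWithinAt_flow hU hG i hx ht)
    (fun t ht => by
      have h1 := hG.deriv_mem (flow_mem hU hG i t x)
      have h2 := hG.c_mem i
      rw [Real.norm_eq_abs, abs_le]
      constructor <;> linarith [h1.1, h1.2, h2.1, h2.2]) (convex_Ici 0)
    (self_mem_Ici (a := (0 : ℝ))) (show t ∈ Ici 0 from ht)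
  rw [flow_zero hU hG i hx] at h
  simpa [abs_of_nonneg ht] using h

theorem abs_flow_sub_flow_le (hU : ContDiff ℝ 2 U) (hG : IsAttractor U c a b) (i : Fin 2) (t : ℝ) :
    ∃ C : ℝ≥0, LipschitzOnWith C (flow U c a b i t) (Icc a b) := by
  obtain ⟨K, hK⟩ := exists_lipschitz_deriv hU a b
  refine ⟨⟨Real.exp (K * max t 0), (Real.exp_pos _).le⟩, LipschitzOnWith.of_dist_le_mul ?_⟩
  intro x hx y hy
  have hX := isTrajectory_flow hU hG i hx
  have hY := isTrajectory_flow hU hG i hy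
  have := abs_sub_le_of_integral_eq (V := deriv U) (S := Icc a b) (K := K) (d := x - y)
    (T := max t 0) (continuous_deriv_of_contDiff hU)
    (fun x hx y hy => by simpa [Real.dist_eq] using hK.dist_le_mul x hx y hy) hX.1 hY.1
    (fun t _ => flow_mem hU hG i t x) (fun t _ => flow_mem hU hG i t y)
    (fun t ht => by
      rw [flow_eq_integral hU hG i hx ht.1, flow_eq_integral hU hG i hy ht.1]
      ring) (max t 0) ⟨le_max_right _ _, le_rfl⟩
  have h2 : ∀ z, flow U c a b i (max t 0) z = flow U c a b i t z := fun z => by simp [flow]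
  rw [h2, h2] at this
  rw [Real.dist_eq, Real.dist_eq, mul_comm]
  exact this

theorem continuous_flow_space (hU : ContDiff ℝ 2 U) (hG : IsAttractor U c a b) (i : Fin 2) (t : ℝ) :
    Continuous (flow U c a b i t) := by
  obtain ⟨C, hC⟩ := abs_flow_sub_flow_le hU hG i t
  have h : flow U c a b i t = fun x => flow U c a b i t (clamp a b x) := by
    funext x
    rw [flow, flow, clamp_of_mem (clamp_mem hG.lt.le x)]
  rw [h]
  exact hC.continuousOn.comp_continuous continuous_clamp fun x => clamp_mem hG.lt.le x

theorem measurable_flow (hU : ContDiff ℝ 2 U) (hG : IsAttractor U c a b) (i : Fin 2) :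
    Measurable fun p : ℝ × ℝ => flow U c a b i p.1 p.2 :=
  measurable_uncurry_of_continuous_of_measurable (u := fun t x => flow U c a b i t x)
    (fun x => continuous_flow_time hU hG i x) fun t => (continuous_flow_space hU hG i t).measurable

/-- The flow preserves the interior of the attractor. -/
theorem flow_mem_Ioo (hU : ContDiff ℝ 2 U) (hG : IsAttractor U c a b) (i : Fin 2) {x : ℝ}
    (hx : x ∈ Ioo a b) {t : ℝ} (ht : 0 ≤ t) : flow U c a b i t x ∈ Ioo a b := by
  obtain ⟨K, hK⟩ := exists_lipschitz_deriv hU a b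
  have hx' := Ioo_subset_Icc_self hx
  have hd := fun t ht => hasDerivWithinAt_flow hU hG i hx' (t := t) ht
  have hlip : ∀ y ∈ Icc a b, ∀ z ∈ Icc a b, |deriv U y - deriv U z| ≤ K * |y - z| :=
    fun x hx y hy => by simpa [Real.dist_eq] using hK.dist_le_mul x hx y hy
  have hci := hG.c_mem i
  constructor
  -- Since c_i ≥ c_1 = U'(a), the distance D to a satisfies D' ≥ U'(a) - U'(a + D) ≥ -K D, so it
  -- decays at most exponentially and never reaches 0. The other endpoint is symmetric.
  · have := mul_exp_le_of_deriv_ge (K := K) (f := fun t => flow U c a b i t x - a)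
      (fun t ht => (hd t ht).sub_const a) (fun t _ => by
        have hm := flow_mem hU hG i t x
        have h1 := hlip _ hm a (left_mem_Icc.2 hG.lt.le)
        rw [hG.left, abs_of_nonneg (sub_nonneg.2 hm.1)] at h1
        have h2 := (abs_le.1 h1).2
        linarith [hci.1]) ht
    rw [flow_zero hU hG i hx'] at this
    have h3 : 0 < (x - a) * Real.exp (-K * t) := mul_pos (sub_pos.2 hx.1) (Real.exp_pos _)
    exact sub_pos.1 (h3.trans_le this)
  · have := mul_exp_le_of_deriv_ge (K := K) (f := fun t => b - flow U c a b i t x)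
      (fun t ht => (hd t ht).const_sub b) (fun t _ => by
        have hm := flow_mem hU hG i t x
        have h1 := hlip _ hm b (right_mem_Icc.2 hG.lt.le)
        rw [hG.right, abs_sub_comm _ b, abs_of_nonneg (sub_nonneg.2 hm.2)] at h1
        have h2 := (abs_le.1 h1).1
        linarith [hci.2]) ht
    rw [flow_zero hU hG i hx'] at this
    have h3 : 0 < (b - x) * Real.exp (-K * t) := mul_pos (sub_pos.2 hx.2) (Real.exp_pos _)
    exact sub_pos.1 (h3.trans_le this)

/-! ### Sequences of holding times -/

/-- Sequences of positive holding times whose sum is infinite. -/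
def goodTimes : Set (ℕ → ℝ) := {s | (∀ k, 0 < s k) ∧ ∀ N : ℕ, ∃ n, (N : ℝ) < switchTime s n}

/-- The sequence without its first term. -/
def tailSeq (s : ℕ → ℝ) : ℕ → ℝ := fun n => s (n + 1)

/-- The sequence with first term `r` followed by `s`. -/
def consSeq (r : ℝ) (s : ℕ → ℝ) : ℕ → ℝ
  | 0 => r
  | n + 1 => s n

theorem tailSeq_consSeq (r : ℝ) (s : ℕ → ℝ) : tailSeq (consSeq r s) = s := rfl

theorem measurable_consSeq : Measurable fun p : ℝ × (ℕ → ℝ) => consSeq p.1 p.2 := by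
  refine measurable_pi_lambda _ fun n => ?_
  cases n with
  | zero => exact measurable_fst
  | succ n => exact (measurable_pi_apply n).comp measurable_snd

theorem switchTime_succ (s : ℕ → ℝ) (n : ℕ) :
    switchTime s (n + 1) = s 0 + switchTime (tailSeq s) n := by
  rw [switchTime, Finset.sum_range_succ', add_comm]
  rfl

theorem measurable_switchTime (n : ℕ) : Measurable fun s => switchTime s n :=
  Finset.measurable_fun_sum _ fun k _ => measurable_pi_apply k

theorem measurableSet_goodTimes : MeasurableSet goodTimes := by
  have : goodTimes = (⋂ k, {s | 0 < s k}) ∩ ⋂ N : ℕ, ⋃ n, {s | (N : ℝ) < switchTime s n} := by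
    ext s; simp [goodTimes]
  rw [this]
  exact (MeasurableSet.iInter fun k => measurableSet_lt measurable_const (measurable_pi_apply k)).inter
    (MeasurableSet.iInter fun N => MeasurableSet.iUnion fun n =>
      measurableSet_lt measurable_const (measurable_switchTime n))

theorem tailSeq_mem_goodTimes {s : ℕ → ℝ} (hs : s ∈ goodTimes) : tailSeq s ∈ goodTimes := by
  refine ⟨fun k => hs.1 (k + 1), fun N => ?_⟩
  obtain ⟨m, hm⟩ := exists_nat_gt (N + s 0)
  obtain ⟨n, hn⟩ := hs.2 m
  cases n with
  | zero =>
    have h0 : switchTime s 0 = 0 := by simp [switchTime]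
    have : (0 : ℝ) ≤ m := m.cast_nonneg
    linarith
  | succ n =>
    rw [switchTime_succ] at hn
    exact ⟨n, by linarith⟩

theorem consSeq_mem_goodTimes {r : ℝ} {s : ℕ → ℝ} (hr : 0 < r) (hs : s ∈ goodTimes) :
    consSeq r s ∈ goodTimes := by
  refine ⟨fun k => ?_, fun N => ?_⟩
  · cases k with
    | zero => exact hr
    | succ k => exact hs.1 k
  · obtain ⟨n, hn⟩ := hs.2 N
    refine ⟨n + 1, ?_⟩
    rw [switchTime_succ, tailSeq_consSeq]
    have : consSeq r s 0 = r := rfl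
    linarith

theorem strictMono_switchTime {s : ℕ → ℝ} (hs : s ∈ goodTimes) : StrictMono (switchTime s) :=
  strictMono_nat_of_lt_succ fun n => by
    rw [switchTime, switchTime, Finset.sum_range_succ]
    linarith [hs.1 n]

theorem exists_lt_switchTime {s : ℕ → ℝ} (hs : s ∈ goodTimes) (t : ℝ) :
    ∃ n, t < switchTime s n := by
  obtain ⟨N, hN⟩ := exists_nat_gt t
  obtain ⟨n, hn⟩ := hs.2 N
  exact ⟨n, hN.trans hn⟩

theorem finite_switchTime_le {s : ℕ → ℝ} (hs : s ∈ goodTimes) (t : ℝ) :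
    {n : ℕ | switchTime s (n + 1) ≤ t}.Finite := by
  obtain ⟨N, hN⟩ := exists_lt_switchTime hs t
  refine (finite_Iio N).subset fun n hn => ?_
  have h1 : switchTime s (n + 1) < switchTime s N := lt_of_le_of_lt hn hN
  have := (strictMono_switchTime hs).lt_iff_lt.1 h1
  exact mem_Iio.2 (by omega)

theorem switchCount_of_lt {s : ℕ → ℝ} (hs : s ∈ goodTimes) {t : ℝ} (ht : t < s 0) :
    switchCount s t = 0 := by
  have : {n : ℕ | switchTime s (n + 1) ≤ t} = ∅ := by
    refine eq_empty_of_forall_notMem fun n hn => ?_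
    have h1 : switchTime s 1 ≤ switchTime s (n + 1) :=
      (strictMono_switchTime hs).monotone (by omega)
    have h2 : switchTime s 1 = s 0 := by simp [switchTime]
    have h3 : switchTime s (n + 1) ≤ t := hn
    linarith
  rw [switchCount, this, ncard_empty]

theorem switchCount_add {s : ℕ → ℝ} (hs : s ∈ goodTimes) {t : ℝ} (ht : 0 ≤ t) :
    switchCount s (s 0 + t) = switchCount (tailSeq s) t + 1 := by
  have : {n : ℕ | switchTime s (n + 1) ≤ s 0 + t} =
      insert 0 (Nat.succ '' {n : ℕ | switchTime (tailSeq s) (n + 1) ≤ t}) := by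
    ext n
    cases n with
    | zero => simp [switchTime, ht]
    | succ n => simp [switchTime_succ s]
  rw [switchCount, this, ncard_insert_of_notMem (by simp)
    ((finite_switchTime_le (tailSeq_mem_goodTimes hs) t).image _),
    ncard_image_of_injective _ Nat.succ_injective, switchCount]

theorem one_sub_one_sub (i : Fin 2) : 1 - (1 - i) = i := by fin_cases i <;> rfl

theorem stateAfter_zero (i : Fin 2) : stateAfter i 0 = i := by simp [stateAfter]

theorem stateAfter_succ (i : Fin 2) (n : ℕ) : stateAfter i (n + 1) = stateAfter (1 - i) n := by
  by_cases h : Even n <;> simp [stateAfter, Nat.even_add_one, h]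

theorem switching_of_lt (i : Fin 2) {s : ℕ → ℝ} (hs : s ∈ goodTimes) {t : ℝ} (ht : t < s 0) :
    switching i s t = i := by
  rw [switching, switchCount_of_lt hs ht, stateAfter_zero]

theorem switching_add (i : Fin 2) {s : ℕ → ℝ} (hs : s ∈ goodTimes) {t : ℝ} (ht : 0 ≤ t) :
    switching i s (s 0 + t) = switching (1 - i) (tailSeq s) t := by
  rw [switching, switchCount_add hs ht, stateAfter_succ, switching]

theorem measurable_switching (i : Fin 2) {s : ℕ → ℝ} (hs : s ∈ goodTimes) :
    Measurable (switching i s) := by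
  have hm : Monotone (switchCount s) := fun t u htu =>
    ncard_le_ncard (fun n (hn : switchTime s (n + 1) ≤ t) => hn.trans htu)
      (finite_switchTime_le hs u)
  exact (measurable_of_countable (stateAfter i)).comp hm.measurable

/-! ### The law of the holding times -/

theorem isProbabilityMeasure_holdingLaw (hl : ∀ i, 0 < l i) (i : Fin 2) :
    IsProbabilityMeasure (holdingLaw l i) := by
  have := fun n => isProbabilityMeasure_expMeasure (hl (stateAfter i n))
  unfold holdingLaw
  infer_instance

theorem expMeasure_Iic {r : ℝ} (hr : 0 < r) (x : ℝ) :
    expMeasure r (Iic x) = ENNReal.ofReal (if 0 ≤ x then 1 - Real.exp (-(r * x)) else 0) := by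
  have := isProbabilityMeasure_expMeasure hr
  rw [← cdf_expMeasure_eq hr x, cdf_eq_real, ofReal_measureReal]

theorem ae_pos_expMeasure {r : ℝ} (hr : 0 < r) : ∀ᵐ x ∂expMeasure r, 0 < x := by
  rw [ae_iff]
  have : {x : ℝ | ¬ 0 < x} = Iic 0 := by ext; simp
  rw [this, expMeasure_Iic hr]
  simp

/-- Positivity is clear. For divergence it is enough that infinitely many holding times exceed 1: n
given ones are all at most 1 with probability at most q^n, where q < 1 is the larger of the two
values P(holding time ≤ 1). -/
theorem ae_mem_goodTimes (hl : ∀ i, 0 < l i) (i : Fin 2) :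
    ∀ᵐ s ∂holdingLaw l i, s ∈ goodTimes := by
  have hp := fun n => isProbabilityMeasure_expMeasure (hl (stateAfter i n))
  have h1 : ∀ᵐ s ∂holdingLaw l i, ∀ k, 0 < s k := by
    refine ae_all_iff.2 fun k => ?_
    exact (measurePreserving_eval_infinitePi
      (fun n => expMeasure (l (stateAfter i n))) k).quasiMeasurePreserving.ae
        (ae_pos_expMeasure (hl _))
  set q : ℝ≥0∞ := max (expMeasure (l 0) (Iic 1)) (expMeasure (l 1) (Iic 1)) with hq
  have hq1 : q < 1 := by
    have : ∀ j, expMeasure (l j) (Iic 1) < 1 := fun j => by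
      rw [expMeasure_Iic (hl j), if_pos zero_le_one, ENNReal.ofReal_lt_one]
      linarith [Real.exp_pos (-(l j * 1))]
    exact max_lt (this 0) (this 1)
  have hqj : ∀ j, expMeasure (l j) (Iic 1) ≤ q := fun j => by
    fin_cases j
    · exact le_max_left _ _
    · exact le_max_right _ _
  have h2 : ∀ᵐ s ∂holdingLaw l i, ∀ m : ℕ, ∃ k, m ≤ k ∧ 1 < s k := by
    refine ae_all_iff.2 fun m => ?_
    rw [ae_iff]
    have hle : ∀ n : ℕ, holdingLaw l i {s | ¬ ∃ k, m ≤ k ∧ 1 < s k} ≤ q ^ n := by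
      intro n
      calc holdingLaw l i {s | ¬ ∃ k, m ≤ k ∧ 1 < s k}
          ≤ holdingLaw l i (Set.pi (Finset.Ico m (m + n)) fun _ => Iic 1) := by
            refine measure_mono fun s hs k hk => ?_
            simp only [mem_ofPred_eq, not_exists, not_and, not_lt] at hs
            exact hs k (Finset.mem_Ico.1 hk).1
        _ = ∏ k ∈ Finset.Ico m (m + n), expMeasure (l (stateAfter i k)) (Iic 1) :=
            Measure.infinitePi_pi _ fun _ _ => measurableSet_Iic
        _ ≤ ∏ k ∈ Finset.Ico m (m + n), q := Finset.prod_le_prod' fun k _ => hqj _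
        _ = q ^ n := by simp
    exact le_antisymm (ge_of_tendsto' (ENNReal.tendsto_pow_atTop_nhds_zero_of_lt_one hq1) hle)
      zero_le
  filter_upwards [h1, h2] with s hs1 hs2
  refine ⟨hs1, fun N => ?_⟩
  induction N with
  | zero => exact ⟨1, by simpa [switchTime] using hs1 0⟩
  | succ N ih =>
    obtain ⟨n, hn⟩ := ih
    obtain ⟨k, hk, hk1⟩ := hs2 n
    refine ⟨k + 1, ?_⟩
    have h3 : switchTime s n ≤ switchTime s k :=
      Finset.sum_le_sum_of_subset_of_nonneg (Finset.range_mono hk) fun j _ _ => (hs1 j).le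
    have h4 : switchTime s (k + 1) = switchTime s k + s k := Finset.sum_range_succ _ _
    push_cast
    linarith

/-- The first holding time is independent of the others, which have the law of the holding times
started from the other state. -/
theorem measurePreserving_consSeq (hl : ∀ i, 0 < l i) (i : Fin 2) :
    MeasurePreserving (fun p : ℝ × (ℕ → ℝ) => consSeq p.1 p.2)
      ((expMeasure (l i)).prod (holdingLaw l (1 - i))) (holdingLaw l i) := by
  have hp := fun j n => isProbabilityMeasure_expMeasure (hl (stateAfter j n))
  have hp' := isProbabilityMeasure_holdingLaw hl
  have hpi := isProbabilityMeasure_expMeasure (hl i)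
  refine ⟨measurable_consSeq, ?_⟩
  refine Measure.eq_infinitePi _ fun S t ht => ?_
  classical
  obtain ⟨N, hN⟩ := Finset.exists_nat_subset_range S
  -- The cylinder is padded by `univ` to a whole initial segment of coordinates, never empty, so
  -- that coordinate 0 can be split off even when S does not contain it.
  set t' : ℕ → Set ℝ := fun n => if n ∈ S then t n else univ with ht'
  have hmt' : ∀ n, MeasurableSet (t' n) := fun n => by
    by_cases h : n ∈ S <;> simp [ht', h, ht]
  have hpi : Set.pi S t = Set.pi (Finset.range (N + 1)) t' := by
    ext s
    simp only [Set.mem_pi, Finset.mem_coe]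
    constructor
    · intro h n _
      by_cases hn : n ∈ S
      · simpa [ht', hn] using h n hn
      · simp [ht', hn]
    · intro h n hn
      have := h n (Finset.range_mono (Nat.le_succ N) (hN hn))
      simpa [ht', hn] using this
  have hprod : ∏ n ∈ S, expMeasure (l (stateAfter i n)) (t n) =
      ∏ n ∈ Finset.range (N + 1), expMeasure (l (stateAfter i n)) (t' n) := by
    have hsub : S ⊆ Finset.range (N + 1) := hN.trans (Finset.range_mono (Nat.le_succ N))
    rw [← Finset.prod_subset hsub]
    · exact Finset.prod_congr rfl fun n hn => by simp [ht', hn]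
    · intro n _ hn
      simp [ht', hn]
  have hpre : (fun p : ℝ × (ℕ → ℝ) => consSeq p.1 p.2) ⁻¹' Set.pi (Finset.range (N + 1)) t' =
      t' 0 ×ˢ Set.pi (Finset.range N) fun n => t' (n + 1) := by
    ext p
    simp only [mem_preimage, Set.mem_pi, Finset.mem_coe, Finset.mem_range, mem_prod]
    constructor
    · intro h
      exact ⟨h 0 (Nat.succ_pos N), fun n hn => h (n + 1) (by omega)⟩
    · rintro ⟨h0, h⟩ n hn
      cases n with
      | zero => exact h0
      | succ n => exact h n (by omega)
  rw [hpi, hprod, Measure.map_apply measurable_consSeq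
    (MeasurableSet.pi (Finset.countable_toSet _) fun n _ => hmt' n), hpre, Measure.prod_prod,
    holdingLaw, Measure.infinitePi_pi _ fun n _ => hmt' _, Finset.prod_range_succ', mul_comm]
  simp only [stateAfter_succ, stateAfter_zero]

/-! ### The path of the process -/

theorem path_of_lt (hU : ContDiff ℝ 2 U) (hG : IsAttractor U c a b) {z : ℝ × Fin 2}
    (hz : z.1 ∈ Icc a b) {s : ℕ → ℝ} (hs : s ∈ goodTimes) {t : ℝ} (ht : 0 ≤ t) (hts : t < s 0) :
    path U c z s t = (flow U c a b z.2 t z.1, z.2) := by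
  rw [path, switching_of_lt z.2 hs hts]
  congr 1
  exact (isTrajectory_trajectory hU hG (measurable_switching z.2 hs) hz).eqOn hU
    (isTrajectory_flow hU hG z.2 hz) (fun r hr => switching_of_lt z.2 hs (hr.2.trans hts))
    ⟨ht, le_rfl⟩

/-- Up to the first switching the trajectory is the frozen flow; the shifted trajectory solves the
equation driven by the shifted switching path, and uniqueness identifies the two. -/
theorem path_of_ge (hU : ContDiff ℝ 2 U) (hG : IsAttractor U c a b) {z : ℝ × Fin 2}
    (hz : z.1 ∈ Icc a b) {s : ℕ → ℝ} (hs : s ∈ goodTimes) {t : ℝ} (hts : s 0 ≤ t) :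
    path U c z s t = path U c (flow U c a b z.2 (s 0) z.1, 1 - z.2) (tailSeq s) (t - s 0) := by
  have ht : 0 ≤ t - s 0 := sub_nonneg.2 hts
  have hs0 := (hs.1 0).le
  have hX := isTrajectory_trajectory hU hG (measurable_switching z.2 hs) hz
  have hflow : trajectory U c (switching z.2 s) z.1 (s 0) = flow U c a b z.2 (s 0) z.1 :=
    hX.eqOn hU (isTrajectory_flow hU hG z.2 hz) (fun r hr => switching_of_lt z.2 hs hr.2)
      ⟨hs0, le_rfl⟩
  have hsh := hX.shift hU (measurable_switching z.2 hs) hs0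
  rw [hflow] at hsh
  have h1 := hsh.eqOn hU (T := t - s 0) (isTrajectory_trajectory hU hG
    (measurable_switching (1 - z.2) (tailSeq_mem_goodTimes hs)) (flow_mem hU hG z.2 (s 0) z.1))
    (fun r hr => switching_add z.2 hs hr.1.le) ⟨ht, le_rfl⟩
  have h2 := switching_add z.2 hs ht
  simp only [add_sub_cancel] at h1 h2
  rw [path, path, h1, h2]

/-- The path of the process, computed with at most `n` switchings. -/
def pathUpTo (U : ℝ → ℝ) (c : Fin 2 → ℝ) (a b : ℝ) :
    ℕ → ℝ × Fin 2 → (ℕ → ℝ) → ℝ → ℝ × Fin 2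
  | 0, z, _, t => (flow U c a b z.2 t z.1, z.2)
  | n + 1, z, s, t => if t < s 0 then (flow U c a b z.2 t z.1, z.2) else
      pathUpTo U c a b n (flow U c a b z.2 (s 0) z.1, 1 - z.2) (tailSeq s) (t - s 0)

theorem measurable_flow_state (hU : ContDiff ℝ 2 U) (hG : IsAttractor U c a b) :
    Measurable fun p : (ℝ × ℝ) × Fin 2 => flow U c a b p.2 p.1.1 p.1.2 :=
  measurable_from_prod_countable_left fun i => measurable_flow hU hG i

theorem measurable_pathUpTo (hU : ContDiff ℝ 2 U) (hG : IsAttractor U c a b) (n : ℕ) :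
    Measurable fun p : (ℝ × Fin 2) × (ℕ → ℝ) × ℝ => pathUpTo U c a b n p.1 p.2.1 p.2.2 := by
  have h0 : Measurable fun p : (ℝ × Fin 2) × (ℕ → ℝ) × ℝ =>
      (flow U c a b p.1.2 p.2.2 p.1.1, p.1.2) :=
    ((measurable_flow_state hU hG).comp ((measurable_snd.snd.prodMk measurable_fst.fst).prodMk
      measurable_fst.snd)).prodMk measurable_fst.snd
  have hs0 : Measurable fun p : (ℝ × Fin 2) × (ℕ → ℝ) × ℝ => p.2.1 0 :=
    (measurable_pi_apply 0).comp measurable_snd.fst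
  induction n with
  | zero => exact h0
  | succ n ih =>
    refine Measurable.ite (measurableSet_lt measurable_snd.snd hs0) h0 ?_
    refine ih.comp (Measurable.prodMk (Measurable.prodMk ?_ ?_) (Measurable.prodMk ?_ ?_))
    · exact (measurable_flow_state hU hG).comp ((hs0.prodMk measurable_fst.fst).prodMk
        measurable_fst.snd)
    · exact (measurable_of_finite fun i : Fin 2 => 1 - i).comp measurable_fst.snd
    · exact measurable_pi_lambda _ fun k => (measurable_pi_apply (k + 1)).comp measurable_snd.fst
    · exact measurable_snd.snd.sub hs0

theorem path_eq_pathUpTo (hU : ContDiff ℝ 2 U) (hG : IsAttractor U c a b) (n : ℕ) :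
    ∀ {z : ℝ × Fin 2}, z.1 ∈ Icc a b → ∀ {s : ℕ → ℝ}, s ∈ goodTimes → ∀ {t : ℝ}, 0 ≤ t →
      t < switchTime s (n + 1) → path U c z s t = pathUpTo U c a b n z s t := by
  induction n with
  | zero =>
    intro z hz s hs t ht hts
    exact path_of_lt hU hG hz hs ht (by simpa [switchTime] using hts)
  | succ n ih =>
    intro z hz s hs t ht hts
    rw [pathUpTo]
    split_ifs with h
    · exact path_of_lt hU hG hz hs ht h
    · rw [path_of_ge hU hG hz hs (not_lt.1 h)]
      refine ih (flow_mem hU hG _ _ _) (tailSeq_mem_goodTimes hs) (sub_nonneg.2 (not_lt.1 h)) ?_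
      rw [switchTime_succ] at hts
      linarith

open Classical in
/-- The path of the process, replaced by a constant for exceptional initial points, exceptional
sequences of holding times and negative times. -/
def regularPath (U : ℝ → ℝ) (c : Fin 2 → ℝ) (a b : ℝ) (z : ℝ × Fin 2) (s : ℕ → ℝ) (t : ℝ) :
    ℝ × Fin 2 :=
  if z.1 ∈ Icc a b ∧ s ∈ goodTimes ∧ 0 ≤ t then path U c z s t else (a, 0)

theorem regularPath_eq {z : ℝ × Fin 2} (hz : z.1 ∈ Icc a b) {s : ℕ → ℝ} (hs : s ∈ goodTimes)
    {t : ℝ} (ht : 0 ≤ t) : regularPath U c a b z s t = path U c z s t :=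
  if_pos ⟨hz, hs, ht⟩

/-- `path` rests on a choice of solution and carries no evident measurability in (z, s, t). The
recursion `pathUpTo` is jointly measurable, and for good holding times it equals the path as soon as
the number of switchings allowed is large enough. -/
theorem measurable_regularPath (hU : ContDiff ℝ 2 U) (hG : IsAttractor U c a b) :
    Measurable fun p : (ℝ × Fin 2) × (ℕ → ℝ) × ℝ => regularPath U c a b p.1 p.2.1 p.2.2 := by
  classical
  have hset : MeasurableSet {p : (ℝ × Fin 2) × (ℕ → ℝ) × ℝ |
      p.1.1 ∈ Icc a b ∧ p.2.1 ∈ goodTimes ∧ 0 ≤ p.2.2} :=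
    (measurable_fst.fst measurableSet_Icc).inter ((measurable_snd.fst measurableSet_goodTimes).inter
      (measurable_snd.snd measurableSet_Ici))
  refine measurable_of_tendsto_metrizable (f := fun n p =>
    if p.1.1 ∈ Icc a b ∧ p.2.1 ∈ goodTimes ∧ 0 ≤ p.2.2 then
      pathUpTo U c a b n p.1 p.2.1 p.2.2 else (a, 0))
    (fun n => Measurable.ite hset (measurable_pathUpTo hU hG n) measurable_const) ?_
  refine tendsto_pi_nhds.2 fun p => tendsto_const_nhds.congr' ?_
  by_cases h : p.1.1 ∈ Icc a b ∧ p.2.1 ∈ goodTimes ∧ 0 ≤ p.2.2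
  · obtain ⟨N, hN⟩ := exists_lt_switchTime h.2.1 p.2.2
    filter_upwards [eventually_ge_atTop N] with n hn
    rw [if_pos h, regularPath_eq h.1 h.2.1 h.2.2]
    refine path_eq_pathUpTo hU hG n h.1 h.2.1 h.2.2 (hN.trans_le ?_)
    exact (strictMono_switchTime h.2.1).monotone (by omega)
  · filter_upwards with n
    rw [regularPath, if_neg h, if_neg h]

theorem regularPath_consSeq (hU : ContDiff ℝ 2 U) (hG : IsAttractor U c a b) {x : ℝ}
    (hx : x ∈ Icc a b) (i : Fin 2) {r : ℝ} (hr : 0 < r) {s : ℕ → ℝ} (hs : s ∈ goodTimes)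
    {t : ℝ} (ht : 0 ≤ t) :
    regularPath U c a b (x, i) (consSeq r s) t = if t < r then (flow U c a b i t x, i) else
      regularPath U c a b (flow U c a b i r x, 1 - i) s (t - r) := by
  have hgood := consSeq_mem_goodTimes hr hs
  rw [regularPath_eq (z := (x, i)) hx hgood ht]
  split_ifs with h
  · exact path_of_lt hU hG (z := (x, i)) hx hgood ht h
  · rw [regularPath_eq (flow_mem hU hG i r x) hs (sub_nonneg.2 (not_lt.1 h))]
    exact path_of_ge hU hG (z := (x, i)) hx hgood (not_lt.1 h)

/-- The event in `transitionProb` need not be visibly measurable; it agrees almost surely with the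
measurable event for `regularPath`, and this determines its outer measure. -/
theorem transitionProb_eq (hl : ∀ i, 0 < l i) {z : ℝ × Fin 2} (hz : z.1 ∈ Icc a b)
    {t : ℝ} (ht : 0 ≤ t) (A : Set (ℝ × Fin 2)) :
    transitionProb U c l t z A = holdingLaw l z.2 {s | regularPath U c a b z s t ∈ A} := by
  refine measure_congr ?_
  filter_upwards [ae_mem_goodTimes hl z.2] with s hs
  have : path U c z s t ∈ A ↔ regularPath U c a b z s t ∈ A := by
    rw [regularPath_eq hz hs ht]
  exact propext this

/-! ### Renewal equations -/

/-- The action of the transition function on nonnegative functions. -/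
def lsemigroup (U : ℝ → ℝ) (c l : Fin 2 → ℝ) (a b : ℝ) (f : ℝ × Fin 2 → ℝ≥0∞) (t : ℝ)
    (z : ℝ × Fin 2) : ℝ≥0∞ :=
  ∫⁻ s, f (regularPath U c a b z s t) ∂holdingLaw l z.2

/-- The action of the transition function on real functions. -/
def semigroup (U : ℝ → ℝ) (c l : Fin 2 → ℝ) (a b : ℝ) (f : ℝ × Fin 2 → ℝ) (t : ℝ)
    (z : ℝ × Fin 2) : ℝ :=
  ∫ s, f (regularPath U c a b z s t) ∂holdingLaw l z.2

theorem measurable_regularPath_fixed (hU : ContDiff ℝ 2 U) (hG : IsAttractor U c a b)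
    (z : ℝ × Fin 2) (t : ℝ) : Measurable fun s => regularPath U c a b z s t :=
  (measurable_regularPath hU hG).comp (measurable_const.prodMk (measurable_id.prodMk
    measurable_const))

theorem measurable_lsemigroup (hU : ContDiff ℝ 2 U) (hG : IsAttractor U c a b) (hl : ∀ i, 0 < l i)
    {f : ℝ × Fin 2 → ℝ≥0∞} (hf : Measurable f) :
    Measurable fun p : (ℝ × ℝ) × Fin 2 => lsemigroup U c l a b f p.1.1 (p.1.2, p.2) := by
  refine measurable_from_prod_countable_left fun i => ?_
  have := isProbabilityMeasure_holdingLaw hl i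
  have h : Measurable fun q : (ℝ × ℝ) × (ℕ → ℝ) =>
      f (regularPath U c a b (q.1.2, i) q.2 q.1.1) :=
    hf.comp ((measurable_regularPath hU hG).comp
      ((measurable_fst.snd.prodMk measurable_const).prodMk
        (measurable_snd.prodMk measurable_fst.fst)))
  exact h.lintegral_prod_right' (ν := holdingLaw l i)

/-- Conditioning on the first holding time r: if r > t the state is still i and the flow has run for
time t; otherwise the process restarts at time r from the flowed point in the other state. -/
theorem lsemigroup_renewal (hU : ContDiff ℝ 2 U) (hG : IsAttractor U c a b) (hl : ∀ i, 0 < l i)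
    {f : ℝ × Fin 2 → ℝ≥0∞} (hf : Measurable f) {x : ℝ} (hx : x ∈ Icc a b) (i : Fin 2) {t : ℝ}
    (ht : 0 ≤ t) :
    lsemigroup U c l a b f t (x, i) =
      ∫⁻ r, (if t < r then f (flow U c a b i t x, i) else
        lsemigroup U c l a b f (t - r) (flow U c a b i r x, 1 - i)) ∂expMeasure (l i) := by
  have hp := isProbabilityMeasure_holdingLaw hl
  have hp' := isProbabilityMeasure_expMeasure (hl i)
  have hF : Measurable fun s => f (regularPath U c a b (x, i) s t) :=
    hf.comp (measurable_regularPath_fixed hU hG (x, i) t)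
  have hFc : Measurable fun p : ℝ × (ℕ → ℝ) =>
      f (regularPath U c a b (x, i) (consSeq p.1 p.2) t) := hF.comp measurable_consSeq
  have h1 := (measurePreserving_consSeq hl i).lintegral_comp hF
  rw [lintegral_prod _ hFc.aemeasurable] at h1
  rw [lsemigroup, ← h1]
  refine lintegral_congr_ae ?_
  filter_upwards [ae_pos_expMeasure (hl i)] with r hr
  have h2 : ∀ᵐ s ∂holdingLaw l (1 - i), f (regularPath U c a b (x, i) (consSeq r s) t) =
      if t < r then f (flow U c a b i t x, i) else
        f (regularPath U c a b (flow U c a b i r x, 1 - i) s (t - r)) := by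
    filter_upwards [ae_mem_goodTimes hl (1 - i)] with s hs
    rw [regularPath_consSeq hU hG hx i hr hs ht]
    split_ifs <;> rfl
  rw [lintegral_congr_ae h2]
  split_ifs
  · simp
  · rfl

theorem semigroup_renewal (hU : ContDiff ℝ 2 U) (hG : IsAttractor U c a b) (hl : ∀ i, 0 < l i)
    {f : ℝ × Fin 2 → ℝ} (hf : Measurable f) {B : ℝ} (hB : ∀ z, |f z| ≤ B) {x : ℝ}
    (hx : x ∈ Icc a b) (i : Fin 2) {t : ℝ} (ht : 0 ≤ t) :
    semigroup U c l a b f t (x, i) =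
      ∫ r, (if t < r then f (flow U c a b i t x, i) else
        semigroup U c l a b f (t - r) (flow U c a b i r x, 1 - i)) ∂expMeasure (l i) := by
  have hp := isProbabilityMeasure_holdingLaw hl
  have hp' := isProbabilityMeasure_expMeasure (hl i)
  have hF : Measurable fun s => f (regularPath U c a b (x, i) s t) :=
    hf.comp (measurable_regularPath_fixed hU hG (x, i) t)
  have hFc : Measurable fun p : ℝ × (ℕ → ℝ) =>
      f (regularPath U c a b (x, i) (consSeq p.1 p.2) t) := hF.comp measurable_consSeq
  rw [semigroup, ← (measurePreserving_consSeq hl i).map_eq,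
    integral_map measurable_consSeq.aemeasurable hF.aestronglyMeasurable,
    integral_prod _ ((integrable_const B).mono' hFc.aestronglyMeasurable
      (Eventually.of_forall fun p => hB _))]
  refine integral_congr_ae ?_
  filter_upwards [ae_pos_expMeasure (hl i)] with r hr
  have h2 : ∀ᵐ s ∂holdingLaw l (1 - i), f (regularPath U c a b (x, i) (consSeq r s) t) =
      if t < r then f (flow U c a b i t x, i) else
        f (regularPath U c a b (flow U c a b i r x, 1 - i) s (t - r)) := by
    filter_upwards [ae_mem_goodTimes hl (1 - i)] with s hs
    rw [regularPath_consSeq hU hG hx i hr hs ht]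
    split_ifs <;> rfl
  rw [integral_congr_ae h2]
  split_ifs
  · simp
  · rfl

/-! ### The stationary densities -/

/-- The sign of the velocity `cᵢ - U'` on the attractor. -/
def dirSign (i : Fin 2) : ℝ := if i = 0 then 1 else -1

theorem dirSign_mul_self (i : Fin 2) : dirSign i * dirSign i = 1 := by
  fin_cases i <;> simp [dirSign]

/-- The unnormalised stationary densities. -/
def weight (U : ℝ → ℝ) (c l : Fin 2 → ℝ) (Φ : Fin 2 → ℝ → ℝ) (i : Fin 2) (x : ℝ) : ℝ :=
  dirSign i * ((Psi l Φ x)⁻¹ / (c i - deriv U x))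

theorem IsAttractor.velocity_pos (hG : IsAttractor U c a b) (i : Fin 2) {x : ℝ}
    (hx : x ∈ Ioo a b) : 0 < dirSign i * (c i - deriv U x) := by
  have := hG.between x hx
  fin_cases i
  · simpa [dirSign] using this.2
  · simpa [dirSign] using this.1

theorem IsAttractor.velocity_ne_zero (hG : IsAttractor U c a b) (i : Fin 2) {x : ℝ}
    (hx : x ∈ Ioo a b) : c i - deriv U x ≠ 0 :=
  right_ne_zero_of_mul (hG.velocity_pos i hx).ne'

theorem Psi_pos (l : Fin 2 → ℝ) (Φ : Fin 2 → ℝ → ℝ) (x : ℝ) : 0 < Psi l Φ x := Real.exp_pos _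

theorem weight_eq_div (i : Fin 2) (x : ℝ) :
    weight U c l Φ i x = (Psi l Φ x)⁻¹ / (dirSign i * (c i - deriv U x)) := by
  have h := dirSign_mul_self i
  have h0 : dirSign i ≠ 0 := left_ne_zero_of_mul (h ▸ one_ne_zero)
  rw [weight, ← div_div, div_eq_mul_inv _ (dirSign i), ← eq_inv_of_mul_eq_one_left h]
  ring

theorem weight_pos (hG : IsAttractor U c a b) (i : Fin 2) {x : ℝ} (hx : x ∈ Ioo a b) :
    0 < weight U c l Φ i x := by
  rw [weight_eq_div]
  exact div_pos (inv_pos.2 (Psi_pos l Φ x)) (hG.velocity_pos i hx)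

/-- The fluxes of the two states are opposite: this is the zero-flux condition that singles out the
weights. -/
theorem velocity_mul_weight (hG : IsAttractor U c a b) (i : Fin 2) {x : ℝ} (hx : x ∈ Ioo a b) :
    (c i - deriv U x) * weight U c l Φ i x = dirSign i * (Psi l Φ x)⁻¹ := by
  have := hG.velocity_ne_zero i hx
  rw [weight]
  field_simp

/-- The stationary Fokker–Planck equation: the flux v_0 w_0 = Ψ⁻¹ has derivative λ_1 w_1 - λ_0 w_0.
-/
theorem hasDerivAt_inv_Psi (hΦ : IsRectifying U c a b Φ) {x : ℝ} (hx : x ∈ Ioo a b) :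
    HasDerivAt (fun x => (Psi l Φ x)⁻¹) (-∑ j, dirSign j * l j * weight U c l Φ j x) x := by
  have h1 : HasDerivAt (fun x => Real.exp (-(l 0 * Φ 0 x + l 1 * Φ 1 x))) _ x :=
    (((hΦ 0 x hx).const_mul (l 0)).add ((hΦ 1 x hx).const_mul (l 1))).neg.exp
  have h2 : (fun x => (Psi l Φ x)⁻¹) = fun x => Real.exp (-(l 0 * Φ 0 x + l 1 * Φ 1 x)) := by
    funext x; rw [Psi, Real.exp_neg]
  rw [h2]
  convert h1 using 1
  have h3 : Real.exp (-(l 0 * Φ 0 x + l 1 * Φ 1 x)) = (Psi l Φ x)⁻¹ := (congrFun h2 x).symm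
  simp only [h3, Fin.sum_univ_two, weight, Pi.neg_apply, Pi.add_apply]
  have h4 := dirSign_mul_self 0
  have h5 := dirSign_mul_self 1
  simp only [dirSign] at *
  simp
  ring

theorem continuousOn_weight (hU : ContDiff ℝ 2 U) (hG : IsAttractor U c a b)
    (hΦ : IsRectifying U c a b Φ) (i : Fin 2) : ContinuousOn (weight U c l Φ i) (Ioo a b) := by
  have h1 : ContinuousOn (fun x => (Psi l Φ x)⁻¹) (Ioo a b) := fun x hx =>
    (hasDerivAt_inv_Psi hΦ hx).continuousAt.continuousWithinAt
  exact continuousOn_const.mul (h1.div (continuousOn_const.sub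
    (continuous_deriv_of_contDiff hU).continuousOn) fun x hx => hG.velocity_ne_zero i hx)

/-- A function whose derivative is at most `B - k / (b - x)` tends to `-∞` at `b`. -/
theorem tendsto_atBot_of_deriv_le {L L' : ℝ → ℝ} {m k B : ℝ} (hm : m < b) (hk : 0 < k)
    (hL : ∀ x ∈ Ioo m b, HasDerivAt L (L' x) x)
    (hL' : ∀ x ∈ Ioo m b, L' x ≤ B - k / (b - x)) : Tendsto L (𝓝[<] b) atBot := by
  -- Subtracting the primitive k log(b - x) + B x of the upper bound leaves a nonincreasing
  -- function, so L is at most a constant plus B x + k log(b - x).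
  have hd : ∀ x ∈ Ioo m b, HasDerivAt (fun x => L x - k * Real.log (b - x) - B * x)
      (L' x - k * (-1 / (b - x)) - B) x := by
    intro x hx
    have h1 : HasDerivAt (fun x => Real.log (b - x)) (-1 / (b - x)) x :=
      ((hasDerivAt_id x).const_sub b).log (sub_pos.2 hx.2).ne'
    exact (((hL x hx).sub (h1.const_mul k)).sub ((hasDerivAt_id x).const_mul B)).congr_deriv
      (by ring)
  have hanti : AntitoneOn (fun x => L x - k * Real.log (b - x) - B * x) (Ioo m b) := by
    refine antitoneOn_of_hasDerivWithinAt_nonpos (convex_Ioo m b)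
      (f' := fun x => L' x - k * (-1 / (b - x)) - B)
      (fun x hx => (hd x hx).continuousAt.continuousWithinAt) ?_ ?_
    · intro x hx
      rw [interior_Ioo] at hx
      exact (hd x hx).hasDerivWithinAt
    · intro x hx
      rw [interior_Ioo] at hx
      have := hL' x hx
      have h2 : k * (-1 / (b - x)) = -(k / (b - x)) := by ring
      linarith
  set y := (m + b) / 2 with hy
  have hym : y ∈ Ioo m b := ⟨by linarith, by linarith⟩
  set D := L y - k * Real.log (b - y) - B * y with hD
  have hlog : Tendsto (fun x => Real.log (b - x)) (𝓝[<] b) atBot := by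
    refine Real.tendsto_log_nhdsGT_zero.comp ?_
    refine tendsto_nhdsWithin_iff.2 ⟨?_, ?_⟩
    · have : Tendsto (fun x => b - x) (𝓝 b) (𝓝 (b - b)) :=
        Continuous.tendsto (by fun_prop) b
      rw [sub_self] at this
      exact this.mono_left nhdsWithin_le_nhds
    · filter_upwards [self_mem_nhdsWithin] with x hx
      exact mem_Ioi.2 (sub_pos.2 (mem_Iio.1 hx))
  have hlim : Tendsto (fun x => D + B * x + k * Real.log (b - x)) (𝓝[<] b) atBot := by
    have h1 : Tendsto (fun x => D + B * x) (𝓝[<] b) (𝓝 (D + B * b)) := by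
      have : Tendsto (fun x => D + B * x) (𝓝 b) (𝓝 (D + B * b)) :=
        Continuous.tendsto (by fun_prop) b
      exact this.mono_left nhdsWithin_le_nhds
    exact h1.add_atBot (hlog.const_mul_atBot hk)
  refine tendsto_atBot_mono' _ ?_ hlim
  filter_upwards [Ioo_mem_nhdsLT hym.2] with x hx
  have := hanti hym ⟨hym.1.trans hx.1, hx.2⟩ hx.1.le
  simp only at this
  linarith

theorem exists_pos_le_of_pos {g : ℝ → ℝ} {p q : ℝ} (hpq : p ≤ q) (hg : Continuous g)
    (hpos : ∀ x ∈ Icc p q, 0 < g x) : ∃ δ > 0, ∀ x ∈ Icc p q, δ ≤ g x := by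
  obtain ⟨y, hy, hmin⟩ := isCompact_Icc.exists_isMinOn (nonempty_Icc.2 hpq) hg.continuousOn
  exact ⟨g y, hpos y hy, fun x hx => hmin hx⟩

theorem IsAttractor.exists_le_right (hU : ContDiff ℝ 2 U) (hG : IsAttractor U c a b) {m : ℝ}
    (hm : m ∈ Ioo a b) : ∃ δ > 0, ∀ x ∈ Icc m b, δ ≤ deriv U x - c 1 := by
  refine exists_pos_le_of_pos hm.2.le ((continuous_deriv_of_contDiff hU).sub continuous_const) ?_
  intro x hx
  rcases eq_or_lt_of_le hx.2 with rfl | h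
  · rw [hG.right]
    have := hG.between m hm
    linarith
  · linarith [(hG.between x ⟨hm.1.trans_le hx.1, h⟩).1]

theorem IsAttractor.exists_le_left (hU : ContDiff ℝ 2 U) (hG : IsAttractor U c a b) {m : ℝ}
    (hm : m ∈ Ioo a b) : ∃ δ > 0, ∀ x ∈ Icc a m, δ ≤ c 0 - deriv U x := by
  refine exists_pos_le_of_pos hm.1.le (continuous_const.sub (continuous_deriv_of_contDiff hU)) ?_
  intro x hx
  rcases eq_or_lt_of_le hx.1 with rfl | h
  · rw [hG.left]
    have := hG.between m hm
    linarith
  · linarith [(hG.between x ⟨h, hx.2.trans_lt hm.2⟩).2]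

theorem midpoint_mem (hG : IsAttractor U c a b) : (a + b) / 2 ∈ Ioo a b :=
  ⟨by linarith [hG.lt], by linarith [hG.lt]⟩

/-- Near b the Lipschitz bound 0 < c_0 - U'(x) ≤ K (b - x) forces λ_0 Φ_0 to grow at least like a
multiple of -log(b - x), while Φ_1 has bounded derivative because U' - c_1 stays away from 0. The
constant K + 1 avoids a division by zero when K = 0. -/
theorem tendsto_inv_Psi_right (hU : ContDiff ℝ 2 U) (hG : IsAttractor U c a b) (hl : ∀ i, 0 < l i)
    (hΦ : IsRectifying U c a b Φ) : Tendsto (fun x => (Psi l Φ x)⁻¹) (𝓝[<] b) (𝓝 0) := by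
  obtain ⟨K, hK⟩ := exists_lipschitz_deriv hU a b
  obtain ⟨δ, hδ, hδ'⟩ := hG.exists_le_right hU (midpoint_mem hG)
  have hm := midpoint_mem hG
  have h1 : Tendsto (fun x => -(l 0 * Φ 0 x + l 1 * Φ 1 x)) (𝓝[<] b) atBot := by
    refine tendsto_atBot_of_deriv_le (k := l 0 / (K + 1)) (B := l 1 / δ) hm.2
      (div_pos (hl 0) (by positivity)) (fun x hx => (((hΦ 0 x ⟨hm.1.trans hx.1, hx.2⟩).const_mul
        (l 0)).add ((hΦ 1 x ⟨hm.1.trans hx.1, hx.2⟩).const_mul (l 1))).neg) ?_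
    intro x hx
    have hxI : x ∈ Ioo a b := ⟨hm.1.trans hx.1, hx.2⟩
    have hd := hδ' x ⟨hx.1.le, hx.2.le⟩
    have hbx : 0 < b - x := sub_pos.2 hx.2
    have hv0 : 0 < c 0 - deriv U x := by linarith [(hG.between x hxI).2]
    have hlip := hK.dist_le_mul b (right_mem_Icc.2 hG.lt.le) x (Ioo_subset_Icc_self hxI)
    rw [Real.dist_eq, Real.dist_eq, hG.right, abs_of_pos hv0, abs_of_pos hbx] at hlip
    have h2 : l 0 / (K + 1) / (b - x) ≤ l 0 * (1 / (c 0 - deriv U x)) := by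
      rw [div_div, mul_one_div]
      refine div_le_div_of_nonneg_left (hl 0).le hv0 ?_
      nlinarith
    have h3 : -(l 1 * (1 / (c 1 - deriv U x))) ≤ l 1 / δ := by
      have : -(l 1 * (1 / (c 1 - deriv U x))) = l 1 / (deriv U x - c 1) := by
        rw [← neg_sub (deriv U x) (c 1), one_div, inv_neg]; ring
      rw [this]
      exact div_le_div_of_nonneg_left (hl 1).le hδ hd
    linarith
  have h2 := Real.tendsto_exp_atBot.comp h1
  refine h2.congr fun x => ?_
  rw [Psi, ← Real.exp_neg, Function.comp_apply]

theorem tendsto_inv_Psi_left (hU : ContDiff ℝ 2 U) (hG : IsAttractor U c a b) (hl : ∀ i, 0 < l i)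
    (hΦ : IsRectifying U c a b Φ) : Tendsto (fun x => (Psi l Φ x)⁻¹) (𝓝[>] a) (𝓝 0) := by
  obtain ⟨K, hK⟩ := exists_lipschitz_deriv hU a b
  obtain ⟨δ, hδ, hδ'⟩ := hG.exists_le_left hU (midpoint_mem hG)
  have hm := midpoint_mem hG
  -- The reflection x ↦ -x reduces the left endpoint to the one-sided lemma at a right endpoint; the
  -- roles of the two states are exchanged.
  have h1 : Tendsto (fun x => -(l 0 * Φ 0 (-x) + l 1 * Φ 1 (-x))) (𝓝[<] (-a)) atBot := by
    refine tendsto_atBot_of_deriv_le (m := -((a + b) / 2)) (k := l 1 / (K + 1)) (B := l 0 / δ)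
      (neg_lt_neg hm.1) (div_pos (hl 1) (by positivity))
      (L' := fun x => l 0 * (1 / (c 0 - deriv U (-x))) + l 1 * (1 / (c 1 - deriv U (-x)))) ?_ ?_
    · intro x hx
      have hxI : -x ∈ Ioo a b := ⟨by linarith [hx.2], by linarith [hx.1, hm.2]⟩
      have h0 := (hΦ 0 (-x) hxI).scomp x (hasDerivAt_neg x)
      have h1 := (hΦ 1 (-x) hxI).scomp x (hasDerivAt_neg x)
      exact ((h0.const_mul (l 0)).add (h1.const_mul (l 1))).neg.congr_deriv
        (by simp only [smul_eq_mul]; ring)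
    intro x hx
    have hxI : -x ∈ Ioo a b := ⟨by linarith [hx.2], by linarith [hx.1, hm.2]⟩
    have hd := hδ' (-x) ⟨hxI.1.le, by linarith [hx.1]⟩
    have hbx : 0 < -a - x := sub_pos.2 hx.2
    have hv1 : 0 < deriv U (-x) - c 1 := by linarith [(hG.between _ hxI).1]
    have hlip := hK.dist_le_mul (-x) (Ioo_subset_Icc_self hxI) a (left_mem_Icc.2 hG.lt.le)
    rw [Real.dist_eq, Real.dist_eq, hG.left, abs_of_pos hv1,
      abs_of_pos (by linarith : 0 < -x - a)] at hlip
    have h2 : l 1 / (K + 1) / (-a - x) ≤ l 1 * (1 / (deriv U (-x) - c 1)) := by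
      rw [div_div, mul_one_div]
      refine div_le_div_of_nonneg_left (hl 1).le hv1 ?_
      nlinarith
    have h3 : l 0 * (1 / (c 0 - deriv U (-x))) ≤ l 0 / δ := by
      rw [mul_one_div]
      exact div_le_div_of_nonneg_left (hl 0).le hδ hd
    have h4 : l 1 * (1 / (c 1 - deriv U (-x))) = -(l 1 * (1 / (deriv U (-x) - c 1))) := by
      rw [← neg_sub (deriv U (-x)) (c 1), one_div, inv_neg]; ring
    simp only [h4]
    linarith
  have hneg : Tendsto (fun x : ℝ => -x) (𝓝[>] a) (𝓝[<] (-a)) := tendsto_neg_nhdsGT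
  have h2 := Real.tendsto_exp_atBot.comp (h1.comp hneg)
  refine h2.congr fun x => ?_
  rw [Psi, ← Real.exp_neg, Function.comp_apply, Function.comp_apply, neg_neg]

/-- The function `Ψ⁻¹` on `(a, b)`, extended by zero. -/
def edge (a b : ℝ) (l : Fin 2 → ℝ) (Φ : Fin 2 → ℝ → ℝ) : ℝ → ℝ :=
  (Ioo a b).indicator fun x => (Psi l Φ x)⁻¹

theorem edge_of_mem {x : ℝ} (hx : x ∈ Ioo a b) : edge a b l Φ x = (Psi l Φ x)⁻¹ :=
  indicator_of_mem hx _

theorem edge_left : edge a b l Φ a = 0 := indicator_of_notMem (by simp) _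

theorem edge_right : edge a b l Φ b = 0 := indicator_of_notMem (by simp) _

theorem hasDerivAt_edge (hΦ : IsRectifying U c a b Φ) {x : ℝ} (hx : x ∈ Ioo a b) :
    HasDerivAt (edge a b l Φ) (-∑ j, dirSign j * l j * weight U c l Φ j x) x :=
  (hasDerivAt_inv_Psi hΦ hx).congr_of_eventuallyEq <| by
    filter_upwards [isOpen_Ioo.mem_nhds hx] with y hy using edge_of_mem hy

theorem continuousOn_edge (hU : ContDiff ℝ 2 U) (hG : IsAttractor U c a b) (hl : ∀ i, 0 < l i)
    (hΦ : IsRectifying U c a b Φ) : ContinuousOn (edge a b l Φ) (Icc a b) := by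
  intro x hx
  rcases eq_or_lt_of_le hx.1 with rfl | h1
  · have h : Tendsto (edge a b l Φ) (𝓝[>] a) (𝓝 (edge a b l Φ a)) := by
      rw [edge_left]
      refine (tendsto_inv_Psi_left hU hG hl hΦ).congr' ?_
      filter_upwards [Ioo_mem_nhdsGT hG.lt] with y hy using (edge_of_mem hy).symm
    exact (continuousWithinAt_Ioi_iff_Ici.1 h).mono Icc_subset_Ici_self
  rcases eq_or_lt_of_le hx.2 with rfl | h2
  · have h : Tendsto (edge a x l Φ) (𝓝[<] x) (𝓝 (edge a x l Φ x)) := by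
      rw [edge_right]
      refine (tendsto_inv_Psi_right hU hG hl hΦ).congr' ?_
      filter_upwards [Ioo_mem_nhdsLT hG.lt] with y hy using (edge_of_mem hy).symm
    exact (continuousWithinAt_Iio_iff_Iic.1 h).mono Icc_subset_Iic_self
  exact (hasDerivAt_edge hΦ ⟨h1, h2⟩).continuousAt.continuousWithinAt

/-- If one of the densities is bounded on a subinterval then both are integrable on it. -/
theorem integrableOn_weight_of_bounded (hU : ContDiff ℝ 2 U) (hG : IsAttractor U c a b)
    (hl : ∀ i, 0 < l i) (hΦ : IsRectifying U c a b Φ) {p q B : ℝ} (hp : a ≤ p) (hq : q ≤ b)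
    (j : Fin 2) (hB : ∀ x ∈ Ioo p q, weight U c l Φ j x ≤ B) :
    IntegrableOn (weight U c l Φ j) (Ioo p q) ∧
      IntegrableOn (weight U c l Φ (1 - j)) (Ioo p q) := by
  have hsub : Ioo p q ⊆ Ioo a b := Ioo_subset_Ioo hp hq
  have hj : IntegrableOn (weight U c l Φ j) (Ioo p q) := by
    refine (integrable_const B).mono' (((continuousOn_weight hU hG hΦ j).mono
      hsub).aestronglyMeasurable measurableSet_Ioo) ?_
    refine (ae_restrict_iff' measurableSet_Ioo).2 (Eventually.of_forall fun x hx => ?_)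
    rw [Real.norm_eq_abs, abs_of_pos (weight_pos hG j (hsub hx))]
    exact hB x hx
  refine ⟨hj, ?_⟩
  -- Adding the slope λ_j B to ±Ψ⁻¹ makes the derivative nonnegative, because w_j ≤ B. The
  -- derivative of a continuous monotone function is integrable, so w_{1-j} is integrable with no
  -- rate of decay of Ψ⁻¹ required.
  have hderiv : ∀ x ∈ Ioo p q, HasDerivAt (fun x => l j * B * x + dirSign j * edge a b l Φ x)
      (l j * B - l j * weight U c l Φ j x + l (1 - j) * weight U c l Φ (1 - j) x) x := by
    intro x hx
    refine (((hasDerivAt_id x).const_mul (l j * B)).add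
      ((hasDerivAt_edge (l := l) hΦ (hsub hx)).const_mul (dirSign j))).congr_deriv ?_
    fin_cases j <;> simp [dirSign, Fin.sum_univ_two] <;> ring
  have hcont : ContinuousOn (fun x => l j * B * x + dirSign j * edge a b l Φ x) (Icc p q) :=
    (continuousOn_const.mul continuousOn_id).add (continuousOn_const.mul
      ((continuousOn_edge hU hG hl hΦ).mono (Icc_subset_Icc hp hq)))
  have hint := intervalIntegral.integrableOn_deriv_of_nonneg hcont hderiv fun x hx => by
    have h1 := mul_le_mul_of_nonneg_left (hB x hx) (hl j).le
    have h2 := mul_pos (hl (1 - j)) (weight_pos (l := l) (Φ := Φ) hG (1 - j) (hsub hx))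
    linarith
  have hint' : IntegrableOn (fun x => (l (1 - j))⁻¹ * ((l j * B - l j * weight U c l Φ j x +
      l (1 - j) * weight U c l Φ (1 - j) x) - l j * B + l j * weight U c l Φ j x)) (Ioo p q) :=
    (((hint.mono_set Ioo_subset_Ioc_self).sub (integrable_const _)).add (hj.const_mul (l j))).const_mul _
  refine hint'.congr_fun (fun x _ => ?_) measurableSet_Ioo
  have := (hl (1 - j)).ne'
  field_simp
  ring

theorem exists_edge_le (hU : ContDiff ℝ 2 U) (hG : IsAttractor U c a b) (hl : ∀ i, 0 < l i)
    (hΦ : IsRectifying U c a b Φ) : ∃ B, ∀ x ∈ Ioo a b, (Psi l Φ x)⁻¹ ≤ B := by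
  obtain ⟨B, hB⟩ := isCompact_Icc.bddAbove_image (continuousOn_edge hU hG hl hΦ)
  exact ⟨B, fun x hx => edge_of_mem (l := l) (Φ := Φ) hx ▸
    hB (mem_image_of_mem _ (Ioo_subset_Icc_self hx))⟩

/-- On the left half w_0 is bounded, since c_0 - U' stays away from 0 there; on the right half w_1
is bounded. On each half the bounded density controls the other one. -/
theorem integrableOn_weight (hU : ContDiff ℝ 2 U) (hG : IsAttractor U c a b) (hl : ∀ i, 0 < l i)
    (hΦ : IsRectifying U c a b Φ) (i : Fin 2) : IntegrableOn (weight U c l Φ i) (Ioo a b) := by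
  have hm := midpoint_mem hG
  set m := (a + b) / 2
  obtain ⟨B, hB⟩ := exists_edge_le hU hG hl hΦ
  obtain ⟨δ, hδ, hδ'⟩ := hG.exists_le_left hU hm
  obtain ⟨η, hη, hη'⟩ := hG.exists_le_right hU hm
  have hB0 : 0 ≤ B := (inv_pos.2 (Psi_pos l Φ m)).le.trans (hB m hm)
  have hleft := integrableOn_weight_of_bounded hU hG hl hΦ le_rfl hm.2.le 0 (B := B / δ)
    fun x hx => by
      rw [weight_eq_div]
      have := hδ' x ⟨hx.1.le, hx.2.le⟩
      simp only [dirSign, if_true, one_mul]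
      exact div_le_div₀ hB0 (hB x ⟨hx.1, hx.2.trans hm.2⟩) hδ this
  have hright := integrableOn_weight_of_bounded hU hG hl hΦ hm.1.le le_rfl 1 (B := B / η)
    fun x hx => by
      rw [weight_eq_div]
      have := hη' x ⟨hx.1.le, hx.2.le⟩
      refine div_le_div₀ hB0 (hB x ⟨hm.1.trans hx.1, hx.2⟩) hη ?_
      simpa [dirSign] using this
  have key : ∀ i, IntegrableOn (weight U c l Φ i) (Ioo a m) ∧
      IntegrableOn (weight U c l Φ i) (Ioo m b) := by
    intro i
    fin_cases i
    · exact ⟨hleft.1, hright.2⟩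
    · exact ⟨hleft.2, hright.1⟩
  have h1 := (key i).1.union ((integrableOn_Icc_iff_integrableOn_Ioo (a := m) (b := b)).2 (key i).2)
  refine h1.mono_set fun x hx => ?_
  by_cases h : x < m
  · exact Or.inl ⟨hx.1, h⟩
  · exact Or.inr ⟨not_lt.1 h, hx.2.le⟩

/-- Integration by parts against `Ψ⁻¹`, which vanishes at the endpoints. -/
theorem integral_deriv_mul_inv_Psi (hU : ContDiff ℝ 2 U) (hG : IsAttractor U c a b)
    (hl : ∀ i, 0 < l i) (hΦ : IsRectifying U c a b Φ) {f f' : ℝ → ℝ}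
    (hf : ContinuousOn f (Icc a b)) (hf' : ∀ x ∈ Ioo a b, HasDerivAt f (f' x) x)
    (hint : IntegrableOn (fun x => f' x * (Psi l Φ x)⁻¹) (Ioo a b)) :
    ∫ x in Ioo a b, f' x * (Psi l Φ x)⁻¹ =
      ∑ j, dirSign j * l j * ∫ x in Ioo a b, f x * weight U c l Φ j x := by
  obtain ⟨B, hB⟩ := isCompact_Icc.exists_bound_of_continuousOn hf
  have hfw : ∀ j, IntegrableOn (fun x => f x * weight U c l Φ j x) (Ioo a b) := fun j => by
    refine (integrableOn_weight hU hG hl hΦ j).bdd_mul (c := B)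
      ((hf.mono Ioo_subset_Icc_self).aestronglyMeasurable measurableSet_Ioo) ?_
    exact (ae_restrict_iff' measurableSet_Ioo).2
      (Eventually.of_forall fun x hx => hB x (Ioo_subset_Icc_self hx))
  have hsum : IntegrableOn (fun x => ∑ j, dirSign j * l j * (f x * weight U c l Φ j x)) (Ioo a b) :=
    integrable_finsetSum _ fun j _ => (hfw j).const_mul _
  have hd : ∀ x ∈ Ioo a b, HasDerivAt (fun x => f x * edge a b l Φ x)
      (f' x * (Psi l Φ x)⁻¹ - ∑ j, dirSign j * l j * (f x * weight U c l Φ j x)) x := by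
    intro x hx
    refine ((hf' x hx).mul (hasDerivAt_edge (l := l) hΦ hx)).congr_deriv ?_
    rw [edge_of_mem hx]
    simp only [Fin.sum_univ_two]
    ring
  have h0 := intervalIntegral.integral_eq_sub_of_hasDerivAt_of_le hG.lt.le
    (hf.mul (continuousOn_edge hU hG hl hΦ)) hd
    ((intervalIntegrable_iff_integrableOn_Ioo_of_le hG.lt.le).2 (hint.sub hsum))
  simp only [Pi.mul_apply] at h0
  rw [edge_left, edge_right, intervalIntegral.integral_of_le hG.lt.le,
    integral_Ioc_eq_integral_Ioo, integral_sub hint hsum,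
    integral_finsetSum _ fun j _ => (hfw j).const_mul _] at h0
  simp only [integral_const_mul, mul_zero, sub_zero] at h0
  linarith

theorem integrableOn_inv_Psi (hU : ContDiff ℝ 2 U) (hG : IsAttractor U c a b) (hl : ∀ i, 0 < l i)
    (hΦ : IsRectifying U c a b Φ) : IntegrableOn (fun x => (Psi l Φ x)⁻¹) (Ioo a b) :=
  (((continuousOn_edge hU hG hl hΦ).integrableOn_Icc (μ := volume)).mono_set
    Ioo_subset_Icc_self).congr_fun (fun _ hx => edge_of_mem hx) measurableSet_Ioo

/-- Integration by parts with f = 1: switchings out of the two states balance. This is what makes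
the two normalising constants equal. -/
theorem mul_integral_weight_eq (hU : ContDiff ℝ 2 U) (hG : IsAttractor U c a b)
    (hl : ∀ i, 0 < l i) (hΦ : IsRectifying U c a b Φ) :
    l 0 * ∫ x in Ioo a b, weight U c l Φ 0 x = l 1 * ∫ x in Ioo a b, weight U c l Φ 1 x := by
  have := integral_deriv_mul_inv_Psi hU hG hl hΦ (f := fun _ => 1) (f' := fun _ => 0)
    continuousOn_const (fun x _ => hasDerivAt_const x 1) (by simp)
  simp [Fin.sum_univ_two, dirSign] at this
  linarith

theorem integral_weight_pos (hU : ContDiff ℝ 2 U) (hG : IsAttractor U c a b)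
    (hl : ∀ i, 0 < l i) (hΦ : IsRectifying U c a b Φ) (i : Fin 2) :
    0 < ∫ x in Ioo a b, weight U c l Φ i x := by
  rw [setIntegral_pos_iff_support_of_nonneg_ae]
  · have : Ioo a b ⊆ Function.support (weight U c l Φ i) ∩ Ioo a b := fun x hx =>
      ⟨(weight_pos hG i hx).ne', hx⟩
    refine lt_of_lt_of_le ?_ (measure_mono this)
    simp [hG.lt]
  · exact (ae_restrict_iff' measurableSet_Ioo).2
      (Eventually.of_forall fun x hx => (weight_pos hG i hx).le)
  · exact integrableOn_weight hU hG hl hΦ i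

/-! ### The stationary equation in mild form -/

/-- The flow is a translation in the rectifying coordinate. -/
theorem rectify_flow (hU : ContDiff ℝ 2 U) (hG : IsAttractor U c a b) (hΦ : IsRectifying U c a b Φ)
    (i : Fin 2) {x : ℝ} (hx : x ∈ Ioo a b) {t : ℝ} (ht : 0 ≤ t) :
    Φ i (flow U c a b i t x) = Φ i x + t := by
  have hd : ∀ s ∈ Ici (0 : ℝ), HasDerivWithinAt (fun s => Φ i (flow U c a b i s x) - s)
      0 (Ici 0) s := by
    intro s hs
    have hm := flow_mem_Ioo hU hG i hx hs
    have h1 := (hΦ i _ hm).comp_hasDerivWithinAt s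
      (hasDerivWithinAt_flow hU hG i (Ioo_subset_Icc_self hx) hs)
    refine (h1.sub (hasDerivWithinAt_id s _)).congr_deriv ?_
    rw [one_div_mul_cancel (hG.velocity_ne_zero i hm), sub_self]
  have h := Convex.norm_image_sub_le_of_norm_hasDerivWithin_le (C := 0) hd (by simp)
    (convex_Ici 0) (self_mem_Ici (a := (0 : ℝ))) (show t ∈ Ici 0 from ht)
  rw [zero_mul, norm_le_zero_iff, flow_zero hU hG i (Ioo_subset_Icc_self hx)] at h
  linarith

/-- In the coordinate Φ_i the flow is the translation by t, so near x it is y ↦ Φ_i⁻¹(Φ_i(y) + t)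
with a local inverse of Φ_i. The formula says that the flow carries its own vector field to itself.
-/
theorem hasDerivAt_flow_space (hU : ContDiff ℝ 2 U) (hG : IsAttractor U c a b)
    (hΦ : IsRectifying U c a b Φ) (i : Fin 2) {x : ℝ} (hx : x ∈ Ioo a b) {t : ℝ} (ht : 0 ≤ t) :
    HasDerivAt (flow U c a b i t)
      ((c i - deriv U (flow U c a b i t x)) / (c i - deriv U x)) x := by
  have hm := flow_mem_Ioo hU hG i hx ht
  have hne := hG.velocity_ne_zero i hm
  have hstrict : HasStrictDerivAt (Φ i) (1 / (c i - deriv U (flow U c a b i t x)))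
      (flow U c a b i t x) := by
    refine hasStrictDerivAt_of_hasDerivAt_of_continuousAt (f' := fun y => 1 / (c i - deriv U y))
      ?_ ?_
    · filter_upwards [isOpen_Ioo.mem_nhds hm] with y hy using hΦ i y hy
    · exact continuousAt_const.div (continuousAt_const.sub
        (continuous_deriv_of_contDiff hU).continuousAt) hne
  have hne' : 1 / (c i - deriv U (flow U c a b i t x)) ≠ 0 := one_div_ne_zero hne
  have hinv := hstrict.to_localInverse hne'
  have heq : ∀ᶠ y in 𝓝 x, flow U c a b i t y =
      hstrict.localInverse _ _ _ hne' (Φ i y + t) := by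
    have h1 := (hstrict.hasStrictFDerivAt_equiv hne').eventually_left_inverse
    have h2 := (continuous_flow_space hU hG i t).tendsto x
    filter_upwards [h2.eventually h1, isOpen_Ioo.mem_nhds hx] with y hy hyI
    rw [← rectify_flow hU hG hΦ i hyI ht]
    exact hy.symm
  have hk : HasDerivAt (fun y => Φ i y + t) (1 / (c i - deriv U x)) x :=
    (hΦ i x hx).add_const t
  have hinv' := hinv.hasDerivAt
  rw [rectify_flow hU hG hΦ i hx ht] at hinv'
  refine ((hinv'.comp x hk).congr_of_eventuallyEq heq).congr_deriv ?_
  rw [one_div, inv_inv, mul_one_div]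

/-- The measure on `(a, b)` whose density is the `i`-th unnormalised stationary density. -/
def weightMeasure (U : ℝ → ℝ) (c l : Fin 2 → ℝ) (a b : ℝ) (Φ : Fin 2 → ℝ → ℝ) (i : Fin 2) :
    Measure ℝ :=
  (volume.restrict (Ioo a b)).withDensity fun x => ENNReal.ofReal (weight U c l Φ i x)

theorem aemeasurable_weight (hU : ContDiff ℝ 2 U) (hG : IsAttractor U c a b)
    (hΦ : IsRectifying U c a b Φ) (i : Fin 2) :
    AEMeasurable (weight U c l Φ i) (volume.restrict (Ioo a b)) :=
  (continuousOn_weight hU hG hΦ i).aemeasurable measurableSet_Ioo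

theorem isFiniteMeasure_weightMeasure (hU : ContDiff ℝ 2 U) (hG : IsAttractor U c a b)
    (hl : ∀ i, 0 < l i) (hΦ : IsRectifying U c a b Φ) (i : Fin 2) :
    IsFiniteMeasure (weightMeasure U c l a b Φ i) :=
  isFiniteMeasure_withDensity_ofReal (integrableOn_weight hU hG hl hΦ i).2

theorem integral_weightMeasure (hU : ContDiff ℝ 2 U) (hG : IsAttractor U c a b)
    (hΦ : IsRectifying U c a b Φ) (i : Fin 2) (f : ℝ → ℝ) :
    ∫ x, f x ∂weightMeasure U c l a b Φ i = ∫ x in Ioo a b, f x * weight U c l Φ i x := by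
  rw [weightMeasure, integral_withDensity_eq_integral_toReal_smul₀
    (aemeasurable_weight hU hG hΦ i).ennreal_ofReal (by simp)]
  refine setIntegral_congr_fun measurableSet_Ioo fun x hx => ?_
  simp only [smul_eq_mul]
  rw [ENNReal.toReal_ofReal (weight_pos hG i hx).le, mul_comm]

theorem ae_mem_weightMeasure (i : Fin 2) :
    ∀ᵐ x ∂weightMeasure U c l a b Φ i, x ∈ Ioo a b :=
  (withDensity_absolutelyContinuous _ _).ae_le (ae_restrict_mem measurableSet_Ioo)

theorem aestronglyMeasurable_comp_flow (hU : ContDiff ℝ 2 U) (hG : IsAttractor U c a b)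
    {f : ℝ → ℝ} (hf : Continuous f) (i : Fin 2) (t : ℝ) (m : Measure ℝ) :
    AEStronglyMeasurable (fun x => f (flow U c a b i t x)) m :=
  (hf.comp (continuous_flow_space hU hG i t)).aestronglyMeasurable

theorem continuous_integral_comp_flow (hU : ContDiff ℝ 2 U) (hG : IsAttractor U c a b)
    {f : ℝ → ℝ} (hf : Continuous f) (i : Fin 2) (m : Measure ℝ) [IsFiniteMeasure m] :
    Continuous fun t => ∫ x, f (flow U c a b i t x) ∂m := by
  obtain ⟨B, hB⟩ := (isCompact_Icc (a := a) (b := b)).exists_bound_of_continuousOn hf.continuousOn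
  exact continuous_of_dominated (bound := fun _ => B)
    (fun t => aestronglyMeasurable_comp_flow hU hG hf i t m)
    (fun t => Eventually.of_forall fun x => hB _ (flow_mem hU hG i t x))
    (integrable_const B)
    (Eventually.of_forall fun x => hf.comp (continuous_flow_time hU hG i x))

/-- Differentiation under the integral brings out (f' v_i)(φ_t x). Invariance of v_i under its flow
turns this, multiplied by w_i, into ±(f ∘ φ_t)' Ψ⁻¹, and integration by parts removes the
derivative. Only f, not the density, is differentiated in space. -/
theorem hasDerivAt_integral_comp_flow (hU : ContDiff ℝ 2 U) (hG : IsAttractor U c a b)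
    (hl : ∀ i, 0 < l i) (hΦ : IsRectifying U c a b Φ) {f f' : ℝ → ℝ}
    (hf : ∀ x, HasDerivAt f (f' x) x) (hf' : Continuous f') (i : Fin 2) {t : ℝ} (ht : 0 < t) :
    HasDerivAt (fun t => ∫ x, f (flow U c a b i t x) ∂weightMeasure U c l a b Φ i)
      (l i * (∫ x, f (flow U c a b i t x) ∂weightMeasure U c l a b Φ i) -
        l (1 - i) * ∫ x, f (flow U c a b i t x) ∂weightMeasure U c l a b Φ (1 - i)) t := by
  have hfc : Continuous f := continuous_iff_continuousAt.2 fun x => (hf x).continuousAt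
  have := isFiniteMeasure_weightMeasure hU hG hl hΦ i
  set v : ℝ → ℝ := fun y => f' y * (c i - deriv U y) with hv
  have hvc : Continuous v := hf'.mul (continuous_const.sub (continuous_deriv_of_contDiff hU))
  obtain ⟨B, hB⟩ := (isCompact_Icc (a := a) (b := b)).exists_bound_of_continuousOn hfc.continuousOn
  obtain ⟨D, hD⟩ := (isCompact_Icc (a := a) (b := b)).exists_bound_of_continuousOn hvc.continuousOn
  have h1 := (hasDerivAt_integral_of_dominated_loc_of_deriv_le
    (μ := weightMeasure U c l a b Φ i) (F := fun t x => f (flow U c a b i t x))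
    (F' := fun t x => v (flow U c a b i t x)) (x₀ := t) (s := Ioi 0) (bound := fun _ => D)
    (Ioi_mem_nhds ht)
    (Eventually.of_forall fun s => aestronglyMeasurable_comp_flow hU hG hfc i s _)
    ((integrable_const B).mono' (aestronglyMeasurable_comp_flow hU hG hfc i t _)
      (Eventually.of_forall fun x => hB _ (flow_mem hU hG i t x)))
    (aestronglyMeasurable_comp_flow hU hG hvc i t _)
    (Eventually.of_forall fun x s _ => hD _ (flow_mem hU hG i s x))
    (integrable_const D)
    (by
      filter_upwards [ae_mem_weightMeasure i] with x hx s hs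
      have h2 := (hasDerivWithinAt_flow hU hG i (Ioo_subset_Icc_self hx)
        (le_of_lt hs)).hasDerivAt (Ici_mem_nhds hs)
      exact (hf _).comp s h2)).2
  refine h1.congr_deriv ?_
  -- The factor 1 / v_i(x) from the spatial derivative of the flow combines with Ψ⁻¹ into the weight
  -- w_i, up to sign.
  have hpt : ∀ x ∈ Ioo a b, f' (flow U c a b i t x) *
      ((c i - deriv U (flow U c a b i t x)) / (c i - deriv U x)) * (Psi l Φ x)⁻¹ =
      dirSign i * (v (flow U c a b i t x) * weight U c l Φ i x) := by
    intro x hx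
    have h3 := hG.velocity_ne_zero i hx
    have h4 := dirSign_mul_self i
    rw [weight, hv]
    field_simp
    rw [sq, h4, mul_one]
  have hparts := integral_deriv_mul_inv_Psi hU hG hl hΦ (f := fun x => f (flow U c a b i t x))
    (f' := fun x => f' (flow U c a b i t x) *
      ((c i - deriv U (flow U c a b i t x)) / (c i - deriv U x)))
    (hfc.comp (continuous_flow_space hU hG i t)).continuousOn
    (fun x hx => (hf _).comp x (hasDerivAt_flow_space hU hG hΦ i hx ht.le))
    (by
      have h5 : IntegrableOn (fun x => v (flow U c a b i t x) * weight U c l Φ i x) (Ioo a b) :=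
        (integrableOn_weight hU hG hl hΦ i).bdd_mul (c := D)
          (aestronglyMeasurable_comp_flow hU hG hvc i t _)
          (Eventually.of_forall fun x => hD _ (flow_mem hU hG i t x))
      exact IntegrableOn.congr_fun (h5.const_mul (dirSign i)) (fun x hx => (hpt x hx).symm)
        measurableSet_Ioo)
  rw [setIntegral_congr_fun measurableSet_Ioo hpt, integral_const_mul,
    ← integral_weightMeasure hU hG hΦ i (fun x => v (flow U c a b i t x))] at hparts
  simp only [← integral_weightMeasure hU hG hΦ _ (fun x => f (flow U c a b i t x))] at hparts
  revert hparts
  fin_cases i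
  · simp [dirSign, Fin.sum_univ_two]
    intro h
    linarith
  · simp [dirSign, Fin.sum_univ_two]
    intro h
    linarith

/-- The factor e^{-λ_i t} cancels the term λ_i ∫ f ∘ φ_t dσ_i of the derivative; integrating the
remaining source term over (0, t] gives the formula. -/
theorem integral_weightMeasure_eq (hU : ContDiff ℝ 2 U) (hG : IsAttractor U c a b)
    (hl : ∀ i, 0 < l i) (hΦ : IsRectifying U c a b Φ) {f f' : ℝ → ℝ}
    (hf : ∀ x, HasDerivAt f (f' x) x) (hf' : Continuous f') (i : Fin 2) {t : ℝ} (ht : 0 ≤ t) :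
    ∫ x, f x ∂weightMeasure U c l a b Φ i =
      Real.exp (-(l i * t)) * ∫ x, f (flow U c a b i t x) ∂weightMeasure U c l a b Φ i +
      ∫ r in Ioc 0 t, l (1 - i) * Real.exp (-(l i * r)) *
        ∫ x, f (flow U c a b i r x) ∂weightMeasure U c l a b Φ (1 - i) := by
  have hfc : Continuous f := continuous_iff_continuousAt.2 fun x => (hf x).continuousAt
  have := isFiniteMeasure_weightMeasure hU hG hl hΦ
  have hM := continuous_integral_comp_flow hU hG hfc i (weightMeasure U c l a b Φ i)
  have hN := continuous_integral_comp_flow hU hG hfc i (weightMeasure U c l a b Φ (1 - i))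
  have hder : ∀ s ∈ Ioo 0 t, HasDerivAt (fun s => Real.exp (-(l i * s)) *
      ∫ x, f (flow U c a b i s x) ∂weightMeasure U c l a b Φ i)
      (-(l (1 - i) * Real.exp (-(l i * s)) *
        ∫ x, f (flow U c a b i s x) ∂weightMeasure U c l a b Φ (1 - i))) s := by
    intro s hs
    have he : HasDerivAt (fun s => Real.exp (-(l i * s))) (Real.exp (-(l i * s)) * -(l i * 1)) s :=
      (((hasDerivAt_id s).const_mul (l i)).neg).exp
    refine (he.mul (hasDerivAt_integral_comp_flow hU hG hl hΦ hf hf' i hs.1)).congr_deriv ?_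
    ring
  have hint : Continuous fun s => -(l (1 - i) * Real.exp (-(l i * s)) *
        ∫ x, f (flow U c a b i s x) ∂weightMeasure U c l a b Φ (1 - i)) := by fun_prop
  have hcont : Continuous fun s => Real.exp (-(l i * s)) *
      ∫ x, f (flow U c a b i s x) ∂weightMeasure U c l a b Φ i := by fun_prop
  have key := intervalIntegral.integral_eq_sub_of_hasDerivAt_of_le ht hcont.continuousOn hder
    (hint.intervalIntegrable _ _)
  rw [intervalIntegral.integral_neg, intervalIntegral.integral_of_le ht] at key
  have h0 : ∫ x, f (flow U c a b i 0 x) ∂weightMeasure U c l a b Φ i =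
      ∫ x, f x ∂weightMeasure U c l a b Φ i := by
    refine integral_congr_ae ?_
    filter_upwards [ae_mem_weightMeasure i] with x hx
    rw [flow_zero hU hG i (Ioo_subset_Icc_self hx)]
  rw [h0, mul_zero, neg_zero, Real.exp_zero, one_mul] at key
  linarith

/-- Finite measures on the line are determined by the integrals of sines and cosines. -/
theorem ext_of_integral_cos_sin {m n : Measure ℝ} [IsFiniteMeasure m] [IsFiniteMeasure n]
    (hcos : ∀ ξ, ∫ x, Real.cos (ξ * x) ∂m = ∫ x, Real.cos (ξ * x) ∂n)
    (hsin : ∀ ξ, ∫ x, Real.sin (ξ * x) ∂m = ∫ x, Real.sin (ξ * x) ∂n) : m = n := by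
  refine Measure.ext_of_charFun (funext fun ξ => ?_)
  have key : ∀ (k : Measure ℝ) [IsFiniteMeasure k], charFun k ξ =
      ((∫ x, Real.cos (ξ * x) ∂k : ℝ) : ℂ) + ((∫ x, Real.sin (ξ * x) ∂k : ℝ) : ℂ) * Complex.I := by
    intro k _
    have hc' : Integrable (fun x => Real.cos (ξ * x)) k :=
      (integrable_const (1 : ℝ)).mono' (Continuous.aestronglyMeasurable (by fun_prop))
        (Eventually.of_forall fun x => Real.abs_cos_le_one _)
    have hc : Integrable (fun x => ((Real.cos (ξ * x) : ℝ) : ℂ)) k := hc'.ofReal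
    have hs' : Integrable (fun x => Real.sin (ξ * x)) k :=
      (integrable_const (1 : ℝ)).mono' (Continuous.aestronglyMeasurable (by fun_prop))
        (Eventually.of_forall fun x => Real.abs_sin_le_one _)
    have hs : Integrable (fun x => ((Real.sin (ξ * x) : ℝ) : ℂ)) k := hs'.ofReal
    rw [charFun_apply_real, ← integral_complex_ofReal, ← integral_complex_ofReal,
      ← integral_mul_const, ← integral_add hc (hs.mul_const _)]
    refine integral_congr_ae (Eventually.of_forall fun x => ?_)
    simp only
    rw [← Complex.ofReal_mul, Complex.exp_mul_I, Complex.ofReal_cos, Complex.ofReal_sin]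
  rw [key m, key n, hcos, hsin]

/-- The image under the flow of the product of `λ₁₋ᵢ e^{-λᵢ r} dr`, `0 < r ≤ t`, and the weight of
the other state. -/
def occupation (U : ℝ → ℝ) (c l : Fin 2 → ℝ) (a b : ℝ) (Φ : Fin 2 → ℝ → ℝ) (i : Fin 2) (t : ℝ) :
    Measure ℝ :=
  (((volume.restrict (Ioc 0 t)).withDensity fun r =>
    ENNReal.ofReal (l (1 - i) * Real.exp (-(l i * r)))).prod
      (weightMeasure U c l a b Φ (1 - i))).map fun p => flow U c a b i p.1 p.2

theorem isFiniteMeasure_expDensity (A k t : ℝ) :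
    IsFiniteMeasure ((volume.restrict (Ioc 0 t)).withDensity fun r =>
      ENNReal.ofReal (A * Real.exp (-(k * r)))) :=
  isFiniteMeasure_withDensity_ofReal
    ((Continuous.integrableOn_Icc (by fun_prop)).mono_set Ioc_subset_Icc_self).2

/-- The mild form of the stationary Kolmogorov equation. -/
theorem lintegral_weightMeasure_eq (hU : ContDiff ℝ 2 U) (hG : IsAttractor U c a b)
    (hl : ∀ i, 0 < l i) (hΦ : IsRectifying U c a b Φ) (i : Fin 2) {t : ℝ} (ht : 0 ≤ t)
    {h : ℝ → ℝ≥0∞} (hh : Measurable h) :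
    ∫⁻ x, h x ∂weightMeasure U c l a b Φ i =
      ENNReal.ofReal (Real.exp (-(l i * t))) *
        ∫⁻ x, h (flow U c a b i t x) ∂weightMeasure U c l a b Φ i +
      ∫⁻ r in Ioc 0 t, ENNReal.ofReal (l (1 - i) * Real.exp (-(l i * r))) *
        ∫⁻ x, h (flow U c a b i r x) ∂weightMeasure U c l a b Φ (1 - i) := by
  have hfin := isFiniteMeasure_weightMeasure hU hG hl hΦ
  have hexp := isFiniteMeasure_expDensity (l (1 - i)) (l i) t
  have hflow := measurable_flow hU hG i
  have hflow' := (continuous_flow_space hU hG i t).measurable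
  have : IsFiniteMeasure (occupation U c l a b Φ i t) := by
    unfold occupation
    infer_instance
  have hmeas : Measurable fun r => ENNReal.ofReal (l (1 - i) * Real.exp (-(l i * r))) := by
    fun_prop
  have hpos : ∀ r, 0 ≤ l (1 - i) * Real.exp (-(l i * r)) := fun r =>
    mul_nonneg (hl _).le (Real.exp_pos _).le
  -- The identity for C¹ test functions is an identity of integrals against two finite measures.
  -- Sines and cosines are among the test functions, so the measures agree and the identity extends
  -- to all measurable h ≥ 0.
  have hreal : ∀ {f f' : ℝ → ℝ}, (∀ x, HasDerivAt f (f' x) x) → Continuous f' →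
      ∫ x, f x ∂weightMeasure U c l a b Φ i =
        ∫ x, f x ∂(ENNReal.ofReal (Real.exp (-(l i * t))) •
          (weightMeasure U c l a b Φ i).map (flow U c a b i t) + occupation U c l a b Φ i t) := by
    intro f f' hf hf'
    have hfc : Continuous f := continuous_iff_continuousAt.2 fun x => (hf x).continuousAt
    obtain ⟨B, hB⟩ := (isCompact_Icc (a := a) (b := b)).exists_bound_of_continuousOn
      hfc.continuousOn
    have hint1 : Integrable f ((weightMeasure U c l a b Φ i).map (flow U c a b i t)) := by
      rw [integrable_map_measure hfc.aestronglyMeasurable hflow'.aemeasurable]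
      exact (integrable_const B).mono' (aestronglyMeasurable_comp_flow hU hG hfc i t _)
        (Eventually.of_forall fun x => hB _ (flow_mem hU hG i t x))
    have hint2' : Integrable (fun p : ℝ × ℝ => f (flow U c a b i p.1 p.2))
        (((volume.restrict (Ioc 0 t)).withDensity fun r =>
          ENNReal.ofReal (l (1 - i) * Real.exp (-(l i * r)))).prod
            (weightMeasure U c l a b Φ (1 - i))) :=
      (integrable_const B).mono' (hfc.measurable.comp hflow).aestronglyMeasurable
        (Eventually.of_forall fun p => hB _ (flow_mem hU hG i p.1 p.2))
    have hint2 : Integrable f (occupation U c l a b Φ i t) := by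
      rw [occupation, integrable_map_measure hfc.aestronglyMeasurable hflow.aemeasurable]
      exact hint2'
    rw [integral_add_measure (hint1.smul_measure ENNReal.ofReal_ne_top) hint2,
      integral_smul_measure, integral_map hflow'.aemeasurable hfc.aestronglyMeasurable,
      occupation, integral_map hflow.aemeasurable hfc.aestronglyMeasurable,
      integral_prod _ hint2', integral_withDensity_eq_integral_toReal_smul hmeas (by simp),
      integral_weightMeasure_eq hU hG hl hΦ hf hf' i ht,
      ENNReal.toReal_ofReal (Real.exp_pos _).le]
    simp only [smul_eq_mul, ENNReal.toReal_ofReal (hpos _)]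
  have hmeq : weightMeasure U c l a b Φ i = ENNReal.ofReal (Real.exp (-(l i * t))) •
      (weightMeasure U c l a b Φ i).map (flow U c a b i t) + occupation U c l a b Φ i t := by
    have : IsFiniteMeasure (ENNReal.ofReal (Real.exp (-(l i * t))) •
      (weightMeasure U c l a b Φ i).map (flow U c a b i t)) := Measure.smul_finite _ ENNReal.ofReal_ne_top
    refine ext_of_integral_cos_sin (fun ξ => ?_) fun ξ => ?_
    · exact hreal (f := fun x => Real.cos (ξ * x)) (f' := fun x => -Real.sin (ξ * x) * (ξ * 1))
        (fun x => ((hasDerivAt_id x).const_mul ξ).cos) (by fun_prop)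
    · exact hreal (f := fun x => Real.sin (ξ * x)) (f' := fun x => Real.cos (ξ * x) * (ξ * 1))
        (fun x => ((hasDerivAt_id x).const_mul ξ).sin) (by fun_prop)
  conv_lhs => rw [hmeq]
  have hin : Measurable fun r => ∫⁻ x, h (flow U c a b i r x) ∂weightMeasure U c l a b Φ (1 - i) :=
    (hh.comp hflow).lintegral_prod_right'
  have hhf : Measurable fun p : ℝ × ℝ => h (flow U c a b i p.1 p.2) := hh.comp hflow
  rw [lintegral_add_measure, lintegral_smul_measure, lintegral_map hh hflow', occupation,
    lintegral_map hh hflow, lintegral_prod _ hhf.aemeasurable,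
    lintegral_withDensity_eq_lintegral_mul _ hmeas hin, smul_eq_mul]
  rfl

/-! ### Invariance -/

theorem lintegral_expMeasure {k : ℝ} (hk : 0 < k) {F : ℝ → ℝ≥0∞} (hF : Measurable F) :
    ∫⁻ r, F r ∂expMeasure k =
      ENNReal.ofReal k * ∫⁻ r in Ioi 0, ENNReal.ofReal (Real.exp (-(k * r))) * F r := by
  have h1 : expMeasure k = volume.withDensity (exponentialPDF k) := rfl
  have hm : Measurable (exponentialPDF k) := (measurable_exponentialPDFReal k).ennreal_ofReal
  rw [h1, lintegral_withDensity_eq_lintegral_mul _ hm hF, ← lintegral_const_mul _ (by fun_prop),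
    ← lintegral_indicator measurableSet_Ioi]
  have h0 : ∀ᵐ r : ℝ, r ≠ 0 := by simp [ae_iff]
  refine lintegral_congr_ae ?_
  filter_upwards [h0] with r hr
  rcases lt_or_gt_of_ne hr with h | h
  · rw [indicator_of_notMem (by simpa using h.le), Pi.mul_apply, exponentialPDF_of_neg h, zero_mul]
  · rw [indicator_of_mem (mem_Ioi.2 h), Pi.mul_apply, exponentialPDF_of_nonneg h.le,
      ENNReal.ofReal_mul hk.le, mul_assoc]

theorem expMeasure_Ioi {k : ℝ} (hk : 0 < k) {t : ℝ} (ht : 0 ≤ t) :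
    expMeasure k (Ioi t) = ENNReal.ofReal (Real.exp (-(k * t))) := by
  have := isProbabilityMeasure_expMeasure hk
  rw [← compl_Iic, prob_compl_eq_one_sub measurableSet_Iic, expMeasure_Iic hk, if_pos ht,
    ← ENNReal.ofReal_one, ← ENNReal.ofReal_sub]
  · congr 1; ring
  · have : Real.exp (-(k * t)) ≤ 1 := Real.exp_le_one_iff.2 (by nlinarith)
    linarith

/-- The function `1_{u > 0} e^{-λᵢ u}`. -/
def expKernel (l : Fin 2 → ℝ) (i : Fin 2) : ℝ → ℝ≥0∞ :=
  (Ioi 0).indicator fun u => ENNReal.ofReal (Real.exp (-(l i * u)))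

theorem measurable_expKernel (i : Fin 2) : Measurable (expKernel l i) :=
  Measurable.indicator (by fun_prop) measurableSet_Ioi

/-- The action of the transition function, extended by zero to negative times. -/
def killedSemigroup (U : ℝ → ℝ) (c l : Fin 2 → ℝ) (a b : ℝ) (f : ℝ × Fin 2 → ℝ≥0∞) (t : ℝ)
    (z : ℝ × Fin 2) : ℝ≥0∞ :=
  if 0 ≤ t then lsemigroup U c l a b f t z else 0

theorem measurable_killedSemigroup (hU : ContDiff ℝ 2 U) (hG : IsAttractor U c a b)
    (hl : ∀ i, 0 < l i) {f : ℝ × Fin 2 → ℝ≥0∞} (hf : Measurable f) :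
    Measurable fun p : (ℝ × ℝ) × Fin 2 => killedSemigroup U c l a b f p.1.1 (p.1.2, p.2) :=
  Measurable.ite (measurable_fst.fst measurableSet_Ici) (measurable_lsemigroup hU hG hl hf)
    measurable_const

/-- Extending by zero to negative times removes the upper limit t from the renewal integral, so it
becomes an integral over the whole line that can be translated freely. -/
theorem killedSemigroup_renewal (hU : ContDiff ℝ 2 U) (hG : IsAttractor U c a b)
    (hl : ∀ i, 0 < l i) {f : ℝ × Fin 2 → ℝ≥0∞} (hf : Measurable f) {x : ℝ} (hx : x ∈ Icc a b)
    (i : Fin 2) (t : ℝ) :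
    killedSemigroup U c l a b f t (x, i) =
      (if 0 ≤ t then ENNReal.ofReal (Real.exp (-(l i * t))) * f (flow U c a b i t x, i) else 0) +
      ENNReal.ofReal (l i) * ∫⁻ u, expKernel l i u *
        killedSemigroup U c l a b f (t - u) (flow U c a b i u x, 1 - i) := by
  have hmeas : Measurable fun u =>
      killedSemigroup U c l a b f (t - u) (flow U c a b i u x, 1 - i) :=
    (measurable_killedSemigroup hU hG hl hf).comp (((measurable_const.sub measurable_id).prodMk
      (continuous_flow_time hU hG i x).measurable).prodMk measurable_const)
  have hker : ∀ u, expKernel l i u *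
      killedSemigroup U c l a b f (t - u) (flow U c a b i u x, 1 - i) =
      (Ioi 0).indicator (fun u => ENNReal.ofReal (Real.exp (-(l i * u))) *
        killedSemigroup U c l a b f (t - u) (flow U c a b i u x, 1 - i)) u := fun u =>
    (indicator_mul_left (Ioi 0) (fun u => ENNReal.ofReal (Real.exp (-(l i * u)))) fun u =>
      killedSemigroup U c l a b f (t - u) (flow U c a b i u x, 1 - i)).symm
  simp only [hker]
  rw [lintegral_indicator measurableSet_Ioi, ← lintegral_expMeasure (hl i) hmeas]
  by_cases ht : 0 ≤ t
  · rw [if_pos ht, killedSemigroup, if_pos ht, lsemigroup_renewal hU hG hl hf hx i ht,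
      ← expMeasure_Ioi (hl i) ht, mul_comm (expMeasure (l i) (Ioi t)),
      ← setLIntegral_const, ← lintegral_indicator measurableSet_Ioi, ← lintegral_add_right _ hmeas]
    refine lintegral_congr fun r => ?_
    by_cases h : t < r
    · rw [if_pos h, indicator_of_mem (mem_Ioi.2 h), killedSemigroup,
        if_neg (by simpa using h), add_zero]
    · rw [if_neg h, indicator_of_notMem (by simpa using h), killedSemigroup,
        if_pos (by simpa using h), zero_add]
  · rw [if_neg ht, killedSemigroup, if_neg ht, zero_add]
    symm
    refine lintegral_eq_zero_of_ae_eq_zero ?_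
    filter_upwards [ae_pos_expMeasure (hl i)] with r hr
    rw [killedSemigroup, if_neg (by push Not at ht; linarith), Pi.zero_apply]

/-- The mild equation with the same kernel as the renewal equation, so that the two can be compared
term by term. The switch from (0, t] to (0, t) costs only a null set. -/
theorem lintegral_weightMeasure_eq_kernel (hU : ContDiff ℝ 2 U) (hG : IsAttractor U c a b)
    (hl : ∀ i, 0 < l i) (hΦ : IsRectifying U c a b Φ) (i : Fin 2) {t : ℝ} (ht : 0 ≤ t)
    {h : ℝ → ℝ≥0∞} (hh : Measurable h) :
    ∫⁻ x, h x ∂weightMeasure U c l a b Φ i =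
      ENNReal.ofReal (Real.exp (-(l i * t))) *
        ∫⁻ x, h (flow U c a b i t x) ∂weightMeasure U c l a b Φ i +
      ENNReal.ofReal (l (1 - i)) * ∫⁻ u, expKernel l i u *
        (Iio t).indicator
          (fun u => ∫⁻ x, h (flow U c a b i u x) ∂weightMeasure U c l a b Φ (1 - i)) u := by
  have hfin := isFiniteMeasure_weightMeasure hU hG hl hΦ
  have hin : Measurable fun r => ∫⁻ x, h (flow U c a b i r x) ∂weightMeasure U c l a b Φ (1 - i) :=
    (hh.comp (measurable_flow hU hG i)).lintegral_prod_right'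
  rw [lintegral_weightMeasure_eq hU hG hl hΦ i ht hh]
  congr 1
  have hm : Measurable fun u => expKernel l i u * (Iio t).indicator
      (fun u => ∫⁻ x, h (flow U c a b i u x) ∂weightMeasure U c l a b Φ (1 - i)) u :=
    (measurable_expKernel i).mul (hin.indicator measurableSet_Iio)
  rw [← lintegral_const_mul _ hm,
    ← setLIntegral_congr Ioo_ae_eq_Ioc, ← lintegral_indicator measurableSet_Ioo]
  refine lintegral_congr fun u => ?_
  by_cases h1 : 0 < u
  · by_cases h2 : u < t
    · rw [indicator_of_mem (show u ∈ Ioo 0 t from ⟨h1, h2⟩), expKernel, indicator_of_mem (mem_Ioi.2 h1),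
        indicator_of_mem (mem_Iio.2 h2), ENNReal.ofReal_mul (hl _).le, mul_assoc]
    · rw [indicator_of_notMem (show u ∉ Ioo 0 t from fun h => h2 h.2),
        indicator_of_notMem (show u ∉ Iio t from h2), mul_zero,
        mul_zero]
  · rw [indicator_of_notMem (show u ∉ Ioo 0 t from fun h => h1 h.1), expKernel,
      indicator_of_notMem (show u ∉ Ioi 0 from h1),
      zero_mul, mul_zero]

/-- The total mass at time `t` transported into the set described by `f` is unchanged, when the
process starts from the stationary weights. -/
theorem sum_lintegral_lsemigroup (hU : ContDiff ℝ 2 U) (hG : IsAttractor U c a b)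
    (hl : ∀ i, 0 < l i) (hΦ : IsRectifying U c a b Φ) {f : ℝ × Fin 2 → ℝ≥0∞} (hf : Measurable f)
    (hf1 : ∀ z, f z ≤ 1) {t : ℝ} (ht : 0 ≤ t) :
    ∑ i, ∫⁻ x, lsemigroup U c l a b f t (x, i) ∂weightMeasure U c l a b Φ i =
      ∑ i, ∫⁻ x, f (x, i) ∂weightMeasure U c l a b Φ i := by
  have hfin := isFiniteMeasure_weightMeasure hU hG hl hΦ
  set σ := weightMeasure U c l a b Φ with hσ
  set p := killedSemigroup U c l a b f with hp
  set K : Fin 2 → ℝ≥0∞ := fun i => ENNReal.ofReal (l i) with hK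
  set E : Fin 2 → ℝ → ℝ≥0∞ := fun i t => ENNReal.ofReal (Real.exp (-(l i * t))) with hE
  set g := expKernel l with hg
  set Q : Fin 2 → Fin 2 → ℝ → ℝ → ℝ≥0∞ := fun i j u q =>
    ∫⁻ x, p q (flow U c a b i u x, 1 - i) ∂σ j with hQ
  set F : Fin 2 → Fin 2 → ℝ → ℝ≥0∞ := fun i j v => ∫⁻ x, f (flow U c a b i v x, i) ∂σ j with hF
  have hgm : ∀ i, Measurable (g i) := measurable_expKernel
  have hpm := measurable_killedSemigroup hU hG hl hf
  have hpm3 : ∀ i, Measurable fun y : (ℝ × ℝ) × ℝ =>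
      p y.1.2 (flow U c a b i y.1.1 y.2, 1 - i) := fun i =>
    hpm.comp ((measurable_fst.snd.prodMk ((measurable_flow hU hG i).comp
      (measurable_fst.fst.prodMk measurable_snd))).prodMk measurable_const)
  have hQm : ∀ i j, Measurable fun y : ℝ × ℝ => Q i j y.1 y.2 := fun i j =>
    (hpm3 i).lintegral_prod_right' (ν := σ j)
  -- The renewal equation at time v in state j, integrated against σ_m and with the order of
  -- integration exchanged.
  have hR : ∀ j m v, ∫⁻ x, p v (x, j) ∂σ m = (Ici 0).indicator (fun v => E j v * F j m v) v +
      K j * ∫⁻ u, g j u * Q j m u (v - u) := by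
    intro j m v
    have h1 : ∀ᵐ x ∂σ m, p v (x, j) =
        (Ici 0).indicator (fun v => E j v * f (flow U c a b j v x, j)) v +
          K j * ∫⁻ u, g j u * p (v - u) (flow U c a b j u x, 1 - j) := by
      filter_upwards [ae_mem_weightMeasure m] with x hx
      exact killedSemigroup_renewal hU hG hl hf (Ioo_subset_Icc_self hx) j v
    have hin : Measurable fun y : ℝ × ℝ =>
        g j y.2 * p (v - y.2) (flow U c a b j y.2 y.1, 1 - j) :=
      ((hgm j).comp measurable_snd).mul ((hpm3 j).comp
        ((measurable_snd.prodMk (measurable_const.sub measurable_snd)).prodMk measurable_fst))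
    have hfm : Measurable fun x => f (flow U c a b j v x, j) :=
      hf.comp ((continuous_flow_space hU hG j v).measurable.prodMk measurable_const)
    rw [lintegral_congr_ae h1, lintegral_add_right _ (hin.lintegral_prod_right'.const_mul _),
      lintegral_const_mul _ hin.lintegral_prod_right', lintegral_lintegral_swap hin.aemeasurable]
    congr 1
    · by_cases hv : v ∈ Ici (0 : ℝ)
      · simp only [indicator_of_mem hv]
        exact lintegral_const_mul _ hfm
      · simp only [indicator_of_notMem hv, lintegral_zero]
    · congr 1
      refine lintegral_congr fun u => ?_
      have hfu : Measurable fun x => p (v - u) (flow U c a b j u x, 1 - j) :=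
        (hpm3 j).comp (Measurable.prodMk (f := fun _ : ℝ => (u, v - u)) measurable_const
          measurable_id)
      show ∫⁻ x, g j u * p (v - u) (flow U c a b j u x, 1 - j) ∂σ m =
        g j u * ∫⁻ x, p (v - u) (flow U c a b j u x, 1 - j) ∂σ m
      rw [lintegral_const_mul _ hfu]
  -- x collects the paths from σ_i that have switched by time t; z is the source term of the mild
  -- equation at time t; y is the double integral, with both a source and a later switching, that
  -- has to cancel.
  set x : Fin 2 → ℝ≥0∞ := fun i => ∫⁻ u, g i u * Q i i u (t - u) with hx
  set y : Fin 2 → ℝ≥0∞ := fun i => ∫⁻ r in Ioi 0, ∫⁻ u, g i u *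
    (Iio r).indicator (fun u => Q i (1 - i) u (t - r)) u with hy
  set z : Fin 2 → ℝ≥0∞ := fun i => ∫⁻ u, g (1 - i) u *
    (Iio t).indicator (fun u => F (1 - i) i u) u with hz
  have hT : ∀ i, ∫⁻ w, lsemigroup U c l a b f t (w, i) ∂σ i = E i t * F i i t + K i * x i := by
    intro i
    have h1 := hR i i t
    rw [indicator_of_mem (mem_Ici.2 ht)] at h1
    rw [← h1]
    refine lintegral_congr fun w => ?_
    rw [hp, killedSemigroup, if_pos ht]
  have hD : ∀ i, ∫⁻ w, f (w, i) ∂σ i = E i t * F i i t + K (1 - i) * z (1 - i) := by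
    intro i
    have h1 := lintegral_weightMeasure_eq_kernel hU hG hl hΦ i ht (h := fun w => f (w, i))
      (hf.comp (measurable_id.prodMk measurable_const))
    rw [hz]
    simp only [one_sub_one_sub]
    exact h1
  have hyin : ∀ i, Measurable fun y : ℝ × ℝ => g i y.2 *
      (Iio y.1).indicator (fun u => Q i (1 - i) u (t - y.1)) y.2 := by
    intro i
    refine ((hgm i).comp measurable_snd).mul ?_
    exact Measurable.ite (measurableSet_lt measurable_snd measurable_fst)
      ((hQm i (1 - i)).comp (measurable_snd.prodMk (measurable_const.sub measurable_fst)))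
      measurable_const
  -- First evaluation: for each r the mild equation over a duration r is applied to the function
  -- P_{t-r} f(·, 1-i).
  have hL1 : ∀ i, ∫⁻ r in Ioi 0, ∫⁻ w, p (t - r) (w, 1 - i) ∂σ i = x i + K (1 - i) * y i := by
    intro i
    have h1 : ∀ r ∈ Ioi (0 : ℝ), ∫⁻ w, p (t - r) (w, 1 - i) ∂σ i =
        g i r * Q i i r (t - r) + K (1 - i) * ∫⁻ u, g i u *
          (Iio r).indicator (fun u => Q i (1 - i) u (t - r)) u := by
      intro r hr
      have h2 := lintegral_weightMeasure_eq_kernel hU hG hl hΦ i (le_of_lt hr)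
        (h := fun w => p (t - r) (w, 1 - i))
        (hpm.comp ((measurable_const.prodMk measurable_id).prodMk measurable_const))
      have h3 : g i r = E i r := indicator_of_mem hr _
      rw [h3]
      exact h2
    rw [setLIntegral_congr_fun measurableSet_Ioi h1,
      lintegral_add_right _ ((hyin i).lintegral_prod_right'.const_mul _),
      lintegral_const_mul _ (hyin i).lintegral_prod_right']
    congr 1
    rw [← lintegral_indicator measurableSet_Ioi]
    refine lintegral_congr fun u => ?_
    by_cases hu : u ∈ Ioi (0 : ℝ)
    · rw [indicator_of_mem hu]
    · rw [indicator_of_notMem hu, hg, expKernel, indicator_of_notMem hu, zero_mul]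
  -- Second evaluation of the same integral: with v = t - r, the renewal equation in state 1-i is
  -- integrated against σ_i.
  have hL2 : ∀ i, ∫⁻ r in Ioi 0, ∫⁻ w, p (t - r) (w, 1 - i) ∂σ i =
      z i + K (1 - i) * y (1 - i) := by
    intro i
    have h1 : ∫⁻ r in Ioi 0, ∫⁻ w, p (t - r) (w, 1 - i) ∂σ i =
        ∫⁻ v in Iio t, ∫⁻ w, p v (w, 1 - i) ∂σ i := by
      rw [← lintegral_indicator measurableSet_Ioi, ← lintegral_indicator measurableSet_Iio,
        ← lintegral_sub_left_eq_self _ t]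
      refine lintegral_congr fun r => ?_
      by_cases hr : r < t
      · rw [indicator_of_mem (mem_Ioi.2 (by linarith)), indicator_of_mem (mem_Iio.2 hr),
          sub_sub_cancel]
      · rw [indicator_of_notMem (by simpa using hr), indicator_of_notMem (by simpa using hr)]
    have hin : Measurable fun y : ℝ × ℝ =>
        g (1 - i) y.2 * Q (1 - i) i y.2 (y.1 - y.2) :=
      ((hgm _).comp measurable_snd).mul ((hQm _ _).comp
        (measurable_snd.prodMk (measurable_fst.sub measurable_snd)))
    rw [h1]
    simp only [hR (1 - i) i]
    rw [lintegral_add_right _ (hin.lintegral_prod_right'.const_mul _),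
      lintegral_const_mul _ hin.lintegral_prod_right']
    congr 1
    · rw [← lintegral_indicator measurableSet_Iio]
      -- The free term lives on v ≥ 0 and the kernel on u > 0; they differ only at the null point 0.
      have h0 : ∀ᵐ r : ℝ, r ≠ 0 := by simp [ae_iff]
      refine lintegral_congr_ae ?_
      filter_upwards [h0] with u hu
      by_cases h2 : u < t
      · rw [indicator_of_mem (mem_Iio.2 h2), indicator_of_mem (mem_Iio.2 h2)]
        rcases lt_or_gt_of_ne hu with h3 | h3
        · rw [indicator_of_notMem (by simpa using h3), hg, expKernel,
            indicator_of_notMem (by simpa using h3.le), zero_mul]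
        · rw [indicator_of_mem (mem_Ici.2 h3.le), hg, expKernel, indicator_of_mem (mem_Ioi.2 h3)]
      · rw [indicator_of_notMem (by simpa using h2), indicator_of_notMem (by simpa using h2),
          mul_zero]
    · congr 1
      rw [hy]
      simp only [one_sub_one_sub]
      rw [lintegral_lintegral_swap hin.aemeasurable]
      have hyin' := hyin (1 - i)
      simp only [one_sub_one_sub] at hyin'
      conv_rhs => rw [lintegral_lintegral_swap hyin'.aemeasurable]
      refine lintegral_congr fun u => ?_
      by_cases hu : 0 < u
      · have hq : Measurable fun r => Q (1 - i) i u (r - u) := (hQm _ _).comp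
          (Measurable.prodMk (f := fun _ : ℝ => u) measurable_const
            (measurable_id.sub measurable_const))
        rw [lintegral_const_mul _ hq, lintegral_const_mul]
        · congr 1
          -- The substitution v = t + u - r turns v < t into u < r and v - u into t - r; the
          -- constraint r > 0 is then implied by u > 0.
          rw [← lintegral_indicator measurableSet_Iio, ← lintegral_indicator measurableSet_Ioi,
            ← lintegral_sub_left_eq_self _ (t + u)]
          refine lintegral_congr fun r => ?_
          by_cases hr : u < r
          · rw [indicator_of_mem (mem_Iio.2 (by linarith)),
              indicator_of_mem (mem_Ioi.2 (hu.trans hr)), indicator_of_mem (mem_Iio.2 hr)]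
            congr 1
            ring
          · rw [indicator_of_notMem (by simp only [mem_Iio]; linarith)]
            by_cases hr0 : 0 < r
            · rw [indicator_of_mem (mem_Ioi.2 hr0), indicator_of_notMem (by simpa using hr)]
            · rw [indicator_of_notMem (by simpa using hr0)]
        · exact Measurable.ite (measurableSet_lt measurable_const measurable_id)
            ((hQm _ _).comp (measurable_const.prodMk (measurable_const.sub measurable_id)))
            measurable_const
      · have h3 : g (1 - i) u = 0 := indicator_of_notMem (by simpa using hu) _
        simp [h3]
  have hK0 : ∀ i, K i ≠ 0 := fun i => by simp [hK, hl i]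
  -- Cancellation in [0, ∞] requires finiteness. The common integral is at most t σ_i(ℝ), as f ≤ 1
  -- and the killed semigroup vanishes for r > t, and it dominates a nonzero multiple of y_i.
  have hyfin : ∀ i, y i ≠ ∞ := by
    intro i hinf
    have h1 := hL1 i
    rw [hinf, ENNReal.mul_top (hK0 _), add_top] at h1
    have h2 : ∫⁻ r in Ioi 0, ∫⁻ w, p (t - r) (w, 1 - i) ∂σ i ≤
        ∫⁻ r, (Icc 0 t).indicator (fun _ => σ i univ) r := by
      rw [← lintegral_indicator measurableSet_Ioi]
      refine lintegral_mono fun r => ?_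
      by_cases hr : r ∈ Ioi (0 : ℝ)
      · rw [indicator_of_mem hr]
        by_cases hrt : r ≤ t
        · rw [indicator_of_mem (show r ∈ Icc 0 t from ⟨le_of_lt hr, hrt⟩)]
          calc ∫⁻ w, p (t - r) (w, 1 - i) ∂σ i ≤ ∫⁻ w, 1 ∂σ i := by
                refine lintegral_mono fun w => ?_
                have := isProbabilityMeasure_holdingLaw hl (1 - i)
                rw [hp, killedSemigroup, if_pos (by linarith), lsemigroup]
                calc _ ≤ ∫⁻ s, 1 ∂holdingLaw l (1 - i) := lintegral_mono fun s => hf1 _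
                  _ = 1 := by simp
            _ = σ i univ := by simp
        · have h3 : ∀ w, p (t - r) (w, 1 - i) = 0 := fun w => by
            rw [hp, killedSemigroup, if_neg (by linarith)]
          simp [h3]
      · rw [indicator_of_notMem hr]
        exact zero_le
    rw [h1, lintegral_indicator measurableSet_Icc, setLIntegral_const] at h2
    exact absurd (top_le_iff.1 h2) (ENNReal.mul_ne_top (measure_ne_top _ _) (by simp))
  have hxz : ∀ i, K i * x i + K i * K (1 - i) * y i = K i * z i + K i * K (1 - i) * y (1 - i) := by
    intro i
    have := (hL1 i).symm.trans (hL2 i)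
    rw [mul_assoc, ← mul_add, this, mul_add, mul_assoc]
  have h0 := hxz 0
  have h1 := hxz 1
  have e1 : (1 : Fin 2) - 0 = 1 := rfl
  have e2 : (1 : Fin 2) - 1 = 0 := rfl
  rw [e1] at h0
  rw [e2] at h1
  have hD0 := hD 0
  have hD1 := hD 1
  rw [e1] at hD0
  rw [e2] at hD1
  rw [Fin.sum_univ_two, Fin.sum_univ_two, hT, hT, hD0, hD1]
  -- Weighted by λ_i, the relations for i = 0, 1 contain y_0 and y_1 with the same coefficient λ_0
  -- λ_1 on both sides of their sum.
  have hsum : K 0 * x 0 + K 1 * x 1 = K 0 * z 0 + K 1 * z 1 := by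
    have hne : K 0 * K 1 * y 0 + K 0 * K 1 * y 1 ≠ ∞ :=
      ENNReal.add_ne_top.2 ⟨ENNReal.mul_ne_top (ENNReal.mul_ne_top ENNReal.ofReal_ne_top
        ENNReal.ofReal_ne_top) (hyfin 0), ENNReal.mul_ne_top (ENNReal.mul_ne_top
          ENNReal.ofReal_ne_top ENNReal.ofReal_ne_top) (hyfin 1)⟩
    refine (ENNReal.add_left_inj hne).1 ?_
    calc K 0 * x 0 + K 1 * x 1 + (K 0 * K 1 * y 0 + K 0 * K 1 * y 1)
        = (K 0 * x 0 + K 0 * K 1 * y 0) + (K 1 * x 1 + K 1 * K 0 * y 1) := by ring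
      _ = (K 0 * z 0 + K 0 * K 1 * y 1) + (K 1 * z 1 + K 1 * K 0 * y 0) := by rw [h0, h1]
      _ = K 0 * z 0 + K 1 * z 1 + (K 0 * K 1 * y 0 + K 0 * K 1 * y 1) := by ring
  calc E 0 t * F 0 0 t + K 0 * x 0 + (E 1 t * F 1 1 t + K 1 * x 1)
      = E 0 t * F 0 0 t + E 1 t * F 1 1 t + (K 0 * x 0 + K 1 * x 1) := by ring
    _ = E 0 t * F 0 0 t + E 1 t * F 1 1 t + (K 0 * z 0 + K 1 * z 1) := by rw [hsum]
    _ = E 0 t * F 0 0 t + K 1 * z 1 + (E 1 t * F 1 1 t + K 0 * z 0) := by ring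

/-! ### The generator -/

theorem measurable_lsemigroup_fixed (hU : ContDiff ℝ 2 U) (hG : IsAttractor U c a b)
    (hl : ∀ i, 0 < l i) {f : ℝ × Fin 2 → ℝ≥0∞} (hf : Measurable f) (t : ℝ) :
    Measurable (lsemigroup U c l a b f t) := by
  refine measurable_from_prod_countable_left fun i => ?_
  have := (measurable_lsemigroup hU hG hl hf).comp
    ((measurable_const (a := t)).prodMk measurable_id |>.prodMk (measurable_const (a := i)))
  simpa only [Function.comp_def, id_eq] using this

theorem measurable_map_regularPath (hU : ContDiff ℝ 2 U) (hG : IsAttractor U c a b)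
    (hl : ∀ i, 0 < l i) (t : ℝ) :
    Measurable fun z : ℝ × Fin 2 =>
      (holdingLaw l z.2).map fun s => regularPath U c a b z s t := by
  refine Measure.measurable_of_measurable_coe _ fun A hA => ?_
  have h1 : (fun z : ℝ × Fin 2 =>
      (holdingLaw l z.2).map (fun s => regularPath U c a b z s t) A) =
        lsemigroup U c l a b (A.indicator 1) t := by
    funext z
    rw [lsemigroup, ← lintegral_indicator_one hA,
      lintegral_map (measurable_one.indicator hA) (measurable_regularPath_fixed hU hG z t)]
  rw [h1]
  exact measurable_lsemigroup_fixed hU hG hl (measurable_one.indicator hA) t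

/-- The transition kernel of the process on the attractor. -/
def transitionKernel (hU : ContDiff ℝ 2 U) (hG : IsAttractor U c a b) (hl : ∀ i, 0 < l i) (t : ℝ) :
    Kernel (ℝ × Fin 2) (ℝ × Fin 2) :=
  ⟨_, measurable_map_regularPath hU hG hl t⟩

theorem transitionKernel_apply (hU : ContDiff ℝ 2 U) (hG : IsAttractor U c a b)
    (hl : ∀ i, 0 < l i) (t : ℝ) (z : ℝ × Fin 2) :
    transitionKernel hU hG hl t z = (holdingLaw l z.2).map fun s => regularPath U c a b z s t := rfl

theorem isMarkovKernel_transitionKernel (hU : ContDiff ℝ 2 U) (hG : IsAttractor U c a b)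
    (hl : ∀ i, 0 < l i) (t : ℝ) : IsMarkovKernel (transitionKernel hU hG hl t) :=
  ⟨fun z => by
    have := isProbabilityMeasure_holdingLaw hl z.2
    rw [transitionKernel_apply]
    exact Measure.isProbabilityMeasure_map (measurable_regularPath_fixed hU hG z t).aemeasurable⟩

theorem integral_transitionKernel (hU : ContDiff ℝ 2 U) (hG : IsAttractor U c a b)
    (hl : ∀ i, 0 < l i) {f : ℝ × Fin 2 → ℝ} (hf : Measurable f) (t : ℝ) (z : ℝ × Fin 2) :
    ∫ y, f y ∂transitionKernel hU hG hl t z = semigroup U c l a b f t z := by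
  rw [transitionKernel_apply, integral_map (measurable_regularPath_fixed hU hG z t).aemeasurable
    hf.aestronglyMeasurable, semigroup]

/-- Invariance is given set by set; as an identity between a measure and its composition with a
kernel it passes to integrals of bounded functions. Only starting points in [a, b] matter, as ν is
carried there. -/
theorem bind_transitionKernel (hU : ContDiff ℝ 2 U) (hG : IsAttractor U c a b)
    (hl : ∀ i, 0 < l i) {ν : Measure (ℝ × Fin 2)} (hν : ∀ᵐ z ∂ν, z.1 ∈ Icc a b)
    (hinv : IsInvariantMeasure U c l ν) {t : ℝ} (ht : 0 ≤ t) :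
    ν.bind (transitionKernel hU hG hl t) = ν := by
  ext A hA
  rw [Measure.bind_apply hA (Kernel.aemeasurable _), ← hinv t ht A hA]
  refine lintegral_congr_ae ?_
  filter_upwards [hν] with z hz
  rw [transitionProb_eq hl hz ht, transitionKernel_apply,
    Measure.map_apply (measurable_regularPath_fixed hU hG z t) hA]
  rfl

theorem integrable_and_integral_semigroup (hU : ContDiff ℝ 2 U) (hG : IsAttractor U c a b)
    (hl : ∀ i, 0 < l i) {ν : Measure (ℝ × Fin 2)} [IsFiniteMeasure ν]
    (hν : ∀ᵐ z ∂ν, z.1 ∈ Icc a b) (hinv : IsInvariantMeasure U c l ν) {f : ℝ × Fin 2 → ℝ}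
    (hf : Measurable f) {B : ℝ} (hB : ∀ z, |f z| ≤ B) {t : ℝ} (ht : 0 ≤ t) :
    Integrable (fun z => semigroup U c l a b f t z) ν ∧
      ∫ z, semigroup U c l a b f t z ∂ν = ∫ z, f z ∂ν := by
  have := isMarkovKernel_transitionKernel hU hG hl t
  have h1 : ((transitionKernel hU hG hl t) ∘ₖ (Kernel.const Unit ν)) () = ν := by
    rw [← Measure.comp_eq_comp_const_apply]
    exact bind_transitionKernel hU hG hl hν hinv ht
  have h2 : Integrable f (((transitionKernel hU hG hl t) ∘ₖ (Kernel.const Unit ν)) ()) := by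
    rw [h1]
    exact (integrable_const B).mono' hf.aestronglyMeasurable (Eventually.of_forall hB)
  have h3 := h2.integral_comp
  have h4 := Kernel.integral_comp h2
  rw [h1] at h4
  simp only [integral_transitionKernel hU hG hl hf, Kernel.const_apply] at h3 h4
  exact ⟨h3, h4.symm⟩

theorem measureReal_expMeasure_Iic {k : ℝ} (hk : 0 < k) {t : ℝ} (ht : 0 ≤ t) :
    (expMeasure k).real (Iic t) = 1 - Real.exp (-(k * t)) := by
  have : Real.exp (-(k * t)) ≤ 1 := Real.exp_le_one_iff.2 (by nlinarith)
  rw [measureReal_def, expMeasure_Iic hk, if_pos ht, ENNReal.toReal_ofReal (by linarith)]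

theorem measurable_semigroup_flow (hU : ContDiff ℝ 2 U) (hG : IsAttractor U c a b)
    (hl : ∀ i, 0 < l i) {f : ℝ × Fin 2 → ℝ} (hf : Measurable f) (i j : Fin 2) (t x : ℝ) :
    Measurable fun r => semigroup U c l a b f (t - r) (flow U c a b i r x, j) := by
  have := isProbabilityMeasure_holdingLaw hl j
  have h : Measurable fun q : ℝ × (ℕ → ℝ) =>
      f (regularPath U c a b (flow U c a b i q.1 x, j) q.2 (t - q.1)) :=
    hf.comp ((measurable_regularPath hU hG).comp
      ((((continuous_flow_time hU hG i x).measurable.comp measurable_fst).prodMk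
        measurable_const).prodMk (measurable_snd.prodMk (measurable_const.sub measurable_fst))))
  exact (h.stronglyMeasurable.integral_prod_right' (ν := holdingLaw l j)).measurable

/-- Two-step expansion of the transition function for small times. -/
theorem abs_semigroup_expansion_le (hU : ContDiff ℝ 2 U) (hG : IsAttractor U c a b)
    (hl : ∀ i, 0 < l i) {f : ℝ × Fin 2 → ℝ} (hf : Measurable f) {B D : ℝ} (hB : ∀ z, |f z| ≤ B)
    (hD : ∀ i, ∀ x ∈ Icc a b, ∀ y ∈ Icc a b, |f (x, i) - f (y, i)| ≤ D * |x - y|) (hD0 : 0 ≤ D) :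
    ∃ C, ∀ x ∈ Icc a b, ∀ i, ∀ t, 0 ≤ t →
      |semigroup U c l a b f t (x, i) - f (x, i) -
        Real.exp (-(l i * t)) * (f (flow U c a b i t x, i) - f (x, i)) -
        (1 - Real.exp (-(l i * t))) * (f (x, 1 - i) - f (x, i))| ≤ C * t ^ 2 := by
  have hp' := fun i => isProbabilityMeasure_expMeasure (hl i)
  have hB0 : 0 ≤ B := (abs_nonneg _).trans (hB (0, 0))
  set V := c 0 - c 1 with hV
  have hV0 : 0 ≤ V := by
    have := hG.c_mem 0
    simp only [hV]
    linarith [this.1]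
  set Λ := l 0 + l 1 with hΛ
  have hlΛ : ∀ i, l i ≤ Λ := fun i => by
    fin_cases i
    · exact le_add_of_nonneg_right (hl 1).le
    · exact le_add_of_nonneg_left (hl 0).le
  have hflow : ∀ i, ∀ x ∈ Icc a b, ∀ t, 0 ≤ t → ∀ j,
      |f (flow U c a b i t x, j) - f (x, j)| ≤ D * V * t := fun i x hx t ht j =>
    calc |f (flow U c a b i t x, j) - f (x, j)| ≤ D * |flow U c a b i t x - x| :=
          hD j _ (flow_mem hU hG i t x) _ hx
      _ ≤ D * (V * t) := mul_le_mul_of_nonneg_left (abs_flow_sub_le hU hG i hx ht) hD0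
      _ = D * V * t := by ring
  have hexp : ∀ i t, 0 ≤ t → (expMeasure (l i)).real (Iic t) ≤ Λ * t := by
    intro i t ht
    rw [measureReal_expMeasure_Iic (hl i) ht]
    have h1 := Real.add_one_le_exp (-(l i * t))
    have h2 := mul_le_mul_of_nonneg_right (hlΛ i) ht
    linarith
  have hSB : ∀ t z, |semigroup U c l a b f t z| ≤ B := by
    intro t z
    have := isProbabilityMeasure_holdingLaw hl z.2
    have h := norm_integral_le_of_norm_le_const (μ := holdingLaw l z.2)
      (f := fun s => f (regularPath U c a b z s t)) (C := B)
      (Eventually.of_forall fun s => hB (regularPath U c a b z s t))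
    simpa [semigroup] using h
  have hmeas : ∀ i x t, Measurable fun r => if t < r then f (flow U c a b i t x, i) else
      semigroup U c l a b f (t - r) (flow U c a b i r x, 1 - i) := fun i x t =>
    Measurable.ite measurableSet_Ioi measurable_const
      (measurable_semigroup_flow hU hG hl hf i (1 - i) t x)
  have hint : ∀ i x t, Integrable (fun r => if t < r then f (flow U c a b i t x, i) else
      semigroup U c l a b f (t - r) (flow U c a b i r x, 1 - i)) (expMeasure (l i)) :=
    fun i x t => (integrable_const B).mono' (hmeas i x t).aestronglyMeasurable
      (Eventually.of_forall fun r => by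
        split_ifs
        · exact hB _
        · exact hSB _ _)
  have hind : ∀ i (A t : ℝ), Integrable ((Iic t).indicator fun _ => A) (expMeasure (l i)) :=
    fun i A t => (integrable_const A).indicator measurableSet_Iic
  have hindI : ∀ i (A t : ℝ), ∫ r, (Iic t).indicator (fun _ => A) r ∂expMeasure (l i) =
      (expMeasure (l i)).real (Iic t) * A := fun i A t => by
    rw [integral_indicator measurableSet_Iic, setIntegral_const, smul_eq_mul]
  -- D V t bounds the change of f along the flow before a switching; a switching by time t has
  -- probability at most Λ t and changes the value by at most 2B.
  set C₁ := D * V + 2 * B * Λ with hC₁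
  have hfirst : ∀ x ∈ Icc a b, ∀ i, ∀ t, 0 ≤ t →
      |semigroup U c l a b f t (x, i) - f (x, i)| ≤ C₁ * t := by
    intro x hx i t ht
    have h1 : semigroup U c l a b f t (x, i) - f (x, i) =
        ∫ r, ((if t < r then f (flow U c a b i t x, i) else
          semigroup U c l a b f (t - r) (flow U c a b i r x, 1 - i)) - f (x, i))
            ∂expMeasure (l i) := by
      rw [integral_sub (hint i x t) (integrable_const _), ← semigroup_renewal hU hG hl hf hB hx i ht]
      simp
    rw [h1, ← Real.norm_eq_abs]
    have h0 : Integrable (fun r => D * V * t + (Iic t).indicator (fun _ => 2 * B) r)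
        (expMeasure (l i)) := (integrable_const _).add (hind i _ t)
    calc _ ≤ ∫ r, (D * V * t + (Iic t).indicator (fun _ => 2 * B) r) ∂expMeasure (l i) := by
          refine norm_integral_le_of_norm_le h0 (Eventually.of_forall fun r => ?_)
          rw [Real.norm_eq_abs]
          by_cases h : t < r
          · rw [if_pos h, indicator_of_notMem (by simpa using h), add_zero]
            exact hflow i x hx t ht i
          · rw [if_neg h, indicator_of_mem (by simpa using h)]
            have h2 := hSB (t - r) (flow U c a b i r x, 1 - i)
            have h3 := hB (x, i)
            have h4 : 0 ≤ D * V * t := by positivity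
            rw [abs_le] at h2 h3 ⊢
            constructor <;> linarith [h2.1, h2.2, h3.1, h3.2]
      _ = D * V * t + (expMeasure (l i)).real (Iic t) * (2 * B) := by
          rw [integral_add (integrable_const _) (hind i _ t), hindI]
          simp
      _ ≤ D * V * t + (Λ * t) * (2 * B) := by
          gcongr
          exact hexp i t ht
      _ = C₁ * t := by rw [hC₁]; ring
  have hΛ0 : 0 ≤ Λ := add_nonneg (hl 0).le (hl 1).le
  have hC₁0 : 0 ≤ C₁ := by positivity
  -- The integrands coincide when r > t. When r ≤ t, an event of probability at most Λ t, they
  -- differ by at most C₁ (t - r) + D V r ≤ (C₁ + D V) t.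
  refine ⟨(C₁ + D * V) * Λ, fun x hx i t ht => ?_⟩
  have hsplit : ∀ r : ℝ, (if t < r then f (flow U c a b i t x, i) - f (x, i) else
      f (x, 1 - i) - f (x, i)) = (f (flow U c a b i t x, i) - f (x, i)) +
        (Iic t).indicator (fun _ => (f (x, 1 - i) - f (x, i)) -
          (f (flow U c a b i t x, i) - f (x, i))) r := by
    intro r
    by_cases h : t < r
    · rw [if_pos h, indicator_of_notMem (by simpa using h), add_zero]
    · rw [if_neg h, indicator_of_mem (by simpa using h)]
      ring
  have hsint : Integrable (fun r : ℝ => (if t < r then f (flow U c a b i t x, i) - f (x, i) else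
      f (x, 1 - i) - f (x, i))) (expMeasure (l i)) := by
    simp only [hsplit]
    exact (integrable_const _).add (hind i _ t)
  have h1 : semigroup U c l a b f t (x, i) - f (x, i) -
        Real.exp (-(l i * t)) * (f (flow U c a b i t x, i) - f (x, i)) -
        (1 - Real.exp (-(l i * t))) * (f (x, 1 - i) - f (x, i)) =
      ∫ r, (((if t < r then f (flow U c a b i t x, i) else
          semigroup U c l a b f (t - r) (flow U c a b i r x, 1 - i)) - f (x, i)) -
        (if t < r then f (flow U c a b i t x, i) - f (x, i) else f (x, 1 - i) - f (x, i)))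
            ∂expMeasure (l i) := by
    have hint' : Integrable (fun r => (if t < r then f (flow U c a b i t x, i) else
        semigroup U c l a b f (t - r) (flow U c a b i r x, 1 - i)) - f (x, i))
          (expMeasure (l i)) := (hint i x t).sub (integrable_const _)
    rw [integral_sub hint' hsint,
      integral_sub (hint i x t) (integrable_const _),
      ← semigroup_renewal hU hG hl hf hB hx i ht]
    simp only [hsplit]
    rw [integral_add (integrable_const _) (hind i _ t), hindI,
      measureReal_expMeasure_Iic (hl i) ht]
    simp
    ring
  rw [h1, ← Real.norm_eq_abs]
  calc _ ≤ ∫ r, (Iic t).indicator (fun _ => (C₁ + D * V) * t) r ∂expMeasure (l i) := by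
        refine norm_integral_le_of_norm_le (hind i _ t) ?_
        filter_upwards [ae_pos_expMeasure (hl i)] with r hr
        rw [Real.norm_eq_abs]
        by_cases h : t < r
        · rw [if_pos h, if_pos h, indicator_of_notMem (by simpa using h), sub_self, abs_zero]
        · rw [if_neg h, if_neg h, indicator_of_mem (by simpa using h)]
          have hrt : r ≤ t := not_lt.1 h
          have h2 := hfirst _ (flow_mem hU hG i r x) (1 - i) (t - r) (sub_nonneg.2 hrt)
          have h3 := hflow i x hx r hr.le (1 - i)
          have h4 : C₁ * (t - r) ≤ C₁ * t := mul_le_mul_of_nonneg_left (by linarith) hC₁0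
          have h5 : D * V * r ≤ D * V * t := mul_le_mul_of_nonneg_left hrt (by positivity)
          rw [abs_le] at h2 h3 ⊢
          constructor <;> linarith [h2.1, h2.2, h3.1, h3.2]
    _ = (expMeasure (l i)).real (Iic t) * ((C₁ + D * V) * t) := hindI i _ t
    _ ≤ (Λ * t) * ((C₁ + D * V) * t) := by
        refine mul_le_mul_of_nonneg_right (hexp i t ht) (by positivity)
    _ = (C₁ + D * V) * Λ * t ^ 2 := by ring

/-- The stationary Kolmogorov equation in weak form. -/
theorem integral_generator_eq_zero (hU : ContDiff ℝ 2 U) (hG : IsAttractor U c a b)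
    (hl : ∀ i, 0 < l i) {ν : Measure (ℝ × Fin 2)} [IsFiniteMeasure ν]
    (hν : ∀ᵐ z ∂ν, z.1 ∈ Icc a b) (hinv : IsInvariantMeasure U c l ν) {F F' : Fin 2 → ℝ → ℝ}
    (hF : ∀ i x, HasDerivAt (F i) (F' i x) x) (hF' : ∀ i, Continuous (F' i)) :
    ∫ z, (F' z.2 z.1 * (c z.2 - deriv U z.1) + l z.2 * (F (1 - z.2) z.1 - F z.2 z.1)) ∂ν = 0 := by
  have hFc : ∀ i, Continuous (F i) := fun i =>
    continuous_iff_continuousAt.2 fun x => (hF i x).continuousAt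
  -- F may be unbounded on the line; clamping makes it bounded without changing it on [a, b], where
  -- the process lives.
  set f : ℝ × Fin 2 → ℝ := fun z => F z.2 (clamp a b z.1) with hf
  have hfm : Measurable f := measurable_from_prod_countable_left fun i =>
    ((hFc i).comp continuous_clamp).measurable
  have hfF : ∀ x ∈ Icc a b, ∀ i, f (x, i) = F i x := fun x hx i => by
    simp only [hf, clamp_of_mem hx]
  obtain ⟨B, hB⟩ : ∃ B, ∀ z, |f z| ≤ B := by
    have h := fun i => (isCompact_Icc (a := a) (b := b)).exists_bound_of_continuousOn
      (hFc i).continuousOn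
    choose B hB using h
    refine ⟨max (B 0) (B 1), fun z => ?_⟩
    obtain ⟨x, i⟩ := z
    have h1 := hB i _ (clamp_mem hG.lt.le x)
    refine h1.trans ?_
    fin_cases i
    · exact le_max_left _ _
    · exact le_max_right _ _
  obtain ⟨D, hD0, hD⟩ : ∃ D, 0 ≤ D ∧ ∀ i, ∀ x ∈ Icc a b, |F' i x| ≤ D := by
    have h := fun i => (isCompact_Icc (a := a) (b := b)).exists_bound_of_continuousOn
      (hF' i).continuousOn
    choose D hD using h
    refine ⟨max (D 0) (D 1), ?_, fun i x hx => (hD i x hx).trans ?_⟩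
    · exact (norm_nonneg _).trans ((hD 0 a (left_mem_Icc.2 hG.lt.le)).trans (le_max_left _ _))
    · fin_cases i
      · exact le_max_left _ _
      · exact le_max_right _ _
  have hlip : ∀ i, ∀ x ∈ Icc a b, ∀ y ∈ Icc a b, |F i x - F i y| ≤ D * |x - y| :=
    fun i x hx y hy => Convex.norm_image_sub_le_of_norm_hasDerivWithin_le
      (fun u _ => (hF i u).hasDerivWithinAt) (fun u hu => hD i u hu) (convex_Icc a b) hy hx
  obtain ⟨C, hC⟩ := abs_semigroup_expansion_le hU hG hl hfm hB (D := D)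
    (fun i x hx y hy => by rw [hfF x hx, hfF y hy]; exact hlip i x hx y hy) hD0
  set τ : ℕ → ℝ := fun n => 1 / ((n : ℝ) + 1) with hτ
  have hτ0 : ∀ n, 0 < τ n := fun n => by positivity
  have hτlim : Tendsto τ atTop (𝓝 0) := tendsto_one_div_add_atTop_nhds_zero_nat
  have hτlim' : Tendsto τ atTop (𝓝[>] 0) :=
    tendsto_nhdsWithin_iff.2 ⟨hτlim, Eventually.of_forall hτ0⟩
  -- J is the explicit part of the expansion P_t f - f = J_t + O(t²). Its right derivative at t = 0
  -- is the generator applied to F.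
  set J : ℝ → ℝ × Fin 2 → ℝ := fun t z =>
    Real.exp (-(l z.2 * t)) * (f (flow U c a b z.2 t z.1, z.2) - f z) +
      (1 - Real.exp (-(l z.2 * t))) * (f (z.1, 1 - z.2) - f z) with hJ
  have hJm : ∀ t, Measurable (J t) := by
    intro t
    refine measurable_from_prod_countable_left fun i => ?_
    have h1 : ∀ j : Fin 2, Measurable fun x : ℝ => f (x, j) := fun j =>
      hfm.comp (measurable_id.prodMk measurable_const)
    have h2 : Measurable fun x => f (flow U c a b i t x, i) :=
      (h1 i).comp (continuous_flow_space hU hG i t).measurable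
    show Measurable fun x => Real.exp (-(l i * t)) * (f (flow U c a b i t x, i) - f (x, i)) +
      (1 - Real.exp (-(l i * t))) * (f (x, 1 - i) - f (x, i))
    exact (((h2.sub (h1 i)).const_mul _).add (((h1 (1 - i)).sub (h1 i)).const_mul _))
  set V := c 0 - c 1 with hV
  set Λ := l 0 + l 1 with hΛ
  have hlΛ : ∀ i, l i ≤ Λ := fun i => by
    fin_cases i
    · exact le_add_of_nonneg_right (hl 1).le
    · exact le_add_of_nonneg_left (hl 0).le
  have hJb : ∀ᵐ z ∂ν, ∀ t, 0 ≤ t → |J t z| ≤ (D * V + Λ * (2 * B)) * t := by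
    filter_upwards [hν] with z hz t ht
    have h1 : Real.exp (-(l z.2 * t)) ≤ 1 :=
      Real.exp_le_one_iff.2 (by nlinarith [hl z.2])
    have h2 := Real.add_one_le_exp (-(l z.2 * t))
    have h3 := Real.exp_pos (-(l z.2 * t))
    have h4 : |f (flow U c a b z.2 t z.1, z.2) - f z| ≤ D * V * t := by
      have hfz : f z = F z.2 z.1 := hfF z.1 hz z.2
      rw [hfF _ (flow_mem hU hG _ _ _), hfz]
      calc _ ≤ D * |flow U c a b z.2 t z.1 - z.1| := hlip _ _ (flow_mem hU hG _ _ _) _ hz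
        _ ≤ D * (V * t) := mul_le_mul_of_nonneg_left (abs_flow_sub_le hU hG _ hz ht) hD0
        _ = D * V * t := by ring
    have h5 : |f (z.1, 1 - z.2) - f z| ≤ 2 * B := by
      have := hB (z.1, 1 - z.2)
      have h6 := hB z
      rw [abs_le] at this h6 ⊢
      constructor <;> linarith [this.1, this.2, h6.1, h6.2]
    have h6 : 1 - Real.exp (-(l z.2 * t)) ≤ Λ * t := by
      have := mul_le_mul_of_nonneg_right (hlΛ z.2) ht
      linarith
    calc |J t z| ≤ |Real.exp (-(l z.2 * t)) * (f (flow U c a b z.2 t z.1, z.2) - f z)| +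
          |(1 - Real.exp (-(l z.2 * t))) * (f (z.1, 1 - z.2) - f z)| := abs_add_le _ _
      _ ≤ 1 * (D * V * t) + (Λ * t) * (2 * B) := by
          rw [abs_mul, abs_mul, abs_of_pos h3, abs_of_nonneg (sub_nonneg.2 h1)]
          have h7 : 0 ≤ Λ * t := mul_nonneg (add_nonneg (hl 0).le (hl 1).le) ht
          gcongr
      _ = (D * V + Λ * (2 * B)) * t := by ring
  have hlim1 : Tendsto (fun n => ∫ z, (τ n)⁻¹ * J (τ n) z ∂ν) atTop
      (𝓝 (∫ z, (F' z.2 z.1 * (c z.2 - deriv U z.1) +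
        l z.2 * (F (1 - z.2) z.1 - F z.2 z.1)) ∂ν)) := by
    refine tendsto_integral_of_dominated_convergence (fun _ => D * V + Λ * (2 * B))
      (fun n => ((hJm _).const_mul _).aestronglyMeasurable) (integrable_const _) (fun n => ?_) ?_
    · filter_upwards [hJb] with z hz
      rw [norm_mul, norm_inv, Real.norm_of_nonneg (hτ0 n).le, inv_mul_le_iff₀ (hτ0 n), mul_comm]
      exact hz _ (hτ0 n).le
    · filter_upwards [hν] with z hz
      obtain ⟨x, i⟩ := z
      have hz' : x ∈ Icc a b := hz
      have hd1 : HasDerivWithinAt (fun t => F i (flow U c a b i t x))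
          (F' i (flow U c a b i 0 x) * (c i - deriv U (flow U c a b i 0 x))) (Ici 0) 0 :=
        (hF i _).comp_hasDerivWithinAt 0 (hasDerivWithinAt_flow hU hG i hz' le_rfl)
      have hd2 : HasDerivWithinAt (fun t => Real.exp (-(l i * t)))
          (Real.exp (-(l i * 0)) * -(l i * 1)) (Ici 0) 0 :=
        ((((hasDerivAt_id (0 : ℝ)).const_mul (l i)).neg).exp).hasDerivWithinAt
      have hd : HasDerivWithinAt (fun t => J t (x, i)) (F' i x * (c i - deriv U x) +
          l i * (F (1 - i) x - F i x)) (Ici 0) 0 := by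
        have h := (hd2.mul (hd1.sub_const (F i x))).add
          ((hd2.const_sub 1).mul_const (F (1 - i) x - F i x))
        rw [flow_zero hU hG i hz'] at h
        refine (h.congr (fun t _ => ?_) ?_).congr_deriv ?_
        · simp only [hJ, hfF _ (flow_mem hU hG _ _ _), hfF x hz']
          rfl
        · simp only [hJ, hfF _ (flow_mem hU hG _ _ _), hfF x hz']
          rfl
        · simp
      have hs := (hasDerivWithinAt_iff_tendsto_slope' (s := Ioi (0 : ℝ)) (by simp)).1
        (hd.mono Ioi_subset_Ici_self)
      refine (hs.comp hτlim').congr fun n => ?_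
      have hJ0 : J 0 (x, i) = 0 := by
        simp only [hJ, flow_zero hU hG i hz']
        simp
      simp [slope_def_field, hJ0, div_eq_inv_mul]
  -- By invariance P_τ f - f has integral zero, so the integral of J_τ / τ consists of the expansion
  -- error alone, which is O(τ).
  have hlim2 : Tendsto (fun n => ∫ z, (τ n)⁻¹ * J (τ n) z ∂ν) atTop (𝓝 0) := by
    have hbound : ∀ n, ‖∫ z, (τ n)⁻¹ * J (τ n) z ∂ν‖ ≤ C * τ n * ν.real univ := by
      intro n
      obtain ⟨hi, he⟩ := integrable_and_integral_semigroup hU hG hl hν hinv hfm hB (hτ0 n).le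
      have hfi : Integrable f ν :=
        (integrable_const B).mono' hfm.aestronglyMeasurable (Eventually.of_forall hB)
      have h0 : ∫ z, (τ n)⁻¹ * (semigroup U c l a b f (τ n) z - f z) ∂ν = 0 := by
        rw [integral_const_mul, integral_sub hi hfi, he, sub_self, mul_zero]
      have hJi : Integrable (fun z => (τ n)⁻¹ * J (τ n) z) ν := by
        refine Integrable.const_mul ?_ _
        refine (integrable_const ((D * V + Λ * (2 * B)) * τ n)).mono' (hJm _).aestronglyMeasurable ?_
        filter_upwards [hJb] with z hz using hz _ (hτ0 n).le
      have h1 : ∫ z, (τ n)⁻¹ * J (τ n) z ∂ν =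
          ∫ z, ((τ n)⁻¹ * J (τ n) z - (τ n)⁻¹ * (semigroup U c l a b f (τ n) z - f z)) ∂ν := by
        have hsi : Integrable (fun z => (τ n)⁻¹ * (semigroup U c l a b f (τ n) z - f z)) ν :=
          (hi.sub hfi).const_mul _
        rw [integral_sub hJi hsi, h0, sub_zero]
      rw [h1]
      refine norm_integral_le_of_norm_le_const ?_
      filter_upwards [hν] with z hz
      obtain ⟨x, i⟩ := z
      have h2 := hC x hz i (τ n) (hτ0 n).le
      rw [← mul_sub, norm_mul, norm_inv, Real.norm_of_nonneg (hτ0 n).le,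
        inv_mul_le_iff₀ (hτ0 n), Real.norm_eq_abs, ← abs_neg]
      refine (le_of_eq ?_).trans (h2.trans (le_of_eq ?_))
      · congr 1
        simp only [hJ]
        ring
      · ring
    refine squeeze_zero_norm hbound ?_
    have : Tendsto (fun n => C * τ n * ν.real univ) atTop (𝓝 (C * 0 * ν.real univ)) :=
      (hτlim.const_mul C).mul_const _
    simpa using this
  exact tendsto_nhds_unique hlim1 hlim2

/-! ### Uniqueness of the stationary distribution -/

/-- The weak form of the stationary Kolmogorov equations for a pair of measures. -/
def IsStationaryPair (U : ℝ → ℝ) (c l : Fin 2 → ℝ) (m : Fin 2 → Measure ℝ) : Prop :=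
  ∀ F F' : Fin 2 → ℝ → ℝ, (∀ i x, HasDerivAt (F i) (F' i x) x) → (∀ i, Continuous (F' i)) →
    ∑ i, ∫ x, (F' i x * (c i - deriv U x) + l i * (F (1 - i) x - F i x)) ∂m i = 0

theorem integrable_of_ae_mem_Icc {m : Measure ℝ} [IsFiniteMeasure m]
    (hm : ∀ᵐ x ∂m, x ∈ Icc a b) {f : ℝ → ℝ} (hf : Continuous f) : Integrable f m := by
  obtain ⟨B, hB⟩ := (isCompact_Icc (a := a) (b := b)).exists_bound_of_continuousOn hf.continuousOn
  exact (integrable_const B).mono' hf.aestronglyMeasurable (hm.mono fun x hx => hB x hx)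

/-- For the same test function in both states the switching terms cancel, and its derivative g is an
arbitrary continuous function: the total flux vanishes as a measure. -/
theorem IsStationaryPair.sum_integral_mul_velocity {m : Fin 2 → Measure ℝ}
    (hm : IsStationaryPair U c l m) {g : ℝ → ℝ} (hg : Continuous g) :
    ∑ i, ∫ x, g x * (c i - deriv U x) ∂m i = 0 := by
  have h := hm (fun _ x => ∫ y in (0 : ℝ)..x, g y) (fun _ => g)
    (fun _ x => (hg.integral_hasStrictDerivAt 0 x).hasDerivAt) (fun _ => hg)
  simpa using h

/-- The test pair is (f, 0), which isolates the transport of the component in state 0. -/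
theorem IsStationaryPair.integral_deriv_mul_velocity (hU : ContDiff ℝ 2 U)
    {m : Fin 2 → Measure ℝ} [∀ i, IsFiniteMeasure (m i)] (hm : IsStationaryPair U c l m)
    (hab : ∀ i, ∀ᵐ x ∂m i, x ∈ Icc a b) {f f' : ℝ → ℝ} (hf : ∀ x, HasDerivAt f (f' x) x)
    (hf' : Continuous f') :
    ∫ x, f' x * (c 0 - deriv U x) ∂m 0 = l 0 * ∫ x, f x ∂m 0 - l 1 * ∫ x, f x ∂m 1 := by
  have hfc : Continuous f := continuous_iff_continuousAt.2 fun x => (hf x).continuousAt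
  have h := hm (fun i => if i = 0 then f else fun _ => 0) (fun i => if i = 0 then f' else fun _ => 0)
    (fun i x => by
      by_cases hi : i = 0
      · simpa [hi] using hf x
      · simpa [hi] using hasDerivAt_const x (0 : ℝ))
    (fun i => by
      by_cases hi : i = 0
      · simpa [hi] using hf'
      · simpa [hi] using continuous_const)
  have h1 : Integrable (fun x => f' x * (c 0 - deriv U x)) (m 0) :=
    integrable_of_ae_mem_Icc (hab 0)
      (hf'.mul (continuous_const.sub (continuous_deriv_of_contDiff hU)))
  have h2 : Integrable (fun x => l 0 * f x) (m 0) :=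
    integrable_of_ae_mem_Icc (hab 0) (continuous_const.mul hfc)
  simp only [Fin.sum_univ_two, Fin.isValue, if_true, sub_zero, one_ne_zero, if_false, zero_mul,
    zero_add, sub_self, zero_sub, mul_neg] at h
  simp only [← sub_eq_add_neg] at h
  rw [integral_sub h1 h2, integral_const_mul, integral_const_mul] at h
  linarith

/-! ### Identification of stationary pairs on the open interval -/

theorem continuous_mul_of_eq_zero {p q : ℝ} (hp : a < p) (hq : q < b) {k h : ℝ → ℝ}
    (hk : Continuous k) (hk0 : ∀ x, x ∉ Icc p q → k x = 0) (hh : ContinuousOn h (Ioo a b)) :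
    Continuous fun x => k x * h x := by
  refine continuous_iff_continuousAt.2 fun x => ?_
  by_cases hx : x ∈ Ioo a b
  · exact hk.continuousAt.mul (hh.continuousAt (Ioo_mem_nhds hx.1 hx.2))
  · have hx' : x ∈ (Icc p q)ᶜ := fun h => hx ⟨hp.trans_le h.1, h.2.trans_lt hq⟩
    refine (continuousAt_const (y := (0 : ℝ))).congr ?_
    filter_upwards [isClosed_Icc.isOpen_compl.mem_nhds hx'] with y hy
    rw [hk0 y hy, zero_mul]

theorem hasDerivAt_Psi (hΦ : IsRectifying U c a b Φ) {x : ℝ} (hx : x ∈ Ioo a b) :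
    HasDerivAt (Psi l Φ)
      (Psi l Φ x * (l 0 / (c 0 - deriv U x) + l 1 / (c 1 - deriv U x))) x := by
  have h := (((hΦ 0 x hx).const_mul (l 0)).add ((hΦ 1 x hx).const_mul (l 1))).exp
  refine h.congr_deriv ?_
  simp only [Psi, Pi.add_apply]
  ring

theorem continuousOn_Psi (hΦ : IsRectifying U c a b Φ) : ContinuousOn (Psi l Φ) (Ioo a b) :=
  fun _ hx => (hasDerivAt_Psi hΦ hx).continuousAt.continuousWithinAt

theorem continuousOn_inv_velocity (hU : ContDiff ℝ 2 U) (hG : IsAttractor U c a b) (i : Fin 2) :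
    ContinuousOn (fun x => (c i - deriv U x)⁻¹) (Ioo a b) :=
  (continuous_const.sub (continuous_deriv_of_contDiff hU)).continuousOn.inv₀
    fun _ hx => hG.velocity_ne_zero i hx

/-- The primitive F of k is supported in [p, q] because k has integral zero, so f = F Ψ is an
admissible test function. In f' v_0 the derivative of Ψ contributes λ_0 f + λ_1 f v_0 / v_1. The
stationary equation for f and the flux identity for g = f / v_1 cancel everything except k Ψ v_0. -/
theorem IsStationaryPair.integral_mul_Psi_eq_zero (hU : ContDiff ℝ 2 U) (hG : IsAttractor U c a b)
    (hΦ : IsRectifying U c a b Φ) {m : Fin 2 → Measure ℝ} [∀ i, IsFiniteMeasure (m i)]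
    (hm : IsStationaryPair U c l m) (hab : ∀ i, ∀ᵐ x ∂m i, x ∈ Icc a b) {p q : ℝ} (hp : a < p)
    (hq : q < b) {k : ℝ → ℝ} (hk : Continuous k) (hk0 : ∀ x, x ∉ Icc p q → k x = 0)
    (hk1 : ∫ x, k x = 0) :
    ∫ x, k x * Psi l Φ x * (c 0 - deriv U x) ∂m 0 = 0 := by
  have hUc := continuous_deriv_of_contDiff hU
  set F : ℝ → ℝ := fun x => ∫ y in p..x, k y with hF
  have hFd : ∀ x, HasDerivAt F (k x) x := fun x => (hk.integral_hasStrictDerivAt p x).hasDerivAt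
  have hFc : Continuous F := continuous_iff_continuousAt.2 fun x => (hFd x).continuousAt
  have hF0 : ∀ x, x ∉ Icc p q → F x = 0 := by
    intro x hx
    simp only [hF]
    by_cases hxp : p ≤ x
    · have hxq : q < x := not_le.1 fun h => hx ⟨hxp, h⟩
      rw [intervalIntegral.integral_of_le hxp, ← integral_Icc_eq_integral_Ioc,
        setIntegral_eq_integral_of_forall_compl_eq_zero, hk1]
      intro y hy
      exact hk0 y fun h => hy ⟨h.1, h.2.trans hxq.le⟩
    · refine (intervalIntegral.integral_congr (g := fun _ => 0) fun y hy => ?_).trans (by simp)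
      rw [uIcc_of_ge (not_le.1 hxp).le] at hy
      rcases hy.2.lt_or_eq with h | h
      · exact hk0 y fun h' => h.not_ge h'.1
      -- The endpoint p belongs to the support interval; k vanishes there by continuity from the
      -- left.
      · have hcl : IsClosed {y | k y = 0} := isClosed_eq hk continuous_const
        have : Iic p ⊆ {y | k y = 0} := by
          rw [← closure_Iio]
          exact hcl.closure_subset_iff.2 fun y hy => hk0 y fun h' => (not_le.2 hy) h'.1
        exact this h.le
  have hΨ := continuousOn_Psi (l := l) hΦ
  have hv := continuousOn_inv_velocity hU hG
  set f : ℝ → ℝ := fun x => F x * Psi l Φ x with hf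
  set f' : ℝ → ℝ := fun x => k x * Psi l Φ x + F x *
    (Psi l Φ x * (l 0 / (c 0 - deriv U x) + l 1 / (c 1 - deriv U x))) with hf'
  have hfd : ∀ x, HasDerivAt f (f' x) x := by
    intro x
    by_cases hx : x ∈ Ioo a b
    · exact (hFd x).mul (hasDerivAt_Psi hΦ hx)
    · have hx' : x ∈ (Icc p q)ᶜ := fun h => hx ⟨hp.trans_le h.1, h.2.trans_lt hq⟩
      have : f' x = 0 := by simp only [hf', hk0 x hx', hF0 x hx', zero_mul, add_zero]
      rw [this]
      refine (hasDerivAt_const x (0 : ℝ)).congr_of_eventuallyEq ?_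
      filter_upwards [isClosed_Icc.isOpen_compl.mem_nhds hx'] with y hy
      simp only [hf, hF0 y hy, zero_mul]
  have hf'c : Continuous f' := by
    refine (continuous_mul_of_eq_zero hp hq hk hk0 hΨ).add
      (continuous_mul_of_eq_zero hp hq hFc hF0 (hΨ.mul ?_))
    simp only [div_eq_mul_inv]
    exact (continuousOn_const.mul (hv 0)).add (continuousOn_const.mul (hv 1))
  have hfc : Continuous f := continuous_mul_of_eq_zero hp hq hFc hF0 hΨ
  have hg : Continuous fun x => F x * (Psi l Φ x * (c 1 - deriv U x)⁻¹) :=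
    continuous_mul_of_eq_zero hp hq hFc hF0 (hΨ.mul (hv 1))
  have e1 := hm.integral_deriv_mul_velocity hU hab hfd hf'c
  have e2 := hm.sum_integral_mul_velocity hg
  rw [Fin.sum_univ_two] at e2
  have e3 : ∫ x, F x * (Psi l Φ x * (c 1 - deriv U x)⁻¹) * (c 1 - deriv U x) ∂m 1 =
      ∫ x, f x ∂m 1 := by
    refine integral_congr_ae (Eventually.of_forall fun x => ?_)
    simp only [hf]
    by_cases hx : x ∈ Icc p q
    · have := hG.velocity_ne_zero 1 (x := x) ⟨hp.trans_le hx.1, hx.2.trans_lt hq⟩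
      field_simp
    · rw [hF0 x hx]
      ring
  have i1 : Integrable (fun x => f' x * (c 0 - deriv U x)) (m 0) :=
    integrable_of_ae_mem_Icc (hab 0) (hf'c.mul (continuous_const.sub hUc))
  have i2 : Integrable (fun x => l 0 * f x) (m 0) :=
    integrable_of_ae_mem_Icc (hab 0) (continuous_const.mul hfc)
  have i3 : Integrable (fun x => l 1 * (F x * (Psi l Φ x * (c 1 - deriv U x)⁻¹) *
      (c 0 - deriv U x))) (m 0) :=
    integrable_of_ae_mem_Icc (hab 0)
      (continuous_const.mul (hg.mul (continuous_const.sub hUc)))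
  have i4 : Integrable (fun x => f' x * (c 0 - deriv U x) - l 0 * f x) (m 0) := i1.sub i2
  have e4 : ∫ x, k x * Psi l Φ x * (c 0 - deriv U x) ∂m 0 =
      ∫ x, (f' x * (c 0 - deriv U x) - l 0 * f x - l 1 *
        (F x * (Psi l Φ x * (c 1 - deriv U x)⁻¹) * (c 0 - deriv U x))) ∂m 0 := by
    refine integral_congr_ae (Eventually.of_forall fun x => ?_)
    simp only [hf, hf']
    by_cases hx : x ∈ Icc p q
    · have h0 := hG.velocity_ne_zero 0 (x := x) ⟨hp.trans_le hx.1, hx.2.trans_lt hq⟩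
      have h1 := hG.velocity_ne_zero 1 (x := x) ⟨hp.trans_le hx.1, hx.2.trans_lt hq⟩
      field_simp
      ring
    · rw [hF0 x hx, hk0 x hx]
      ring
  rw [e4, integral_sub i4 i3, integral_sub i1 i2, integral_const_mul, integral_const_mul, e1]
  rw [e3] at e2
  rw [eq_neg_of_add_eq_zero_left e2]
  ring

/-- A continuous cutoff function, equal to `1` well inside `(a, b)` and vanishing near `a`, `b`. -/
def cutoff (a b : ℝ) (n : ℕ) (x : ℝ) : ℝ := max 0 (min 1 (((n : ℝ) + 1) * min (x - a) (b - x) - 1))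

theorem continuous_cutoff (n : ℕ) : Continuous (cutoff a b n) := by
  unfold cutoff
  fun_prop

theorem cutoff_nonneg (n : ℕ) (x : ℝ) : 0 ≤ cutoff a b n x := le_max_left _ _

theorem cutoff_le_one (n : ℕ) (x : ℝ) : cutoff a b n x ≤ 1 :=
  max_le zero_le_one (min_le_left _ _)

theorem cutoff_eq_zero (n : ℕ) {x : ℝ}
    (hx : x ∉ Icc (a + 1 / ((n : ℝ) + 1)) (b - 1 / ((n : ℝ) + 1))) : cutoff a b n x = 0 := by
  have hn : (0 : ℝ) < n + 1 := by positivity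
  refine max_eq_left ((min_le_right _ _).trans ?_)
  rw [sub_nonpos, mul_comm, ← le_div_iff₀ hn]
  rw [mem_Icc, not_and_or, not_le, not_le] at hx
  rcases hx with hx | hx
  · exact (min_le_left _ _).trans (by linarith)
  · exact (min_le_right _ _).trans (by linarith)

theorem eventually_cutoff_eq_one {x : ℝ} (hx : x ∈ Ioo a b) :
    ∀ᶠ n in atTop, cutoff a b n x = 1 := by
  have hd : 0 < min (x - a) (b - x) := lt_min (sub_pos.2 hx.1) (sub_pos.2 hx.2)
  filter_upwards [(tendsto_natCast_atTop_atTop (R := ℝ)).eventually_ge_atTop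
    (2 / min (x - a) (b - x))] with n hn
  rw [div_le_iff₀ hd] at hn
  have : 1 ≤ ((n : ℝ) + 1) * min (x - a) (b - x) - 1 := by nlinarith
  rw [cutoff, min_eq_left this, max_eq_right zero_le_one]

theorem tendsto_integral_cutoff {m : Measure ℝ} (hab : ∀ᵐ x ∂m, x ∈ Ioo a b) {f : ℝ → ℝ}
    (hf : Integrable f m) :
    Tendsto (fun n => ∫ x, cutoff a b n x * f x ∂m) atTop (𝓝 (∫ x, f x ∂m)) := by
  refine tendsto_integral_of_dominated_convergence (fun x => |f x|)
    (fun n => (continuous_cutoff n).aestronglyMeasurable.mul hf.1) hf.abs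
    (fun n => Eventually.of_forall fun x => ?_) ?_
  · rw [norm_mul, Real.norm_of_nonneg (cutoff_nonneg n x), Real.norm_eq_abs]
    exact mul_le_of_le_one_left (abs_nonneg _) (cutoff_le_one n x)
  · filter_upwards [hab] with x hx
    refine tendsto_const_nhds.congr' ?_
    filter_upwards [eventually_cutoff_eq_one hx] with n hn
    rw [hn, one_mul]

theorem integral_cutoff_pos (hab : a < b) : ∃ n, 0 < ∫ x, cutoff a b n x := by
  have h1 : Integrable (fun _ : ℝ => (1 : ℝ)) (volume.restrict (Ioo a b)) := integrable_const _
  have h := tendsto_integral_cutoff (ae_restrict_mem measurableSet_Ioo) h1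
  have h2 : ∫ _ in Ioo a b, (1 : ℝ) = b - a := by simp [hab.le]
  rw [h2] at h
  obtain ⟨n, hn⟩ := (h.eventually_const_lt (sub_pos.2 hab)).exists
  refine ⟨n, ?_⟩
  rw [setIntegral_eq_integral_of_forall_compl_eq_zero] at hn
  · simpa using hn
  · intro x hx
    rw [cutoff_eq_zero n, zero_mul]
    have : (0 : ℝ) < 1 / ((n : ℝ) + 1) := by positivity
    exact fun h => hx ⟨by linarith [h.1], by linarith [h.2]⟩

/-- A functional that kills all test functions of integral zero is a multiple of the integral: Ψ v_0
m_0 is a multiple of Lebesgue measure on (a, b). The flux identity with g = k Ψ gives the same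
constant for state 1, and K ≥ 0 since v_0 ≥ 0 on [a, b]. -/
theorem IsStationaryPair.exists_integral_mul_Psi_eq (hU : ContDiff ℝ 2 U)
    (hG : IsAttractor U c a b) (hΦ : IsRectifying U c a b Φ) {m : Fin 2 → Measure ℝ}
    [∀ i, IsFiniteMeasure (m i)] (hm : IsStationaryPair U c l m)
    (hab : ∀ i, ∀ᵐ x ∂m i, x ∈ Icc a b) :
    ∃ K, 0 ≤ K ∧ ∀ p q, a < p → q < b → ∀ k : ℝ → ℝ, Continuous k →
      (∀ x, x ∉ Icc p q → k x = 0) → ∀ i,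
      ∫ x, k x * Psi l Φ x * (dirSign i * (c i - deriv U x)) ∂m i = K * ∫ x, k x := by
  obtain ⟨n, hn⟩ := integral_cutoff_pos hG.lt
  set χ := cutoff a b n with hχ
  set J := ∫ x, χ x with hJ
  have hn0 : (0 : ℝ) < 1 / ((n : ℝ) + 1) := by positivity
  have hUc := continuous_deriv_of_contDiff hU
  have hΨ := continuousOn_Psi (l := l) hΦ
  have hsupp : ∀ k : ℝ → ℝ, Continuous k → ∀ p q, (∀ x, x ∉ Icc p q → k x = 0) →
      Integrable k := fun k hk p q hk0 =>
    hk.integrable_of_hasCompactSupport (HasCompactSupport.intro isCompact_Icc hk0)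
  have hχ0 : ∀ x, x ∉ Icc (a + 1 / ((n : ℝ) + 1)) (b - 1 / ((n : ℝ) + 1)) → χ x = 0 :=
    fun x hx => cutoff_eq_zero n hx
  have hχc : Continuous χ := continuous_cutoff n
  have hχi := hsupp χ hχc _ _ hχ0
  have hχI : Integrable (fun x => χ x * Psi l Φ x * (c 0 - deriv U x)) (m 0) :=
    integrable_of_ae_mem_Icc (hab 0)
      ((continuous_mul_of_eq_zero (lt_add_of_pos_right a hn0) (sub_lt_self b hn0) hχc hχ0 hΨ).mul
        (continuous_const.sub hUc))
  refine ⟨J⁻¹ * ∫ x, χ x * Psi l Φ x * (c 0 - deriv U x) ∂m 0, mul_nonneg (inv_nonneg.2 hn.le)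
    (integral_nonneg_of_ae ?_), fun p q hp hq k hk hk0 => ?_⟩
  · filter_upwards [hab 0] with x hx
    exact mul_nonneg (mul_nonneg (cutoff_nonneg n x) (Psi_pos l Φ x).le)
      (sub_nonneg.2 (hG.deriv_mem hx).2)
  have hki := hsupp k hk p q hk0
  have hkc := continuous_mul_of_eq_zero hp hq hk hk0 hΨ
  have hkI : Integrable (fun x => k x * Psi l Φ x * (c 0 - deriv U x)) (m 0) :=
    integrable_of_ae_mem_Icc (hab 0) (hkc.mul (continuous_const.sub hUc))
  set I := ∫ x, k x with hI
  have h0 : ∫ x, k x * Psi l Φ x * (c 0 - deriv U x) ∂m 0 =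
      J⁻¹ * (∫ x, χ x * Psi l Φ x * (c 0 - deriv U x) ∂m 0) * I := by
    -- Subtracting the multiple I / J of the reference bump χ leaves a function of integral zero,
    -- supported in the hull of the two supports.
    have hz := hm.integral_mul_Psi_eq_zero hU hG hΦ hab
      (p := min p (a + 1 / ((n : ℝ) + 1))) (q := max q (b - 1 / ((n : ℝ) + 1)))
      (k := fun x => k x - J⁻¹ * I * χ x)
      (lt_min hp (lt_add_of_pos_right a hn0)) (max_lt hq (sub_lt_self b hn0))
      (hk.sub (continuous_const.mul hχc))
      (fun x hx => by
        rw [hk0 x fun h => hx ⟨(min_le_left _ _).trans h.1, h.2.trans (le_max_left _ _)⟩,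
          hχ0 x fun h => hx ⟨(min_le_right _ _).trans h.1, h.2.trans (le_max_right _ _)⟩]
        ring)
      (by
        rw [integral_sub hki (hχi.const_mul _), integral_const_mul, ← hI, ← hJ]
        field_simp
        ring)
    have he : ∀ x, (k x - J⁻¹ * I * χ x) * Psi l Φ x * (c 0 - deriv U x) =
        k x * Psi l Φ x * (c 0 - deriv U x) -
          J⁻¹ * I * (χ x * Psi l Φ x * (c 0 - deriv U x)) := fun x => by ring
    simp only [he] at hz
    rw [integral_sub hkI (hχI.const_mul _), integral_const_mul] at hz
    linarith
  have h1 := hm.sum_integral_mul_velocity hkc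
  rw [Fin.sum_univ_two] at h1
  intro i
  rw [← h0]
  fin_cases i
  · simp [dirSign]
  · simp only [Fin.mk_one, Fin.isValue, dirSign, one_ne_zero, if_false, neg_one_mul, mul_neg]
    rw [integral_neg]
    linarith

/-- Since Ψ |v_i| w_i = 1, testing with g w_i recovers ∫ g dm_i. The cutoffs make g w_i an
admissible test function, and dominated convergence removes them. -/
theorem IsStationaryPair.exists_restrict_eq (hU : ContDiff ℝ 2 U) (hG : IsAttractor U c a b)
    (hl : ∀ i, 0 < l i) (hΦ : IsRectifying U c a b Φ) {m : Fin 2 → Measure ℝ}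
    [∀ i, IsFiniteMeasure (m i)] (hm : IsStationaryPair U c l m)
    (hab : ∀ i, ∀ᵐ x ∂m i, x ∈ Icc a b) :
    ∃ K, 0 ≤ K ∧ ∀ i, (m i).restrict (Ioo a b) =
      ENNReal.ofReal K • weightMeasure U c l a b Φ i := by
  obtain ⟨K, hK, h⟩ := hm.exists_integral_mul_Psi_eq hU hG hΦ hab
  refine ⟨K, hK, fun i => ?_⟩
  have := isFiniteMeasure_weightMeasure hU hG hl hΦ i
  have : IsFiniteMeasure (ENNReal.ofReal K • weightMeasure U c l a b Φ i) :=
    (weightMeasure U c l a b Φ i).smul_finite ENNReal.ofReal_ne_top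
  refine ext_of_forall_integral_eq_of_IsFiniteMeasure fun g => ?_
  rw [integral_smul_measure, ENNReal.toReal_ofReal hK, smul_eq_mul,
    integral_weightMeasure hU hG hΦ i]
  have hgi : Integrable g ((m i).restrict (Ioo a b)) := g.integrable _
  have hgw : Integrable (fun x => g x * weight U c l Φ i x) (volume.restrict (Ioo a b)) :=
    (integrableOn_weight hU hG hl hΦ i).bdd_mul (c := ‖g‖) g.continuous.aestronglyMeasurable
      (Eventually.of_forall g.norm_coe_le_norm)
  have l1 := tendsto_integral_cutoff (ae_restrict_mem measurableSet_Ioo) hgi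
  have l2 := (tendsto_integral_cutoff (ae_restrict_mem measurableSet_Ioo) hgw).const_mul K
  refine tendsto_nhds_unique (l1.congr fun n => ?_) l2
  have hn0 : (0 : ℝ) < 1 / ((n : ℝ) + 1) := by positivity
  have hsub : Icc (a + 1 / ((n : ℝ) + 1)) (b - 1 / ((n : ℝ) + 1)) ⊆ Ioo a b := fun x hx =>
    ⟨by linarith [hx.1], by linarith [hx.2]⟩
  have hk0 : ∀ x, x ∉ Icc (a + 1 / ((n : ℝ) + 1)) (b - 1 / ((n : ℝ) + 1)) →
      cutoff a b n x * (g x * weight U c l Φ i x) = 0 := fun x hx => by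
    rw [cutoff_eq_zero n hx, zero_mul]
  have hc := h _ _ (lt_add_of_pos_right a hn0) (sub_lt_self b hn0)
    (fun x => cutoff a b n x * (g x * weight U c l Φ i x))
    (continuous_mul_of_eq_zero (lt_add_of_pos_right a hn0) (sub_lt_self b hn0)
      (continuous_cutoff n) (fun x hx => cutoff_eq_zero n hx)
      (g.continuous.continuousOn.mul (continuousOn_weight hU hG hΦ i))) hk0 i
  rw [setIntegral_eq_integral_of_forall_compl_eq_zero
      (fun x hx => by rw [cutoff_eq_zero n fun h => hx (hsub h), zero_mul]),
    setIntegral_eq_integral_of_forall_compl_eq_zero (fun x hx => hk0 x fun h => hx (hsub h)), ← hc]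
  refine integral_congr_ae (Eventually.of_forall fun x => ?_)
  by_cases hx : x ∈ Icc (a + 1 / ((n : ℝ) + 1)) (b - 1 / ((n : ℝ) + 1))
  · have h1 := velocity_mul_weight (l := l) (Φ := Φ) hG i (hsub hx)
    have h2 := dirSign_mul_self i
    have h3 := (Psi_pos l Φ x).ne'
    calc cutoff a b n x * g x = cutoff a b n x * g x * (dirSign i * dirSign i) *
          (Psi l Φ x * (Psi l Φ x)⁻¹) := by rw [h2, mul_inv_cancel₀ h3]; ring
      _ = cutoff a b n x * g x * dirSign i * Psi l Φ x * (dirSign i * (Psi l Φ x)⁻¹) := by ring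
      _ = _ := by rw [← h1]; ring
  · simp only [cutoff_eq_zero n hx, zero_mul]

/-! ### Exclusion of atoms at the endpoints -/

theorem measure_eq_restrict_Ioo_add {m : Measure ℝ} (hlt : a < b) (hab : ∀ᵐ x ∂m, x ∈ Icc a b) :
    m = m.restrict (Ioo a b) + m {a} • Measure.dirac a + m {b} • Measure.dirac b := by
  rw [← Measure.restrict_singleton, ← Measure.restrict_singleton,
    ← Measure.restrict_union (by simp) (measurableSet_singleton a),
    ← Measure.restrict_union (by simp [hlt.ne']) (measurableSet_singleton b),
    union_comm (Ioo a b), singleton_union, Ioo_insert_left hlt, union_comm, singleton_union,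
    Ico_insert_right hlt.le]
  exact (Measure.restrict_eq_self_of_ae_mem hab).symm

/-- Stationary pairs of measures carried by `[a, b]` are multiples of the canonical one. -/
theorem IsStationaryPair.exists_eq_smul (hU : ContDiff ℝ 2 U) (hG : IsAttractor U c a b)
    (hl : ∀ i, 0 < l i) (hΦ : IsRectifying U c a b Φ) {m : Fin 2 → Measure ℝ}
    [∀ i, IsFiniteMeasure (m i)] (hm : IsStationaryPair U c l m)
    (hab : ∀ i, ∀ᵐ x ∂m i, x ∈ Icc a b) :
    ∃ K, 0 ≤ K ∧ ∀ i, m i = ENNReal.ofReal K • weightMeasure U c l a b Φ i := by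
  obtain ⟨K, hK, hr⟩ := hm.exists_restrict_eq hU hG hl hΦ hab
  refine ⟨K, hK, ?_⟩
  have hUc := continuous_deriv_of_contDiff hU
  have hlt := hG.lt
  have hint : ∀ i, ∀ f : ℝ → ℝ, Continuous f → ∫ x, f x ∂m i =
      K * (∫ x in Ioo a b, f x * weight U c l Φ i x) + (m i).real {a} * f a +
        (m i).real {b} * f b := by
    intro i f hf
    have hf0 := integrable_of_ae_mem_Icc (hab i) hf
    have hd : ∀ x, Integrable f (m i {x} • Measure.dirac x) := fun x =>
      (integrable_dirac (by finiteness)).smul_measure (measure_ne_top _ _)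
    conv_lhs => rw [measure_eq_restrict_Ioo_add hlt (hab i)]
    rw [integral_add_measure ((hf0.restrict).add_measure (hd a)) (hd b),
      integral_add_measure hf0.restrict (hd a), hr i, integral_smul_measure,
      ENNReal.toReal_ofReal hK, integral_weightMeasure hU hG hΦ i, integral_smul_measure,
      integral_smul_measure, integral_dirac, integral_dirac]
    rfl
  have hUa := hG.left
  have hUb := hG.right
  have hcc : 0 < c 0 - c 1 := by
    have := hG.between _ (midpoint_mem hG)
    linarith
  -- In the flux identity the densities cancel, as v_0 w_0 = -v_1 w_1. Of the atoms only those with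
  -- nonzero velocity survive: state 0 at a and state 1 at b, with opposite velocities ±(c_0 - c_1).
  have hfirst : ∀ g : ℝ → ℝ, Continuous g → (m 0).real {a} * g a = (m 1).real {b} * g b := by
    intro g hg
    have h := hm.sum_integral_mul_velocity hg
    rw [Fin.sum_univ_two, hint 0 (fun x => g x * (c 0 - deriv U x)) (by fun_prop),
      hint 1 (fun x => g x * (c 1 - deriv U x)) (by fun_prop), hUa, hUb] at h
    have h2 : ∀ i, ∫ x in Ioo a b, g x * (c i - deriv U x) * weight U c l Φ i x =
        dirSign i * ∫ x in Ioo a b, g x * (Psi l Φ x)⁻¹ := by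
      intro i
      rw [← integral_const_mul]
      refine setIntegral_congr_fun measurableSet_Ioo fun x hx => ?_
      rw [mul_assoc, velocity_mul_weight hG i hx]
      ring
    rw [h2, h2] at h
    simp only [dirSign, Fin.isValue, if_true, one_ne_zero, if_false] at h
    have h3 : ((m 0).real {a} * g a - (m 1).real {b} * g b) * (c 0 - c 1) = 0 := by linarith
    rcases mul_eq_zero.1 h3 with h4 | h4
    · linarith
    · exact absurd h4 hcc.ne'
  have hpa : (m 0).real {a} = 0 := by
    have h := hfirst (fun x => x - b) (by fun_prop)
    rw [sub_self, mul_zero, mul_eq_zero] at h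
    exact h.resolve_right (sub_neg.2 hlt).ne
  have hqb : (m 1).real {b} = 0 := by
    have h := hfirst (fun x => x - a) (by fun_prop)
    rw [sub_self, mul_zero, eq_comm, mul_eq_zero] at h
    exact h.resolve_right (sub_pos.2 hlt).ne'
  -- The remaining atoms sit where the velocity is zero, so only the switching terms see them. For
  -- the test function x - y the density terms cancel by integration by parts.
  have hsecond : ∀ y : ℝ, l 0 * ((m 0).real {b} * (b - y)) = l 1 * ((m 1).real {a} * (a - y)) := by
    intro y
    have hd : ∀ x : ℝ, HasDerivAt (fun x => x - y) 1 x := fun x => (hasDerivAt_id x).sub_const y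
    have h := hm.integral_deriv_mul_velocity hU hab hd continuous_const
    have hc : Continuous fun x : ℝ => x - y := by fun_prop
    rw [hint 0 (fun x => 1 * (c 0 - deriv U x)) (by fun_prop), hint 0 _ hc, hint 1 _ hc,
      hUa, hUb, hpa, hqb] at h
    have h2 : ∫ x in Ioo a b, 1 * (c 0 - deriv U x) * weight U c l Φ 0 x =
        ∫ x in Ioo a b, 1 * (Psi l Φ x)⁻¹ := by
      refine setIntegral_congr_fun measurableSet_Ioo fun x hx => ?_
      rw [mul_assoc, velocity_mul_weight hG 0 hx]
      simp [dirSign]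
    have h3 := integral_deriv_mul_inv_Psi hU hG hl hΦ (f := fun x => x - y) (f' := fun _ => 1)
      hc.continuousOn (fun x _ => hd x) (by simpa using integrableOn_inv_Psi hU hG hl hΦ)
    rw [h2, h3, Fin.sum_univ_two] at h
    simp only [dirSign, Fin.isValue, if_true, one_ne_zero, if_false] at h
    linarith
  have hpb : (m 0).real {b} = 0 := by
    have h := hsecond a
    rw [sub_self, mul_zero, mul_zero, mul_eq_zero, mul_eq_zero] at h
    rcases h with h | h | h
    · exact absurd h (hl 0).ne'
    · exact h
    · exact absurd h (sub_pos.2 hlt).ne'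
  have hqa : (m 1).real {a} = 0 := by
    have h := hsecond b
    rw [sub_self, mul_zero, mul_zero, eq_comm, mul_eq_zero, mul_eq_zero] at h
    rcases h with h | h | h
    · exact absurd h (hl 1).ne'
    · exact h
    · exact absurd h (sub_neg.2 hlt).ne
  intro i
  have hz : m i {a} = 0 ∧ m i {b} = 0 := by
    fin_cases i
    · exact ⟨(measureReal_eq_zero_iff).1 hpa, (measureReal_eq_zero_iff).1 hpb⟩
    · exact ⟨(measureReal_eq_zero_iff).1 hqa, (measureReal_eq_zero_iff).1 hqb⟩
  have h := measure_eq_restrict_Ioo_add hlt (hab i)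
  rwa [hz.1, hz.2, zero_smul, zero_smul, add_zero, add_zero, hr i] at h

/-! ### Measures on the state space -/

/-- The measure on the line carried by the `i`-th component of the state space. -/
def fiber (ν : Measure (ℝ × Fin 2)) (i : Fin 2) : Measure ℝ := ν.comap fun x => (x, i)

theorem sum_map_fiber (ν : Measure (ℝ × Fin 2)) :
    ∑ i, (fiber ν i).map (fun x => (x, i)) = ν := by
  have hr : ∀ i : Fin 2, range (fun x : ℝ => (x, i)) = Prod.snd ⁻¹' {i} := fun i => by
    ext z
    simp [Prod.ext_iff, eq_comm]
  have h : ∀ i, (fiber ν i).map (fun x => (x, i)) = ν.restrict (Prod.snd ⁻¹' {i}) := fun i => by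
    rw [fiber, (measurableEmbedding_prod_mk_right i).map_comap, hr]
  have hc : (Prod.snd ⁻¹' {0} : Set (ℝ × Fin 2))ᶜ = Prod.snd ⁻¹' {1} := by
    ext ⟨x, i⟩
    fin_cases i <;> simp
  rw [Fin.sum_univ_two, h, h, ← hc]
  exact Measure.restrict_add_restrict_compl (measurable_snd (measurableSet_singleton _))

theorem isFiniteMeasure_fiber (ν : Measure (ℝ × Fin 2)) [IsFiniteMeasure ν] (i : Fin 2) :
    IsFiniteMeasure (fiber ν i) :=
  ⟨by
    rw [fiber, (measurableEmbedding_prod_mk_right i).comap_apply]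
    exact measure_lt_top _ _⟩

theorem ae_mem_fiber {ν : Measure (ℝ × Fin 2)} (hν : ∀ᵐ z ∂ν, z.1 ∈ Icc a b) (i : Fin 2) :
    ∀ᵐ x ∂fiber ν i, x ∈ Icc a b := by
  rw [ae_iff] at hν ⊢
  rw [fiber, (measurableEmbedding_prod_mk_right i).comap_apply]
  refine measure_mono_null ?_ hν
  rintro _ ⟨x, hx, rfl⟩
  exact hx

theorem integral_sum_map {m : Fin 2 → Measure ℝ} {f : ℝ × Fin 2 → ℝ}
    (hf : ∀ i, Integrable (fun x => f (x, i)) (m i)) :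
    ∫ z, f z ∂(∑ i, (m i).map fun x => (x, i)) = ∑ i, ∫ x, f (x, i) ∂m i := by
  have h : ∀ i, Integrable f ((m i).map fun x => (x, i)) := fun i =>
    ((measurableEmbedding_prod_mk_right i).integrable_map_iff).2 (hf i)
  rw [Fin.sum_univ_two, integral_add_measure (h 0) (h 1), Fin.sum_univ_two,
    (measurableEmbedding_prod_mk_right 0).integral_map,
    (measurableEmbedding_prod_mk_right 1).integral_map]

theorem lintegral_sum_map {m : Fin 2 → Measure ℝ} (f : ℝ × Fin 2 → ℝ≥0∞) :
    ∫⁻ z, f z ∂(∑ i, (m i).map fun x => (x, i)) = ∑ i, ∫⁻ x, f (x, i) ∂m i := by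
  rw [Fin.sum_univ_two, lintegral_add_measure, Fin.sum_univ_two,
    (measurableEmbedding_prod_mk_right 0).lintegral_map,
    (measurableEmbedding_prod_mk_right 1).lintegral_map]

theorem isStationaryPair_fiber (hU : ContDiff ℝ 2 U) (hG : IsAttractor U c a b)
    (hl : ∀ i, 0 < l i) {ν : Measure (ℝ × Fin 2)} [IsFiniteMeasure ν]
    (hν : ∀ᵐ z ∂ν, z.1 ∈ Icc a b) (hinv : IsInvariantMeasure U c l ν) :
    IsStationaryPair U c l (fiber ν) := by
  intro F F' hF hF'
  have hUc := continuous_deriv_of_contDiff hU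
  have hFc : ∀ i, Continuous (F i) := fun i =>
    continuous_iff_continuousAt.2 fun x => (hF i x).continuousAt
  have h := integral_generator_eq_zero hU hG hl hν hinv hF hF'
  rw [← sum_map_fiber ν, integral_sum_map] at h
  · exact h
  · intro i
    have := isFiniteMeasure_fiber ν i
    have h1 := hF' i
    have h2 := hFc i
    have h3 := hFc (1 - i)
    have hc : Continuous fun x =>
        F' i x * (c i - deriv U x) + l i * (F (1 - i) x - F i x) := by fun_prop
    exact integrable_of_ae_mem_Icc (ae_mem_fiber hν i) hc

/-! ### The stationary distribution -/

/-- The multiple of the canonical stationary measure by `κ`. -/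
def stationaryMeasure (U : ℝ → ℝ) (c l : Fin 2 → ℝ) (a b : ℝ) (Φ : Fin 2 → ℝ → ℝ) (κ : ℝ) :
    Measure (ℝ × Fin 2) :=
  ∑ i, (ENNReal.ofReal κ • weightMeasure U c l a b Φ i).map fun x => (x, i)

theorem measureOfDensities_eq_stationaryMeasure {κ : ℝ} (hκ : 0 ≤ κ) :
    measureOfDensities a b (fun i x => κ * weight U c l Φ i x) =
      stationaryMeasure U c l a b Φ κ := by
  rw [measureOfDensities, stationaryMeasure]
  refine Finset.sum_congr rfl fun i _ => ?_
  rw [weightMeasure, ← withDensity_smul' _ _ ENNReal.ofReal_ne_top]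
  congr 2
  funext x
  rw [ENNReal.ofReal_mul hκ]
  rfl

theorem weightMeasure_univ (hU : ContDiff ℝ 2 U) (hG : IsAttractor U c a b)
    (hl : ∀ i, 0 < l i) (hΦ : IsRectifying U c a b Φ) (i : Fin 2) :
    weightMeasure U c l a b Φ i univ = ENNReal.ofReal (∫ x in Ioo a b, weight U c l Φ i x) := by
  rw [weightMeasure, withDensity_apply _ MeasurableSet.univ, Measure.restrict_univ,
    ofReal_integral_eq_lintegral_ofReal (integrableOn_weight hU hG hl hΦ i)]
  exact (ae_restrict_iff' measurableSet_Ioo).2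
    (Eventually.of_forall fun x hx => (weight_pos hG i hx).le)

theorem stationaryMeasure_univ (hU : ContDiff ℝ 2 U) (hG : IsAttractor U c a b)
    (hl : ∀ i, 0 < l i) (hΦ : IsRectifying U c a b Φ) {κ : ℝ} (hκ : 0 ≤ κ) :
    stationaryMeasure U c l a b Φ κ univ =
      ENNReal.ofReal (κ * ∑ i, ∫ x in Ioo a b, weight U c l Φ i x) := by
  have h := fun i => (integral_weight_pos hU hG hl hΦ i).le
  have hm : ∀ i : Fin 2, Measurable fun x : ℝ => (x, i) := fun i =>
    measurable_id.prodMk measurable_const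
  simp only [stationaryMeasure, Fin.sum_univ_two, Measure.add_apply,
    Measure.map_apply (hm _) MeasurableSet.univ, preimage_univ, Measure.smul_apply,
    weightMeasure_univ hU hG hl hΦ, smul_eq_mul]
  rw [← ENNReal.ofReal_mul hκ, ← ENNReal.ofReal_mul hκ,
    ← ENNReal.ofReal_add (mul_nonneg hκ (h 0)) (mul_nonneg hκ (h 1)), mul_add]

theorem stationaryMeasure_compl (κ : ℝ) :
    stationaryMeasure U c l a b Φ κ (Ioo a b ×ˢ univ)ᶜ = 0 := by
  have hm : ∀ i : Fin 2, Measurable fun x : ℝ => (x, i) := fun i =>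
    measurable_id.prodMk measurable_const
  have h : ∀ i, weightMeasure U c l a b Φ i (Ioo a b)ᶜ = 0 := fun i =>
    ae_iff.1 (ae_mem_weightMeasure i)
  have hp : ∀ i : Fin 2, (fun x : ℝ => (x, i)) ⁻¹' (Ioo a b ×ˢ univ)ᶜ = (Ioo a b)ᶜ := fun i => by
    ext x
    simp
  simp only [stationaryMeasure, Fin.sum_univ_two, Measure.add_apply, Measure.smul_apply,
    Measure.map_apply (hm _) (measurableSet_Ioo.prod MeasurableSet.univ).compl, hp, h, smul_zero,
    add_zero]

/-- The semigroup identity applied to the indicator of A; the common factor κ passes through both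
sides. -/
theorem isInvariantMeasure_stationaryMeasure (hU : ContDiff ℝ 2 U) (hG : IsAttractor U c a b)
    (hl : ∀ i, 0 < l i) (hΦ : IsRectifying U c a b Φ) (κ : ℝ) :
    IsInvariantMeasure U c l (stationaryMeasure U c l a b Φ κ) := by
  intro t ht A hA
  have hA1 : Measurable (A.indicator (1 : ℝ × Fin 2 → ℝ≥0∞)) := measurable_one.indicator hA
  have h := sum_lintegral_lsemigroup hU hG hl hΦ hA1
    (fun z => indicator_le_self' (fun _ _ => zero_le_one) z) ht
  rw [← lintegral_indicator_one hA, stationaryMeasure, lintegral_sum_map, lintegral_sum_map]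
  simp only [lintegral_smul_measure, ← Finset.smul_sum]
  rw [← h]
  congr 1
  refine Finset.sum_congr rfl fun i _ => lintegral_congr_ae ?_
  filter_upwards [ae_mem_weightMeasure i] with x hx
  have hr := measurable_regularPath_fixed hU hG (x, i) t
  rw [transitionProb_eq hl (Ioo_subset_Icc_self hx) ht, lsemigroup, ← lintegral_map hA1 hr,
    lintegral_indicator_one hA, Measure.map_apply hr hA]
  rfl

/-- The density is positive on (a, b), so Lebesgue measure there is absolutely continuous with
respect to it, and every open set meeting [a, b] meets (a, b) in a nonempty open set. -/
theorem support_stationaryMeasure (hU : ContDiff ℝ 2 U) (hG : IsAttractor U c a b)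
    (hΦ : IsRectifying U c a b Φ) {κ : ℝ} (hκ : 0 < κ) :
    (stationaryMeasure U c l a b Φ κ).support = Icc a b ×ˢ univ := by
  refine Subset.antisymm (Measure.support_subset_of_isClosed (isClosed_Icc.prod isClosed_univ) ?_) ?_
  · rw [mem_ae_iff]
    exact measure_mono_null (compl_subset_compl.2 (prod_mono_left Ioo_subset_Icc_self))
      (stationaryMeasure_compl κ)
  · rintro ⟨x, i⟩ hx
    rw [Measure.mem_support_iff_forall]
    intro V hV
    have hcont : Continuous fun y : ℝ => (y, i) := by fun_prop
    obtain ⟨O, hOV, hO, hxO⟩ := mem_nhds_iff.1 (hcont.continuousAt.preimage_mem_nhds hV)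
    rw [pos_iff_ne_zero]
    intro h0
    have h1 : (ENNReal.ofReal κ • weightMeasure U c l a b Φ i).map (fun y => (y, i)) V = 0 := by
      have h2 : stationaryMeasure U c l a b Φ κ V =
          ∑ j, (ENNReal.ofReal κ • weightMeasure U c l a b Φ j).map (fun y => (y, j)) V := by
        rw [stationaryMeasure, Measure.finsetSum_apply]
      rw [h2, Finset.sum_eq_zero_iff] at h0
      exact h0 i (Finset.mem_univ i)
    rw [(measurableEmbedding_prod_mk_right i).map_apply, Measure.smul_apply, smul_eq_mul,
      mul_eq_zero] at h1
    have h3 : weightMeasure U c l a b Φ i O = 0 :=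
      measure_mono_null hOV (h1.resolve_left (ENNReal.ofReal_pos.2 hκ).ne')
    have h4 : volume.restrict (Ioo a b) ≪ weightMeasure U c l a b Φ i := by
      refine withDensity_absolutelyContinuous' (aemeasurable_weight hU hG hΦ i).ennreal_ofReal ?_
      filter_upwards [ae_restrict_mem measurableSet_Ioo] with y hy
      exact (ENNReal.ofReal_pos.2 (weight_pos hG i hy)).ne'
    have h5 := h4 h3
    rw [Measure.restrict_apply hO.measurableSet] at h5
    have h6 : x ∈ closure (Ioo a b) := by
      rw [closure_Ioo hG.lt.ne]
      exact hx.1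
    exact ((hO.inter isOpen_Ioo).measure_pos volume (mem_closure_iff.1 h6 O hO hxO)).ne' h5

theorem eq_stationaryMeasure (hU : ContDiff ℝ 2 U) (hG : IsAttractor U c a b)
    (hl : ∀ i, 0 < l i) (hΦ : IsRectifying U c a b Φ) {ν : Measure (ℝ × Fin 2)}
    [IsFiniteMeasure ν] (hν : ∀ᵐ z ∂ν, z.1 ∈ Icc a b) (hinv : IsInvariantMeasure U c l ν) :
    ∃ K, 0 ≤ K ∧ ν = stationaryMeasure U c l a b Φ K := by
  have := isFiniteMeasure_fiber ν
  obtain ⟨K, hK, h⟩ := (isStationaryPair_fiber hU hG hl hν hinv).exists_eq_smul hU hG hl hΦ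
    (ae_mem_fiber hν)
  refine ⟨K, hK, ?_⟩
  conv_lhs => rw [← sum_map_fiber ν]
  simp only [h, stationaryMeasure]

end TelegraphPotential

end

/-! ### Assembly of the theorem -/

theorem mainTheorem3 (U : ℝ → ℝ) (hU : TelegraphPotential.IsDoubleWell U)
    (c l : Fin 2 → ℝ) (hc : c 1 < c 0) (hl : ∀ i, 0 < l i)
    (a b : ℝ) (hG : TelegraphPotential.IsAttractor U c a b)
    (Φ : Fin 2 → ℝ → ℝ) (hΦ : TelegraphPotential.IsRectifying U c a b Φ)
    (w : Fin 2 → ℝ → ℝ)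
    (hw0 : ∀ x, w 0 x = (TelegraphPotential.Psi l Φ x)⁻¹ / (c 0 - deriv U x))
    (hw1 : ∀ x, w 1 x = (TelegraphPotential.Psi l Φ x)⁻¹ / (deriv U x - c 1))
    (C : Fin 2 → ℝ)
    (hC0 : C 0 = l 1 / (l 0 + l 1) * (∫ x in Ioo a b, w 0 x)⁻¹)
    (hC1 : C 1 = l 0 / (l 0 + l 1) * (∫ x in Ioo a b, w 1 x)⁻¹)
    (μ : Measure (ℝ × Fin 2))
    (hμ : μ = TelegraphPotential.measureOfDensities a b fun i x => C i * w i x) :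
    -- the process started in `[a, b]` is well defined and stays in `[a, b]`
    (∀ x ∈ Icc a b, ∀ i : Fin 2, ∀ᵐ s ∂TelegraphPotential.holdingLaw l i,
      TelegraphPotential.IsTrajectory U c (TelegraphPotential.switching i s) x
        (TelegraphPotential.trajectory U c (TelegraphPotential.switching i s) x) ∧
      ∀ t, 0 ≤ t →
        TelegraphPotential.trajectory U c (TelegraphPotential.switching i s) x t ∈ Icc a b) ∧
    -- the normalising constants are finite and positive, and give the stated masses
    (∀ i, IntegrableOn (w i) (Ioo a b) ∧ 0 < ∫ x in Ioo a b, w i x) ∧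
    (∀ i, 0 < C i ∧ ∀ x ∈ Ioo a b, 0 < C i * w i x) ∧
    (∫ x in Ioo a b, C 0 * w 0 x = l 1 / (l 0 + l 1)) ∧
    (∫ x in Ioo a b, C 1 * w 1 x = l 0 / (l 0 + l 1)) ∧
    -- the densities define an invariant probability measure with support `G`
    IsProbabilityMeasure μ ∧
    μ (Ioo a b ×ˢ univ)ᶜ = 0 ∧
    μ.support = Icc a b ×ˢ univ ∧
    TelegraphPotential.IsInvariantMeasure U c l μ ∧
    -- and it is the only invariant probability measure carried by `[a, b]`
    (∀ ν : Measure (ℝ × Fin 2), IsProbabilityMeasure ν → ν (Icc a b ×ˢ univ)ᶜ = 0 →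
      TelegraphPotential.IsInvariantMeasure U c l ν → ν = μ) := by
  have hU' := hU.1
  set I : Fin 2 → ℝ := fun i => ∫ x in Ioo a b, TelegraphPotential.weight U c l Φ i x with hI
  have hIpos : ∀ i, 0 < I i := TelegraphPotential.integral_weight_pos hU' hG hl hΦ
  have hIeq : l 0 * I 0 = l 1 * I 1 := TelegraphPotential.mul_integral_weight_eq hU' hG hl hΦ
  have hw : w = TelegraphPotential.weight U c l Φ := by
    funext i x
    rw [TelegraphPotential.weight_eq_div]
    fin_cases i
    · simp [hw0, TelegraphPotential.dirSign]
    · simp [hw1, TelegraphPotential.dirSign]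
  subst hw
  have hL : 0 < l 0 + l 1 := add_pos (hl 0) (hl 1)
  -- λ_1 / ∫ w_0 and λ_0 / ∫ w_1 agree because λ_0 ∫ w_0 = λ_1 ∫ w_1; thus μ is one multiple of the
  -- canonical measure.
  have hC01 : C 1 = C 0 := by
    have h0 := (hIpos 0).ne'
    have h1 := (hIpos 1).ne'
    rw [hC0, hC1]
    change l 0 / (l 0 + l 1) * (I 1)⁻¹ = l 1 / (l 0 + l 1) * (I 0)⁻¹
    field_simp
    linarith
  have hCpos : ∀ i, 0 < C i := by
    have h : 0 < C 0 := by
      rw [hC0]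
      exact mul_pos (div_pos (hl 1) hL) (inv_pos.2 (hIpos 0))
    intro i
    fin_cases i
    · exact h
    · exact hC01 ▸ h
  have hint0 : ∫ x in Ioo a b, C 0 * TelegraphPotential.weight U c l Φ 0 x =
      l 1 / (l 0 + l 1) := by
    rw [integral_const_mul, hC0, mul_assoc, inv_mul_cancel₀ (hIpos 0).ne', mul_one]
  have hint1 : ∫ x in Ioo a b, C 1 * TelegraphPotential.weight U c l Φ 1 x =
      l 0 / (l 0 + l 1) := by
    rw [integral_const_mul, hC1, mul_assoc, inv_mul_cancel₀ (hIpos 1).ne', mul_one]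
  have hCi : ∀ i, C i = C 0 := fun i => by
    fin_cases i
    · rfl
    · exact hC01
  have hμ' : μ = TelegraphPotential.stationaryMeasure U c l a b Φ (C 0) := by
    rw [hμ, ← TelegraphPotential.measureOfDensities_eq_stationaryMeasure (hCpos 0).le]
    simp only [hCi]
  have hmass : C 0 * ∑ i, I i = 1 := by
    rw [Fin.sum_univ_two, mul_add]
    rw [integral_const_mul] at hint0 hint1
    rw [hC01] at hint1
    change C 0 * I 0 = _ at hint0
    change C 0 * I 1 = _ at hint1
    rw [hint0, hint1]
    field_simp
    ring
  subst hμ'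
  have hprob : IsProbabilityMeasure (TelegraphPotential.stationaryMeasure U c l a b Φ (C 0)) :=
    ⟨by rw [TelegraphPotential.stationaryMeasure_univ hU' hG hl hΦ (hCpos 0).le]
        change ENNReal.ofReal (C 0 * ∑ i, I i) = 1
        rw [hmass, ENNReal.ofReal_one]⟩
  refine ⟨fun x hx i => ?_, fun i => ⟨TelegraphPotential.integrableOn_weight hU' hG hl hΦ i,
    hIpos i⟩, fun i => ⟨hCpos i, fun x hx => mul_pos (hCpos i)
      (TelegraphPotential.weight_pos hG i hx)⟩, hint0, hint1, hprob,
    TelegraphPotential.stationaryMeasure_compl _,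
    TelegraphPotential.support_stationaryMeasure hU' hG hΦ (hCpos 0),
    TelegraphPotential.isInvariantMeasure_stationaryMeasure hU' hG hl hΦ _,
    fun ν hν hνab hinv => ?_⟩
  · filter_upwards [TelegraphPotential.ae_mem_goodTimes hl i] with s hs
    have hm := TelegraphPotential.measurable_switching i hs
    exact ⟨TelegraphPotential.isTrajectory_trajectory hU' hG hm hx,
      fun t ht => TelegraphPotential.trajectory_mem hU' hG hm hx ht⟩
  · have hae : ∀ᵐ z ∂ν, z.1 ∈ Icc a b := by
      rw [ae_iff]
      have hsub : {z : ℝ × Fin 2 | z.1 ∉ Icc a b} ⊆ (Icc a b ×ˢ univ)ᶜ := fun z hz h => hz h.1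
      exact measure_mono_null hsub hνab
    -- ν is some multiple of the canonical measure; total mass one forces the same multiple as for
    -- μ.
    obtain ⟨K, hK, hνK⟩ := TelegraphPotential.eq_stationaryMeasure hU' hG hl hΦ hae hinv
    have h1 := hν.measure_univ
    rw [hνK, TelegraphPotential.stationaryMeasure_univ hU' hG hl hΦ hK,
      ENNReal.ofReal_eq_one] at h1
    change K * ∑ i, I i = 1 at h1
    have hS : ∑ i, I i ≠ 0 := right_ne_zero_of_mul (h1 ▸ one_ne_zero)
    rw [hνK, mul_right_cancel₀ hS (h1.trans hmass.symm)]
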